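/- Work in homotopy type theory: intensional Martin-Löf type theory with universes $\mathcal U_0:\mathcal U_1:\cdots$, dependent products (with $\eta$), dependent sums, empty and unit types, binary sums, identity types, function extensionality, and the higher inductive families $W_{S,\mathrm{Pos}}^{P}$ described below. Fix an (external) integer $n\ge 0$; of univalence, only univalence for $(n-1)$-types is assumed: for all $i$, the family $X\mapsto X$ over the subtype $\sum_{X:\mathcal U_i}\mathrm{isTrunc}_{n-1}(X)$ is univalent. Given a type $I$, an $I$-indexed container $(S,\mathrm{Pos})$ consists of types $S(i)$ for $i:I$ and $\mathrm{Pos}(i,s,j)$ for $i:I$, $s:S(i)$, $j:I$. Its extension sends a family $F$ over $I$ to $\mathrm{Ext}(F,i)=\sum_{s:S(i)}\prod_{j:I}\big(\mathrm{Pos}(i,s,j)\to F(j)\big)$. For a family $P$ of propositions over $I$, the $P$-propositional indexed W-type $W=W_{S,\mathrm{Pos}}^{P}$ is the higher inductive family over $I$ generated by a point constructor $\sup:\mathrm{Ext}(W,i)\to W(i)$ for $i:I$ and a path constructor $w_0=_{W(i)}w_1$ for all $i:I$ with $P(i)$ and all $w_0,w_1:W(i)$; its computation rule is required only up to the identity type.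 The container retains $n$-truncatedness if for every family $F$ over $I$ (it suffices: valued in the universe in which $W$ lives), all $i_0,i_1:I$ and all $(s_b,t_b):\mathrm{Ext}(F,i_b)$ for $b\in\{0,1\}$: if for all $j_0,j_1:I$, $p_0:\mathrm{Pos}(i_0,s_0,j_0)$ and $p_1:\mathrm{Pos}(i_1,s_1,j_1)$ the type $\sum_{q:j_0=j_1}\big(t_0(j_0,p_0)=_{F(q)}t_1(j_1,p_1)\big)$ is $(n-1)$-truncated, then the type $(i_0,s_0,t_0)=(i_1,s_1,t_1)$ of equalities in $\sum_{i:I}\mathrm{Ext}(F,i)$ is $(n-1)$-truncated. **Theorem.** Let $U$ be a universe (a type with a family of types $\mathrm{El}(X)$, $X:U$, left implicit; for example some $\mathcal U_i$) that is univalent for $(n-1)$-types, and let $U^{\le n}=\sum_{X:U}\mathrm{isTrunc}_n(X)$ be its subuniverse of $n$-types. Let $(S,\mathrm{Pos})$ be a $U^{\le n}$-indexed container that retains $n$-truncatedness, and let $P$ be a family of propositions over $U^{\le n}$ such that $P(X)$ implies that $X$ is $(n-1)$-truncated. Then the type $$V=\sum_{X:U^{\le n}}\mathrm{inV}(X),\qquad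 \mathrm{inV}=W_{S,\mathrm{Pos}}^{P},$$ is $n$-truncated. That is, for all universe levels of the data, the closed type expressing this statement is inhabited by a closed term of the type theory. -/

import Mathlib

/-!
# Homotopy type theory as a formal system

The objects of the theorem live inside homotopy type theory: identity types have no uniqueness
of identity proofs, and universes are (partially) univalent.  So the type theory itself is
defined here: raw terms with de Bruijn indices, conversion, and the typing judgement.
A theorem of homotopy type theory is a closed type with a closed inhabitant.

The theory has: universes `U 0 : U 1 : ...`, dependent products (with eta), dependent sums,
the empty type, the unit type, binary sums, identity types, function extensionality, univalence
for `(n-1)`-types, and partially propositional indexed W-types, whose computation rule holds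
only up to the identity type.
-/

namespace HoTT

/-- The constants of the theory. The numerical arguments are universe levels. -/
inductive Const : Type
  | sig (i j : ℕ) | pair (i j : ℕ) | split (i j k : ℕ)
  | empty (i : ℕ) | emptyElim (i k : ℕ)
  | unit (i : ℕ) | star (i : ℕ) | unitElim (i k : ℕ)
  | sum (i j : ℕ) | inl (i j : ℕ) | inr (i j : ℕ) | sumElim (i j k : ℕ)
  | id (i : ℕ) | refl (i : ℕ) | J (i k : ℕ)
  | funext (i j : ℕ)
  | ua (i : ℕ)
  | W (k a b c : ℕ) | sup (k a b c : ℕ) | trunc (k a b c : ℕ)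
  | wElim (k a b c l : ℕ) | wBeta (k a b c l : ℕ)

/-- Raw terms, with de Bruijn indices. In `pi A B` and `lam A t` the second argument is under
one binder. -/
inductive Tm : Type
  | var (k : ℕ)
  | U (i : ℕ)
  | pi (A B : Tm)
  | lam (A t : Tm)
  | app (f a : Tm)
  | const (c : Const)

namespace Tm

/-- Lift a renaming under a binder. -/
def upr (ρ : ℕ → ℕ) : ℕ → ℕ
  | 0 => 0
  | k + 1 => ρ k + 1

def rename : (ℕ → ℕ) → Tm → Tm
  | ρ, var k => var (ρ k)
  | _, U i => U i
  | ρ, pi A B => pi (rename ρ A) (rename (upr ρ) B)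
  | ρ, lam A t => lam (rename ρ A) (rename (upr ρ) t)
  | ρ, app f a => app (rename ρ f) (rename ρ a)
  | _, const c => const c

/-- Weakening by one variable. -/
def shift (t : Tm) : Tm := rename Nat.succ t

/-- Lift a substitution under a binder. -/
def ups (σ : ℕ → Tm) : ℕ → Tm
  | 0 => var 0
  | k + 1 => shift (σ k)

def subst : (ℕ → Tm) → Tm → Tm
  | σ, var k => σ k
  | _, U i => U i
  | σ, pi A B => pi (subst σ A) (subst (ups σ) B)
  | σ, lam A t => lam (subst σ A) (subst (ups σ) t)
  | σ, app f a => app (subst σ f) (subst σ a)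
  | _, const c => const c

/-- `inst t a` is `t[a]`: the variable `0` is replaced by `a`. -/
def inst (t a : Tm) : Tm :=
  subst (fun k => match k with
    | 0 => a
    | k + 1 => var k) t

/-- Application to a list of arguments. -/
def apps (f : Tm) (as : List Tm) : Tm := as.foldl app f

end Tm

/-! ### Writing terms with named variables

An `HTm` is a term as a function of the number of binders that enclose it, so that bound
variables can be written as variables of Lean. -/

abbrev HTm : Type := ℕ → Tm

/-- The variable bound by the binder with `d` binders around it. -/
def bvar (d : ℕ) : HTm := fun e => .var (e - (d + 1))

def Pi (A : HTm) (B : HTm → HTm) : HTm := fun d => .pi (A d) (B (bvar d) (d + 1))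

def Lam (A : HTm) (t : HTm → HTm) : HTm := fun d => .lam (A d) (t (bvar d) (d + 1))

def arr (A B : HTm) : HTm := Pi A fun _ => B

def Univ (i : ℕ) : HTm := fun _ => .U i

def ap (f : HTm) (as : List HTm) : HTm := fun d => Tm.apps (f d) (as.map fun a => a d)

def cst (c : Const) (as : List HTm) : HTm := ap (fun _ => .const c) as

/-- A closed term, used at any depth. -/
def closed (t : Tm) : HTm := fun _ => t

/-! ### Abbreviations for the constants

Numerical arguments are the levels of the types that follow. -/

def Sig (i j : ℕ) (A : HTm) (B : HTm → HTm) : HTm := cst (.sig i j) [A, Lam A B]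

def Pair (i j : ℕ) (A : HTm) (B : HTm → HTm) (a b : HTm) : HTm :=
  cst (.pair i j) [A, Lam A B, a, b]

/-- First projection `Σ (x : A), B x → A`. -/
def Fst (i j : ℕ) (A : HTm) (B : HTm → HTm) (z : HTm) : HTm :=
  cst (.split i j i) [A, Lam A B, Lam (Sig i j A B) fun _ => A,
    Lam A fun a => Lam (B a) fun _ => a, z]

def Eq (i : ℕ) (A x y : HTm) : HTm := cst (.id i) [A, x, y]

def Refl (i : ℕ) (A x : HTm) : HTm := cst (.refl i) [A, x]

/-- Based path induction: `C y p` from `d : C x refl`, for `p : x = y`. -/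
def Ind (i k : ℕ) (A x : HTm) (C : HTm → HTm → HTm) (d y p : HTm) : HTm :=
  cst (.J i k) [A, x, Lam A fun y => Lam (Eq i A x y) fun p => C y p, d, y, p]

/-- Transport of `u : F x` along `p : x = y`, for `A : U i` and `F : A → U k`. -/
def Transport (i k : ℕ) (A F x y p u : HTm) : HTm :=
  ap (Ind i k A x (fun y _ => arr (ap F [x]) (ap F [y])) (Lam (ap F [x]) fun u => u) y p) [u]

/-! ### Truncation levels, equivalences, univalence -/

/-- `λ (A : U i), Σ (c : A), Π (x : A), c = x`. -/
def isContrTm (i : ℕ) : Tm :=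
  Lam (Univ i) (fun A => Sig i i A fun c => Pi A fun x => Eq i A c x) 0

/-- `isTruncTm i m : U i → U i` says that a type is `(m-2)`-truncated. -/
def isTruncTm (i : ℕ) : ℕ → Tm
  | 0 => isContrTm i
  | m + 1 => Lam (Univ i) (fun A => Pi A fun x => Pi A fun y =>
      ap (closed (isTruncTm i m)) [Eq i A x y]) 0

/-- `IsTrunc i m A`: the type `A : U i` is `(m-2)`-truncated. So `m = 0` says contractible and
`m = 1` says propositional. -/
def IsTrunc (i m : ℕ) (A : HTm) : HTm := ap (closed (isTruncTm i m)) [A]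

/-- The fiber `Σ (x : A), f x = y`, for `A : U i` and `B : U j`. -/
def Fiber (i j : ℕ) (A B f y : HTm) : HTm := Sig i j A fun x => Eq j B (ap f [x]) y

/-- `f : A → B` has contractible fibers. -/
def IsEquiv (i j : ℕ) (A B f : HTm) : HTm :=
  Pi B fun y => IsTrunc (max i j) 0 (Fiber i j A B f y)

/-- The type of equivalences of `A B : U i`. -/
def Equiv (i : ℕ) (A B : HTm) : HTm := Sig i i (arr A B) fun f => IsEquiv i i A B f

/-- The identity equivalence. Its fiber over `y` has the center `(y, refl)`; the contraction
at `(x, p)` is by induction on `p : x = y`. -/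
def IdEquiv (i : ℕ) (A : HTm) : HTm :=
  let idf : HTm := Lam A fun x => x
  let fib : HTm → HTm := fun y => Fiber i i A A idf y
  let pr : HTm → HTm → HTm → HTm := fun y x p =>
    Pair i i A (fun x => Eq i A (ap idf [x]) y) x p
  Pair i i (arr A A) (fun f => IsEquiv i i A A f) idf
    (Lam A fun y =>
      Pair i i (fib y) (fun c => Pi (fib y) fun z => Eq i (fib y) c z)
        (pr y y (Refl i A y))
        (Lam (fib y) fun z =>
          cst (.split i i i) [A, Lam A fun x => Eq i A (ap idf [x]) y,
            Lam (fib y) fun z => Eq i (fib y) (pr y y (Refl i A y)) z,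
            Lam A fun x => Lam (Eq i A x y) fun p =>
              Ind i i A x (fun y p => Eq i (fib y) (pr y y (Refl i A y)) (pr y x p))
                (Refl i (fib x) (pr x x (Refl i A x))) y p,
            z]))

/-- The canonical map `x₀ = x₁ → (Y x₀ ≃ Y x₁)`, sending `refl` to the identity equivalence,
for a family `Y` over `X : U k` valued in `U l`. -/
def IdToEquiv (k l : ℕ) (X : HTm) (Y : HTm → HTm) (x₀ x₁ : HTm) : HTm :=
  Lam (Eq k X x₀ x₁) fun p =>
    Ind k l X x₀ (fun x _ => Equiv l (Y x₀) (Y x)) (IdEquiv l (Y x₀)) x₁ p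

/-- The family `Y` over `X` is univalent. -/
def Univalent (k l : ℕ) (X : HTm) (Y : HTm → HTm) : HTm :=
  Pi X fun x₀ => Pi X fun x₁ =>
    IsEquiv k l (Eq k X x₀ x₁) (Equiv l (Y x₀) (Y x₁)) (IdToEquiv k l X Y x₀ x₁)

/-- The family `Y` over `X` is univalent for `(m-2)`-types: its restriction to the subtype
of those `x : X` with `Y x` an `(m-2)`-type is univalent. -/
def UnivalentFor (m k l : ℕ) (X : HTm) (Y : HTm → HTm) : HTm :=
  Univalent (max k l) l (Sig k l X fun x => IsTrunc l m (Y x))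
    (fun z => Y (Fst k l X (fun x => IsTrunc l m (Y x)) z))

/-! ### Indexed containers and partially propositional indexed W-types -/

/-- The type of `Pos` for an `I`-indexed container: `Π (i : I), S i → I → U b`. -/
def PosTy (b : ℕ) (I S : HTm) : HTm := Pi I fun i => arr (ap S [i]) (arr I (Univ b))

/-- The type `Π (j : I), Pos i s j → F j`. -/
def Args (I Pos F i s : HTm) : HTm := Pi I fun j => arr (ap Pos [i, s, j]) (ap F [j])

/-- The extension `Σ (s : S i), Π (j : I), Pos i s j → F j`, a type in `U m`, where
`S i : U a` and where `m` bounds all levels. -/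
def Ext (a m : ℕ) (I S Pos F i : HTm) : HTm :=
  Sig a m (ap S [i]) fun s => Args I Pos F i s

/-- The level of the W-type. -/
def wLevel (k a b c : ℕ) : ℕ := max k (max a (max b c))

/-- Quantification over `I : U k`, an `I`-indexed container `(S, Pos)`, and a family `P` of
propositions over `I`. -/
def PiData (k a b c : ℕ) (body : HTm → HTm → HTm → HTm → HTm → HTm) : HTm :=
  Pi (Univ k) fun I => Pi (arr I (Univ a)) fun S => Pi (PosTy b I S) fun Pos =>
    Pi (arr I (Univ c)) fun P => Pi (Pi I fun i => IsTrunc c 1 (ap P [i])) fun hP =>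
      body I S Pos P hP

/-- The family `I → U m` given by the W-type. -/
def WFam (k a b c : ℕ) (I S Pos P hP : HTm) : HTm := cst (.W k a b c) [I, S, Pos, P, hP]

/-- `W : I → U m`. -/
def wTy (k a b c : ℕ) : HTm :=
  PiData k a b c fun I _ _ _ _ => arr I (Univ (wLevel k a b c))

/-- The point constructor `sup i s t : W i`, for `s : S i` and `t : Π j, Pos i s j → W j`. -/
def supTy (k a b c : ℕ) : HTm :=
  PiData k a b c fun I S Pos P hP =>
    let W := WFam k a b c I S Pos P hP
    Pi I fun i => Pi (ap S [i]) fun s => arr (Args I Pos W i s) (ap W [i])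

/-- The path constructor `x = y`, for `x y : W i`, given `P i`. -/
def truncTy (k a b c : ℕ) : HTm :=
  PiData k a b c fun I S Pos P hP =>
    let W := WFam k a b c I S Pos P hP
    Pi I fun i => arr (ap P [i]) (Pi (ap W [i]) fun x => Pi (ap W [i]) fun y =>
      Eq (wLevel k a b c) (ap W [i]) x y)

/-- Quantification over the data of an induction on the W-type: a family `X i w` in `U l`, its
value `d i s t` at the point constructor, and the condition that `X i w` is a proposition
if `P i`. -/
def PiWElim (k a b c l : ℕ)
    (body : (I S Pos P hP X d h : HTm) → HTm) : HTm :=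
  PiData k a b c fun I S Pos P hP =>
    let W := WFam k a b c I S Pos P hP
    Pi (Pi I fun i => arr (ap W [i]) (Univ l)) fun X =>
    Pi (Pi I fun i => Pi (ap S [i]) fun s => Pi (Args I Pos W i s) fun t =>
      arr (Pi I fun j => Pi (ap Pos [i, s, j]) fun p => ap X [j, ap t [j, p]])
        (ap X [i, cst (.sup k a b c) [I, S, Pos, P, hP, i, s, t]])) fun d =>
    Pi (Pi I fun i => arr (ap P [i]) (Pi (ap W [i]) fun w => IsTrunc l 1 (ap X [i, w]))) fun h =>
      body I S Pos P hP X d h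

/-- Induction: `X i w` for all `i` and `w : W i`. -/
def wElimTy (k a b c l : ℕ) : HTm :=
  PiWElim k a b c l fun I S Pos P hP X _ _ =>
    Pi I fun i => Pi (ap (WFam k a b c I S Pos P hP) [i]) fun w => ap X [i, w]

/-- The computation rule, as an identity:
`elim i (sup i s t) = d i s t (fun j p => elim j (t j p))`. -/
def wBetaTy (k a b c l : ℕ) : HTm :=
  PiWElim k a b c l fun I S Pos P hP X d h =>
    let elim : HTm → HTm → HTm := fun i w =>
      cst (.wElim k a b c l) [I, S, Pos, P, hP, X, d, h, i, w]
    Pi I fun i => Pi (ap S [i]) fun s => Pi (Args I Pos (WFam k a b c I S Pos P hP) i s) fun t =>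
      let w := cst (.sup k a b c) [I, S, Pos, P, hP, i, s, t]
      Eq l (ap X [i, w]) (elim i w)
        (ap d [i, s, t, Lam I fun j => Lam (ap Pos [i, s, j]) fun p => elim j (ap t [j, p])])

/-! ### The types of the constants -/

/-- The type of a constant, in the theory with univalence for `(n-1)`-types. -/
def Const.hty (n : ℕ) : Const → HTm
  | sig i j => Pi (Univ i) fun A => arr (arr A (Univ j)) (Univ (max i j))
  | pair i j => Pi (Univ i) fun A => Pi (arr A (Univ j)) fun B =>
      Pi A fun a => arr (ap B [a]) (cst (.sig i j) [A, B])
  | split i j k => Pi (Univ i) fun A => Pi (arr A (Univ j)) fun B =>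
      Pi (arr (cst (.sig i j) [A, B]) (Univ k)) fun C =>
      arr (Pi A fun a => Pi (ap B [a]) fun b => ap C [cst (.pair i j) [A, B, a, b]])
        (Pi (cst (.sig i j) [A, B]) fun z => ap C [z])
  | empty i => Univ i
  | emptyElim i k => Pi (arr (cst (.empty i) []) (Univ k)) fun C =>
      Pi (cst (.empty i) []) fun z => ap C [z]
  | unit i => Univ i
  | star i => cst (.unit i) []
  | unitElim i k => Pi (arr (cst (.unit i) []) (Univ k)) fun C =>
      arr (ap C [cst (.star i) []]) (Pi (cst (.unit i) []) fun z => ap C [z])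
  | sum i j => arr (Univ i) (arr (Univ j) (Univ (max i j)))
  | inl i j => Pi (Univ i) fun A => Pi (Univ j) fun B => arr A (cst (.sum i j) [A, B])
  | inr i j => Pi (Univ i) fun A => Pi (Univ j) fun B => arr B (cst (.sum i j) [A, B])
  | sumElim i j k => Pi (Univ i) fun A => Pi (Univ j) fun B =>
      Pi (arr (cst (.sum i j) [A, B]) (Univ k)) fun C =>
      arr (Pi A fun a => ap C [cst (.inl i j) [A, B, a]])
        (arr (Pi B fun b => ap C [cst (.inr i j) [A, B, b]])
          (Pi (cst (.sum i j) [A, B]) fun z => ap C [z]))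
  | id i => Pi (Univ i) fun A => arr A (arr A (Univ i))
  | refl i => Pi (Univ i) fun A => Pi A fun x => Eq i A x x
  | J i k => Pi (Univ i) fun A => Pi A fun x =>
      Pi (Pi A fun y => arr (Eq i A x y) (Univ k)) fun C =>
      arr (ap C [x, Refl i A x]) (Pi A fun y => Pi (Eq i A x y) fun p => ap C [y, p])
  | funext i j => Pi (Univ i) fun A => Pi (arr A (Univ j)) fun B =>
      Pi (Pi A fun x => ap B [x]) fun f => Pi (Pi A fun x => ap B [x]) fun g =>
      arr (Pi A fun x => Eq j (ap B [x]) (ap f [x]) (ap g [x]))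
        (Eq (max i j) (Pi A fun x => ap B [x]) f g)
  | ua i => UnivalentFor (n + 1) (i + 1) i (Univ i) (fun X => X)
  | W k a b c => wTy k a b c
  | sup k a b c => supTy k a b c
  | trunc k a b c => truncTy k a b c
  | wElim k a b c l => wElimTy k a b c l
  | wBeta k a b c l => wBetaTy k a b c l

/-- The type of a constant as a closed term. -/
def Const.ty (n : ℕ) (c : Const) : Tm := c.hty n 0

/-! ### Judgements -/

open Tm in
/-- Judgmental equality: the congruence generated by beta and eta for functions and the
computation rules of dependent sums, the unit type, binary sums and identity types. -/
inductive Conv : Tm → Tm → Prop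
  | refl (t) : Conv t t
  | symm {t u} : Conv t u → Conv u t
  | trans {t u v} : Conv t u → Conv u v → Conv t v
  | pi {A A' B B'} : Conv A A' → Conv B B' → Conv (pi A B) (pi A' B')
  | lam {A A' t t'} : Conv A A' → Conv t t' → Conv (lam A t) (lam A' t')
  | app {f f' a a'} : Conv f f' → Conv a a' → Conv (app f a) (app f' a')
  | beta (A t a) : Conv (app (lam A t) a) (inst t a)
  | eta (A f) : Conv (lam A (app (shift f) (var 0))) f
  | split (i j k A B C f a b) :
      Conv (apps (const (.split i j k)) [A, B, C, f, apps (const (.pair i j)) [A, B, a, b]])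
        (apps f [a, b])
  | unitElim (i k C d) : Conv (apps (const (.unitElim i k)) [C, d, const (.star i)]) d
  | sumInl (i j k A B C f g a) :
      Conv (apps (const (.sumElim i j k)) [A, B, C, f, g, apps (const (.inl i j)) [A, B, a]])
        (app f a)
  | sumInr (i j k A B C f g b) :
      Conv (apps (const (.sumElim i j k)) [A, B, C, f, g, apps (const (.inr i j)) [A, B, b]])
        (app g b)
  | J (i k A x C d) :
      Conv (apps (const (.J i k)) [A, x, C, d, x, apps (const (.refl i)) [A, x]]) d

/-- The typing judgement `Γ ⊢ t : A` of the theory with univalence for `(n-1)`-types. The head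
of the list `Γ` is the type of the variable `0`. A context is extended only by types, so that
in a derivation that ends in the empty context all contexts are well-formed. -/
inductive Typing (n : ℕ) : List Tm → Tm → Tm → Prop
  | var {Γ : List Tm} {k : ℕ} {A : Tm} :
      Γ[k]? = some A → Typing n Γ (.var k) (A.rename (· + (k + 1)))
  | univ (Γ : List Tm) (i : ℕ) : Typing n Γ (.U i) (.U (i + 1))
  | pi {Γ : List Tm} {A B : Tm} {i j : ℕ} :
      Typing n Γ A (.U i) → Typing n (A :: Γ) B (.U j) → Typing n Γ (.pi A B) (.U (max i j))
  | lam {Γ : List Tm} {A B t : Tm} {i j : ℕ} :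
      Typing n Γ A (.U i) → Typing n (A :: Γ) B (.U j) → Typing n (A :: Γ) t B →
      Typing n Γ (.lam A t) (.pi A B)
  | app {Γ : List Tm} {A B f a : Tm} :
      Typing n Γ f (.pi A B) → Typing n Γ a A → Typing n Γ (.app f a) (B.inst a)
  | const (Γ : List Tm) (c : Const) : Typing n Γ (.const c) (c.ty n)
  | conv {Γ : List Tm} {t A B : Tm} {i : ℕ} :
      Typing n Γ t A → Conv A B → Typing n Γ B (.U i) → Typing n Γ t B

/-- The closed type `A` is a theorem of homotopy type theory with univalence for
`(n-1)`-types: it is a type, and it has a closed inhabitant. -/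
def Provable (n : ℕ) (A : HTm) : Prop :=
  (∃ i, Typing n [] (A 0) (.U i)) ∧ ∃ t, Typing n [] t (A 0)

/-! ### The notions of the theorem -/

/-- The subuniverse `Σ (X : U), isTrunc n (El X)` of `n`-types of a universe `(U, El)`, where
`U` is a type in `U k` and `El : U → U l`. -/
def NTypes (n k l : ℕ) (U El : HTm) : HTm := Sig k l U fun X => IsTrunc l (n + 2) (ap El [X])

/-- The decoding of an element of the subuniverse of `n`-types. -/
def NTypes.El (n k l : ℕ) (U El X : HTm) : HTm :=
  ap El [Fst k l U (fun X => IsTrunc l (n + 2) (ap El [X])) X]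

/-- The `I`-indexed container `(S, Pos)` retains `n`-truncatedness. Here `I : U k`,
`S : I → U a`, and `m` is the level of the families `F` over `I`. For `(s₀, t₀)` in the
extension at `i₀` and `(s₁, t₁)` in the extension at `i₁`: if
`Σ (q : j₀ = j₁), t₀ j₀ p₀ =_{F(q)} t₁ j₁ p₁` is `(n-1)`-truncated for all `j₀ j₁ p₀ p₁`, then
`(i₀, s₀, t₀) = (i₁, s₁, t₁)` is `(n-1)`-truncated. -/
def Retains (n k a m : ℕ) (I S Pos : HTm) : HTm :=
  Pi (arr I (Univ m)) fun F =>
  Pi I fun i₀ => Pi I fun i₁ =>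
  Pi (ap S [i₀]) fun s₀ => Pi (Args I Pos F i₀ s₀) fun t₀ =>
  Pi (ap S [i₁]) fun s₁ => Pi (Args I Pos F i₁ s₁) fun t₁ =>
  arr
    (Pi I fun j₀ => Pi I fun j₁ =>
      Pi (ap Pos [i₀, s₀, j₀]) fun p₀ => Pi (ap Pos [i₁, s₁, j₁]) fun p₁ =>
      IsTrunc m (n + 1) (Sig k m (Eq k I j₀ j₁) fun q =>
        Eq m (ap F [j₁]) (Transport k m I F j₀ j₁ q (ap t₀ [j₀, p₀])) (ap t₁ [j₁, p₁])))
    (let E : HTm → HTm := fun i => Ext a m I S Pos F i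
     let el : HTm → HTm → HTm → HTm := fun i s t =>
      Pair k m I E i (Pair a m (ap S [i]) (fun s => Args I Pos F i s) s t)
     IsTrunc m (n + 1) (Eq m (Sig k m I E) (el i₀ s₀ t₀) (el i₁ s₁ t₁)))

/-- The statement, as a type: for every universe `(U, El)` that is univalent for `(n-1)`-types,
every container `(S, Pos)` indexed by its subuniverse `I` of `n`-types that retains
`n`-truncatedness, and every family `P` of propositions over `I` such that `P X` implies that
`X` is `(n-1)`-truncated, the type `Σ (X : I), inV X` is `n`-truncated, where `inV` is the
`P`-propositional indexed W-type of `(S, Pos)`. -/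
def VTruncated (n k l a b c : ℕ) : HTm :=
  let κ := max k l
  let m := wLevel κ a b c
  Pi (Univ k) fun U => Pi (arr U (Univ l)) fun El =>
  arr (UnivalentFor (n + 1) k l U (fun X => ap El [X])) <|
    let I := NTypes n k l U El
    Pi (arr I (Univ a)) fun S => Pi (PosTy b I S) fun Pos =>
    Pi (arr I (Univ c)) fun P => Pi (Pi I fun X => IsTrunc c 1 (ap P [X])) fun hP =>
    arr (Retains n κ a m I S Pos) <|
    arr (Pi I fun X => arr (ap P [X]) (IsTrunc l (n + 1) (NTypes.El n k l U El X))) <|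
    IsTrunc m (n + 2) (Sig κ m I fun X => ap (WFam κ a b c I S Pos P hP) [X])

end HoTT

/-!
# Truncatedness of propositional indexed W-types, inside homotopy type theory

The theorem asks for a derivation in the formal type theory, and a derivation of this size is not
written down as a tree. It is produced by a verified type checker. Terms with symbolic levels and
with references to earlier lemmas (`Sym.R`) have a type inference algorithm `Sym.R.infer` and a
test for convertibility `Sym.R.conv`, which are sound for the judgements of the theory
(`Sym.R.infer_sound`, `Sym.R.conv_sound`). Levels stay variables, so that one run of the checker
covers all values of `k l a b c` and of `n`. The truncation index is external to the theory;
`Sym.Thm.of_provesByInduction` turns an induction on it into an induction in Lean, where the terms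
of the base case and of the induction step are type-checked. By `Sym.thm_of_checkAll`, the
statements in a list of lemmas whose proofs the checker accepts are theorems of the type theory,
and the kernel evaluates the checker on the list `Sym.allEntries`. Subject reduction and the
normalization of terms play no role: a type that is the result of a reduction is checked again.

The lemmas are written in a surface syntax (`Sym.E`) in which binders are those of Lean and
implicit arguments are found by unification. The mathematical argument is the following.

Let `W` be a `P`-propositional indexed W-type over `I`. Equalities of its elements are described by
codes. For `x₀` and `x₁` in the extension of the container and `p : i₀ = i₁`, the code of the
equalities of `sup x₀` and `sup x₁` over `p` is the join `P i₁ ⋆ A p`, where `A p` is the type of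
the equalities of `x₀` and `x₁` over `p`. The join with a proposition is itself a propositional
indexed W-type, with `A p` and `P i₁` as constructors and without arguments (`Sym.closedData`), so
no further higher inductive type is needed. As `P i₁ ⋆ A p` is contractible if `P i₁` holds, and
as contractible types are equal by univalence, the codes extend from the elements `sup x₁` to all
of `W` (`Sym.extendFam`); the encode-decode method shows that the type of equalities is a retract
of the type of codes (`Sym.truncSup`). It remains to bound the truncation level of
`Σ p, P i₁ ⋆ A p` by that of `Σ p, A p`, which is the type of equalities in the extension. This is
`Sym.truncClosed`, by induction on the level: since `x ↦ P ⋆ A x` is a W-type, its equalities are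
again of the form `P ⋆ A'`, with a level that is smaller by one. Where `P` holds, the level is that
of the equalities of the indices.

So the equalities of elements `sup x₀` and `sup x₁` of `W` are `(n-1)`-truncated if those of the
extension are, and if `i₀ = i₁` is `(n-1)`-truncated whenever `P i₁` holds (`Sym.wPath`). For a
container that retains `n`-truncatedness, induction on `W` gives the first condition, and so `W` has
an `n`-truncated total space (`Sym.truncW`). For the subuniverse of `n`-types of `U`, the second
condition holds since `P Y` implies that `Y` is an `(n-1)`-type: if there is an equality `X = Y` at
all, then `X` is an `(n-1)`-type too, and by univalence `X = Y` is a type of equivalences of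
`(n-1)`-types (`Sym.truncNTypes`).
-/

namespace HoTT

/-! ### Substitution -/

namespace Tm

theorem upr_comp (ρ τ : ℕ → ℕ) : upr (fun k => ρ (τ k)) = fun k => upr ρ (upr τ k) := by
  funext k; cases k <;> rfl

theorem rename_rename (t : Tm) : ∀ ρ τ : ℕ → ℕ,
    rename ρ (rename τ t) = rename (fun k => ρ (τ k)) t := by
  induction t <;> intro ρ τ <;> simp_all [rename, upr_comp]

theorem ups_upr (σ : ℕ → Tm) (τ : ℕ → ℕ) :
    ups (fun k => σ (τ k)) = fun k => ups σ (upr τ k) := by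
  funext k; cases k <;> rfl

theorem subst_rename (t : Tm) : ∀ (σ : ℕ → Tm) (τ : ℕ → ℕ),
    subst σ (rename τ t) = subst (fun k => σ (τ k)) t := by
  induction t <;> intro σ τ <;> simp_all [rename, subst, ups_upr]

theorem rename_shift (ρ : ℕ → ℕ) (t : Tm) : rename (upr ρ) (shift t) = shift (rename ρ t) := by
  simp only [shift, rename_rename]; rfl

theorem rename_ups (ρ : ℕ → ℕ) (σ : ℕ → Tm) :
    ups (fun k => rename ρ (σ k)) = fun k => rename (upr ρ) (ups σ k) := by
  funext k; cases k with
  | zero => rfl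
  | succ k => exact (rename_shift ρ (σ k)).symm

theorem rename_subst (t : Tm) : ∀ (ρ : ℕ → ℕ) (σ : ℕ → Tm),
    rename ρ (subst σ t) = subst (fun k => rename ρ (σ k)) t := by
  induction t <;> intro ρ σ <;> simp_all [rename, subst, rename_ups]

theorem subst_shift (σ : ℕ → Tm) (t : Tm) : subst (ups σ) (shift t) = shift (subst σ t) := by
  simp only [shift, subst_rename, rename_subst]; rfl

theorem subst_ups (σ τ : ℕ → Tm) :
    ups (fun k => subst σ (τ k)) = fun k => subst (ups σ) (ups τ k) := by
  funext k; cases k with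
  | zero => rfl
  | succ k => exact (subst_shift σ (τ k)).symm

theorem subst_subst (t : Tm) : ∀ σ τ : ℕ → Tm,
    subst σ (subst τ t) = subst (fun k => subst σ (τ k)) t := by
  induction t <;> intro σ τ <;> simp_all [subst, subst_ups]

theorem ups_var : ups var = var := by
  funext k; cases k <;> rfl

theorem subst_var (t : Tm) : subst var t = t := by
  induction t <;> simp_all [subst, ups_var]

theorem ups_ren (ρ : ℕ → ℕ) : ups (fun k => var (ρ k)) = fun k => var (upr ρ k) := by
  funext k; cases k <;> rfl

theorem rename_eq_subst (t : Tm) : ∀ ρ : ℕ → ℕ, rename ρ t = subst (fun k => var (ρ k)) t := by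
  induction t <;> intro ρ <;> simp_all [rename, subst, ups_ren]

/-- The substitution of `a` for the variable `0`. -/
def single (a : Tm) : ℕ → Tm
  | 0 => a
  | k + 1 => var k

theorem inst_eq (t a : Tm) : inst t a = subst (single a) t := by
  unfold inst; congr 1

theorem inst_shift (t a : Tm) : inst (shift t) a = t := by
  rw [inst_eq, shift, subst_rename]; exact subst_var t

theorem subst_inst (σ : ℕ → Tm) (t a : Tm) :
    subst σ (inst t a) = inst (subst (ups σ) t) (subst σ a) := by
  rw [inst_eq, inst_eq, subst_subst, subst_subst]
  congr 1; funext k; cases k with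
  | zero => rfl
  | succ k =>
    change σ k = subst _ (shift (σ k))
    rw [← inst_eq, inst_shift]

/-- All free variables of the term are below `d`. -/
def Scoped : ℕ → Tm → Prop
  | d, var k => k < d
  | _, U _ => True
  | d, pi A B => Scoped d A ∧ Scoped (d + 1) B
  | d, lam A t => Scoped d A ∧ Scoped (d + 1) t
  | d, app f a => Scoped d f ∧ Scoped d a
  | _, const _ => True

theorem Scoped.subst_eq {t : Tm} : ∀ {d : ℕ} {σ : ℕ → Tm}, Scoped d t →
    (∀ k < d, σ k = var k) → subst σ t = t := by
  have up : ∀ {d : ℕ} {σ : ℕ → Tm}, (∀ k < d, σ k = var k) → ∀ k < d + 1, ups σ k = var k := by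
    intro d σ h k hk
    cases k with
    | zero => rfl
    | succ k => simp [ups, h k (by omega), shift, rename]
  induction t with
  | var k => intro d σ h hσ; exact hσ k h
  | U i => intros; rfl
  | pi A B ihA ihB => intro d σ h hσ; simp [subst, ihA h.1 hσ, ihB h.2 (up hσ)]
  | lam A B ihA ihB => intro d σ h hσ; simp [subst, ihA h.1 hσ, ihB h.2 (up hσ)]
  | app A B ihA ihB => intro d σ h hσ; simp [subst, ihA h.1 hσ, ihB h.2 hσ]
  | const c => intros; rfl

/-- A term is closed if every substitution leaves it unchanged. -/
def Closed (t : Tm) : Prop := ∀ σ, subst σ t = t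

theorem Scoped.closed {t : Tm} (h : Scoped 0 t) : Closed t := fun _ =>
  h.subst_eq fun k hk => absurd hk (Nat.not_lt_zero k)

theorem Closed.rename_eq {t : Tm} (h : Closed t) (ρ : ℕ → ℕ) : rename ρ t = t := by
  rw [rename_eq_subst]; exact h _

end Tm

open Tm

theorem isTruncTm_closed (i m : ℕ) : Closed (isTruncTm i m) := by
  induction m with
  | zero => intro σ; rfl
  | succ m ih =>
    intro σ
    simp [isTruncTm, Lam, Pi, ap, closed, Eq, cst, Univ, bvar, apps, subst, ih _, ups, shift,
      rename]

theorem Const.ty_closed (n : ℕ) (c : Const) : Closed (c.ty n) := by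
  intro σ
  cases c
  case ua i =>
    have h := isTruncTm_closed i (n + 1)
    simp [Const.ty, Const.hty, UnivalentFor, Univalent, Pi, Univ, Sig, IsTrunc, IsEquiv, Fiber,
      IdToEquiv, Lam, ap, closed, Eq, cst, bvar, apps, subst, h _, ups, shift, rename,
      Ind, IdEquiv, Pair, Fst, Equiv, Refl, isTruncTm_closed i 0 _,
      isTruncTm_closed (i + 1) 0 _, arr]
  all_goals rfl

/-! ### Stability of the judgements under substitution -/

theorem subst_apps (σ : ℕ → Tm) (as : List Tm) : ∀ f : Tm,
    subst σ (apps f as) = apps (subst σ f) (as.map (subst σ)) := by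
  induction as with
  | nil => intro f; rfl
  | cons a as ih => intro f; exact ih (app f a)

theorem Conv.subst {t u : Tm} (h : Conv t u) : ∀ σ, Conv (t.subst σ) (u.subst σ) := by
  induction h with
  | refl t => exact fun σ => .refl _
  | symm _ ih => exact fun σ => (ih σ).symm
  | trans _ _ ih₁ ih₂ => exact fun σ => (ih₁ σ).trans (ih₂ σ)
  | pi _ _ ih₁ ih₂ => exact fun σ => .pi (ih₁ σ) (ih₂ _)
  | lam _ _ ih₁ ih₂ => exact fun σ => .lam (ih₁ σ) (ih₂ _)
  | app _ _ ih₁ ih₂ => exact fun σ => .app (ih₁ σ) (ih₂ σ)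
  | beta A t a => intro σ; rw [subst_inst]; exact .beta _ _ _
  | eta A f =>
    intro σ
    simp only [Tm.subst, subst_shift]
    exact .eta _ _
  | split => intro σ; simp only [subst_apps, List.map, Tm.subst]; exact .split ..
  | unitElim => intro σ; simp only [subst_apps, List.map, Tm.subst]; exact .unitElim ..
  | sumInl => intro σ; simp only [subst_apps, List.map, Tm.subst]; exact .sumInl ..
  | sumInr => intro σ; simp only [subst_apps, List.map, Tm.subst]; exact .sumInr ..
  | J => intro σ; simp only [subst_apps, List.map, Tm.subst]; exact .J ..

theorem Conv.rename {t u : Tm} (h : Conv t u) (ρ : ℕ → ℕ) : Conv (t.rename ρ) (u.rename ρ) := by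
  simpa only [rename_eq_subst] using h.subst _

theorem Typing.scoped {n : ℕ} {Γ : List Tm} {t A : Tm} (h : Typing n Γ t A) :
    Scoped Γ.length t := by
  induction h with
  | var h => exact (List.getElem?_eq_some_iff.1 h).1
  | univ => trivial
  | pi _ _ ih₁ ih₂ => exact ⟨ih₁, ih₂⟩
  | lam _ _ _ ih₁ _ ih₃ => exact ⟨ih₁, ih₃⟩
  | app _ _ ih₁ ih₂ => exact ⟨ih₁, ih₂⟩
  | const => trivial
  | conv _ _ _ ih => exact ih

theorem Typing.closed {n : ℕ} {t A : Tm} (h : Typing n [] t A) : Closed t := h.scoped.closed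

/-- The type of the variable `k` in the context `Γ` is `B`. -/
def VarTy (Γ : List Tm) (k : ℕ) (B : Tm) : Prop :=
  ∃ A, Γ[k]? = some A ∧ B = A.rename (· + (k + 1))

theorem VarTy.zero (Γ : List Tm) (A : Tm) : VarTy (A :: Γ) 0 (shift A) := ⟨A, rfl, rfl⟩

theorem VarTy.succ {Γ : List Tm} {k : ℕ} {B : Tm} (C : Tm) (h : VarTy Γ k B) :
    VarTy (C :: Γ) (k + 1) (shift B) := by
  obtain ⟨A, hA, rfl⟩ := h
  refine ⟨A, by simpa using hA, ?_⟩
  rw [shift, rename_rename]; rfl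

/-- A typed variable of an extended context is the new variable or an old one. -/
theorem VarTy.cases {Γ : List Tm} {C : Tm} {k : ℕ} {B : Tm} (h : VarTy (C :: Γ) k B) :
    (k = 0 ∧ B = shift C) ∨ ∃ j B', k = j + 1 ∧ VarTy Γ j B' ∧ B = shift B' := by
  obtain ⟨A, hA, rfl⟩ := h
  cases k with
  | zero => simp at hA; subst hA; exact .inl ⟨rfl, rfl⟩
  | succ k =>
    refine .inr ⟨k, _, rfl, ⟨A, by simpa using hA, rfl⟩, ?_⟩
    rw [shift, rename_rename]; rfl

theorem VarTy.typing {n : ℕ} {Γ : List Tm} {k : ℕ} {B : Tm} (h : VarTy Γ k B) :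
    Typing n Γ (.var k) B := by
  obtain ⟨A, hA, rfl⟩ := h; exact .var hA

theorem Typing.rename {n : ℕ} {Γ : List Tm} {t A : Tm} (h : Typing n Γ t A) :
    ∀ {Δ : List Tm} {ρ : ℕ → ℕ}, (∀ k B, VarTy Γ k B → VarTy Δ (ρ k) (B.rename ρ)) →
      Typing n Δ (t.rename ρ) (A.rename ρ) := by
  have up : ∀ {Γ Δ : List Tm} {ρ : ℕ → ℕ} (C : Tm),
      (∀ k B, VarTy Γ k B → VarTy Δ (ρ k) (B.rename ρ)) →
      ∀ k B, VarTy (C :: Γ) k B → VarTy (C.rename ρ :: Δ) (upr ρ k) (B.rename (upr ρ)) := by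
    intro Γ Δ ρ C h k B hB
    rcases hB.cases with ⟨rfl, rfl⟩ | ⟨j, B', rfl, hB', rfl⟩ <;> rw [rename_shift]
    · exact .zero _ _
    · exact (h _ _ hB').succ _
  induction h with
  | var h => exact fun hρ => (hρ _ _ ⟨_, h, rfl⟩).typing
  | univ => exact fun _ => .univ _ _
  | pi _ _ ih₁ ih₂ => exact fun hρ => .pi (ih₁ hρ) (ih₂ (up _ hρ))
  | lam _ _ _ ih₁ ih₂ ih₃ => exact fun hρ => .lam (ih₁ hρ) (ih₂ (up _ hρ)) (ih₃ (up _ hρ))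
  | app _ _ ih₁ ih₂ =>
    intro Δ ρ hρ
    have := (ih₁ hρ).app (ih₂ hρ)
    rwa [rename_eq_subst (inst _ _), subst_inst, ups_ren, ← rename_eq_subst, ← rename_eq_subst]
  | const Γ c =>
    intro Δ ρ _
    rw [(c.ty_closed n).rename_eq]; exact .const _ _
  | conv _ hc _ ih₁ ih₂ => exact fun hρ => (ih₁ hρ).conv (hc.rename _) (ih₂ hρ)

theorem Typing.shift {n : ℕ} {Γ : List Tm} {t A : Tm} (C : Tm) (h : Typing n Γ t A) :
    Typing n (C :: Γ) (Tm.shift t) (Tm.shift A) :=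
  h.rename fun _ _ hB => hB.succ C

theorem Typing.subst {n : ℕ} {Γ : List Tm} {t A : Tm} (h : Typing n Γ t A) :
    ∀ {Δ : List Tm} {σ : ℕ → Tm}, (∀ k B, VarTy Γ k B → Typing n Δ (σ k) (B.subst σ)) →
      Typing n Δ (t.subst σ) (A.subst σ) := by
  have up : ∀ {Γ Δ : List Tm} {σ : ℕ → Tm} (C : Tm),
      (∀ k B, VarTy Γ k B → Typing n Δ (σ k) (B.subst σ)) →
      ∀ k B, VarTy (C :: Γ) k B → Typing n (C.subst σ :: Δ) (ups σ k) (B.subst (ups σ)) := by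
    intro Γ Δ σ C h k B hB
    rcases hB.cases with ⟨rfl, rfl⟩ | ⟨j, B', rfl, hB', rfl⟩ <;> rw [subst_shift]
    · exact (VarTy.zero _ _).typing
    · exact (h _ _ hB').shift _
  induction h with
  | var h => exact fun hσ => hσ _ _ ⟨_, h, rfl⟩
  | univ => exact fun _ => .univ _ _
  | pi _ _ ih₁ ih₂ => exact fun hσ => .pi (ih₁ hσ) (ih₂ (up _ hσ))
  | lam _ _ _ ih₁ ih₂ ih₃ => exact fun hσ => .lam (ih₁ hσ) (ih₂ (up _ hσ)) (ih₃ (up _ hσ))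
  | app _ _ ih₁ ih₂ => intro Δ σ hσ; rw [subst_inst]; exact (ih₁ hσ).app (ih₂ hσ)
  | const Γ c => intro Δ σ _; rw [c.ty_closed n]; exact .const _ _
  | conv _ hc _ ih₁ ih₂ => exact fun hσ => (ih₁ hσ).conv (hc.subst _) (ih₂ hσ)

theorem Typing.inst {n : ℕ} {Γ : List Tm} {t a A B : Tm} (h : Typing n (A :: Γ) t B)
    (ha : Typing n Γ a A) : Typing n Γ (t.inst a) (B.inst a) := by
  rw [inst_eq, inst_eq]
  refine h.subst fun k C hC => ?_
  rcases hC.cases with ⟨rfl, rfl⟩ | ⟨j, B', rfl, hB', rfl⟩ <;> rw [← inst_eq, inst_shift]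
  · exact ha
  · exact hB'.typing

/-- A closed typing holds in every context. -/
theorem Typing.weaken {n : ℕ} {t A : Tm} (h : Typing n [] t A) (hA : Closed A) (Γ : List Tm) :
    Typing n Γ t A := by
  have := h.rename (Δ := Γ) (ρ := id) fun k B hB => by obtain ⟨_, h, _⟩ := hB; simp at h
  rwa [h.closed.rename_eq, hA.rename_eq] at this

/-- `A` is a type in the context `Γ`. -/
def IsTy (n : ℕ) (Γ : List Tm) (A : Tm) : Prop := ∃ i, Typing n Γ A (.U i)

theorem IsTy.pi_inv {n : ℕ} {Γ : List Tm} {A B : Tm} (h : IsTy n Γ (.pi A B)) :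
    IsTy n Γ A ∧ IsTy n (A :: Γ) B := by
  obtain ⟨i, h⟩ := h
  generalize ht : Tm.pi A B = t, hT : Tm.U i = T at h
  clear hT
  induction h with
  | pi h₁ h₂ => cases ht; exact ⟨⟨_, h₁⟩, ⟨_, h₂⟩⟩
  | conv _ _ _ ih => exact ih ht
  | _ => cases ht

theorem IsTy.shift {n : ℕ} {Γ : List Tm} {A : Tm} (C : Tm) (h : IsTy n Γ A) :
    IsTy n (C :: Γ) (Tm.shift A) := by
  obtain ⟨i, h⟩ := h; exact ⟨i, h.shift C⟩

/-- All variables of the context have types. -/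
def WF (n : ℕ) (Γ : List Tm) : Prop := ∀ k B, VarTy Γ k B → IsTy n Γ B

theorem WF.nil (n : ℕ) : WF n [] := fun k B hB => by obtain ⟨_, h, _⟩ := hB; simp at h

theorem WF.cons {n : ℕ} {Γ : List Tm} {A : Tm} (h : WF n Γ) (hA : IsTy n Γ A) :
    WF n (A :: Γ) := by
  intro k B hB
  rcases hB.cases with ⟨rfl, rfl⟩ | ⟨j, B', rfl, hB', rfl⟩
  · exact hA.shift A
  · exact (h _ _ hB').shift A

end HoTT

namespace HoTT.Sym

/-! ### Terms with symbolic levels -/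

/-- Level expressions: variables, the external number `n`, and closure under `0`, successor and
maximum. Truncation indices are written in the same language. -/
inductive Lvl : Type
  | v (k : ℕ) | n | z | s (l : Lvl) | mx (a b : Lvl)

namespace Lvl

/-- The value of a level expression under the valuation `ρ` of the variables. -/
def eval (n : ℕ) (ρ : ℕ → ℕ) : Lvl → ℕ
  | v k => ρ k
  | .n => n
  | z => 0
  | s l => eval n ρ l + 1
  | mx a b => max (eval n ρ a) (eval n ρ b)

/-- Substitution for the variables of a level expression. -/
def subst (σ : ℕ → Lvl) : Lvl → Lvl
  | v k => σ k
  | .n => .n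
  | z => z
  | s l => s (subst σ l)
  | mx a b => mx (subst σ a) (subst σ b)

/-- The number `d` is at most `l + o`, by inspection. -/
def leZ (d : ℕ) : Lvl → ℕ → Bool
  | s l, o => leZ d l (o + 1)
  | mx a b, o => leZ d a o || leZ d b o
  | _, o => Nat.ble d o

/-- `v k + d ≤ l + o`, by inspection. -/
def leV (k d : ℕ) : Lvl → ℕ → Bool
  | v j, o => Nat.beq k j && Nat.ble d o
  | s l, o => leV k d l (o + 1)
  | mx a b, o => leV k d a o || leV k d b o
  | _, _ => false

/-- `n + d ≤ l + o`, by inspection. -/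
def leN (d : ℕ) : Lvl → ℕ → Bool
  | .n, o => Nat.ble d o
  | s l, o => leN d l (o + 1)
  | mx a b, o => leN d a o || leN d b o
  | _, _ => false

/-- `a + d ≤ b`, by inspection. -/
def le : Lvl → ℕ → Lvl → Bool
  | v k, d, b => leV k d b 0
  | .n, d, b => leN d b 0
  | z, d, b => leZ d b 0
  | s a, d, b => le a (d + 1) b
  | mx a c, d, b => le a d b && le c d b

/-- A sufficient test for two level expressions to be equal under every valuation. -/
def eqv (a b : Lvl) : Bool := le a 0 b && le b 0 a

variable {n : ℕ} {ρ : ℕ → ℕ}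

theorem leZ_sound {d : ℕ} {l : Lvl} : ∀ {o}, leZ d l o = true → d ≤ l.eval n ρ + o := by
  induction l with
  | s l ih => intro o h; have := ih h; simp only [eval]; omega
  | mx a b iha ihb =>
    intro o h
    simp only [leZ, Bool.or_eq_true] at h
    simp only [eval]
    rcases h with h | h
    · have := iha h; omega
    · have := ihb h; omega
  | _ => intro o h; have := Nat.le_of_ble_eq_true h; omega

theorem leV_sound {k d : ℕ} {l : Lvl} :
    ∀ {o}, leV k d l o = true → ρ k + d ≤ l.eval n ρ + o := by
  induction l with
  | v j =>
    intro o h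
    simp only [leV, Bool.and_eq_true] at h
    have h₁ := Nat.eq_of_beq_eq_true h.1
    have := Nat.le_of_ble_eq_true h.2
    subst h₁; simp only [eval]; omega
  | s l ih => intro o h; have := ih h; simp only [eval]; omega
  | mx a b iha ihb =>
    intro o h
    simp only [leV, Bool.or_eq_true] at h
    simp only [eval]
    rcases h with h | h
    · have := iha h; omega
    · have := ihb h; omega
  | _ => intro o h; simp [leV] at h

theorem leN_sound {d : ℕ} {l : Lvl} : ∀ {o}, leN d l o = true → n + d ≤ l.eval n ρ + o := by
  induction l with
  | n => intro o h; have := Nat.le_of_ble_eq_true h; simp only [eval]; omega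
  | s l ih => intro o h; have := ih h; simp only [eval]; omega
  | mx a b iha ihb =>
    intro o h
    simp only [leN, Bool.or_eq_true] at h
    simp only [eval]
    rcases h with h | h
    · have := iha h; omega
    · have := ihb h; omega
  | _ => intro o h; simp [leN] at h

theorem le_sound {a b : Lvl} : ∀ {d}, le a d b = true → a.eval n ρ + d ≤ b.eval n ρ := by
  induction a with
  | v k => intro d h; exact leV_sound h
  | n => intro d h; exact leN_sound h
  | z => intro d h; have := leZ_sound (n := n) (ρ := ρ) h; simp only [eval]; omega
  | s a ih => intro d h; have := ih h; simp only [eval]; omega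
  | mx a c iha ihc =>
    intro d h
    simp only [le, Bool.and_eq_true] at h
    have h₁ := iha h.1
    have h₂ := ihc h.2
    simp only [eval]; omega

theorem eqv_sound {a b : Lvl} (h : eqv a b = true) : a.eval n ρ = b.eval n ρ := by
  simp only [eqv, Bool.and_eq_true] at h
  have h₁ := le_sound (n := n) (ρ := ρ) h.1
  have h₂ := le_sound (n := n) (ρ := ρ) h.2
  omega

theorem eval_subst (σ : ℕ → Lvl) (l : Lvl) :
    (l.subst σ).eval n ρ = l.eval n fun k => (σ k).eval n ρ := by
  induction l <;> simp_all [subst, eval]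

/-- Syntactic equality. -/
def same : Lvl → Lvl → Bool
  | v j, v k => Nat.beq j k
  | .n, .n => true
  | z, z => true
  | s a, s b => same a b
  | mx a b, mx a' b' => same a a' && same b b'
  | _, _ => false

theorem eq_of_same {a : Lvl} : ∀ {b}, same a b = true → a = b := by
  induction a with
  | v j => intro b h; cases b <;> simp_all [same]
  | s a ih => intro b h; cases b <;> simp only [same, Bool.false_eq_true] at h; rw [ih h]
  | mx a b iha ihb =>
    intro c h
    cases c <;> simp only [same, Bool.and_eq_true, Bool.false_eq_true] at h
    rw [iha h.1, ihb h.2]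
  | _ => intro b h; cases b <;> simp_all [same]

/-- Pointwise syntactic equality. -/
def sames : List Lvl → List Lvl → Bool
  | [], [] => true
  | a :: as, b :: bs => same a b && sames as bs
  | _, _ => false

theorem eq_of_sames {as : List Lvl} : ∀ {bs : List Lvl}, sames as bs = true → as = bs := by
  induction as with
  | nil => intro bs h; cases bs <;> simp_all [sames]
  | cons a as ih =>
    intro bs h
    cases bs with
    | nil => simp [sames] at h
    | cons b bs =>
      simp only [sames, Bool.and_eq_true] at h
      rw [eq_of_same h.1, ih h.2]

/-- Pointwise `eqv`. -/
def eqvs : List Lvl → List Lvl → Bool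
  | [], [] => true
  | a :: as, b :: bs => (same a b || eqv a b) && eqvs as bs
  | _, _ => false

theorem eqvs_sound {as : List Lvl} : ∀ {bs : List Lvl}, eqvs as bs = true →
    as.map (eval n ρ) = bs.map (eval n ρ) := by
  induction as with
  | nil => intro bs h; cases bs <;> simp_all [eqvs]
  | cons a as ih =>
    intro bs h
    cases bs with
    | nil => simp [eqvs] at h
    | cons b bs =>
      simp only [eqvs, Bool.and_eq_true, Bool.or_eq_true] at h
      rw [List.map_cons, List.map_cons, ih h.2]
      rcases h.1 with h | h
      · rw [eq_of_same h]
      · rw [eqv_sound h]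

/-- The `k`-th entry of a list of levels. -/
def get (ls : List Lvl) (k : ℕ) : Lvl := ls.getD k z

theorem eval_get (ls : List Lvl) (k : ℕ) :
    (get ls k).eval n ρ = (ls.map (eval n ρ)).getD k 0 := by
  simp only [get, List.getD_eq_getElem?_getD, List.getElem?_map]
  cases ls[k]? <;> rfl

end Lvl

/-- The heads of constants: the constants of the theory without their levels, the truncation
predicate `isTruncTm`, and proved lemmas. -/
inductive Head : Type
  | sig | pair | split | empty | emptyElim | unit | star | unitElim | sum | inl | inr | sumElim
  | id | refl | J | funext | ua | W | sup | trunc | wElim | wBeta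
  | isTrunc
  | lem (k : ℕ)

/-- A numbering of the heads. -/
def Head.code : Head → ℕ
  | sig => 0 | pair => 1 | split => 2 | empty => 3 | emptyElim => 4 | unit => 5 | star => 6
  | unitElim => 7 | sum => 8 | inl => 9 | inr => 10 | sumElim => 11 | id => 12 | refl => 13
  | J => 14 | funext => 15 | ua => 16 | W => 17 | sup => 18 | trunc => 19 | wElim => 20
  | wBeta => 21 | isTrunc => 22 | lem k => k + 23

theorem Head.eq_of_code {h h' : Head} (e : Nat.beq h.code h'.code = true) : h = h' := by
  have e := Nat.eq_of_beq_eq_true e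
  cases h <;> cases h' <;> simp only [code, Nat.reduceEqDiff, reduceCtorEq, lem.injEq] at e ⊢
  omega

/-- Raw terms with de Bruijn indices, as in `Tm`, but with symbolic levels and with lemmas as
additional constants. -/
inductive R : Type
  | var (k : ℕ)
  | U (l : Lvl)
  | pi (A B : R)
  | lam (A t : R)
  | app (f a : R)
  | con (h : Head) (ls : List Lvl)

/-- The constant of the theory with the given head and levels. For heads that are not constants
of the theory, this is a dummy value. -/
def Head.const (h : Head) (ls : List ℕ) : Const :=
  let l := fun k => ls.getD k 0
  match h with
  | sig => .sig (l 0) (l 1)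
  | pair => .pair (l 0) (l 1)
  | split => .split (l 0) (l 1) (l 2)
  | empty => .empty (l 0)
  | emptyElim => .emptyElim (l 0) (l 1)
  | unit => .unit (l 0)
  | star => .star (l 0)
  | unitElim => .unitElim (l 0) (l 1)
  | sum => .sum (l 0) (l 1)
  | inl => .inl (l 0) (l 1)
  | inr => .inr (l 0) (l 1)
  | sumElim => .sumElim (l 0) (l 1) (l 2)
  | id => .id (l 0)
  | refl => .refl (l 0)
  | J => .J (l 0) (l 1)
  | funext => .funext (l 0) (l 1)
  | ua => .ua (l 0)
  | W => .W (l 0) (l 1) (l 2) (l 3)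
  | sup => .sup (l 0) (l 1) (l 2) (l 3)
  | trunc => .trunc (l 0) (l 1) (l 2) (l 3)
  | wElim => .wElim (l 0) (l 1) (l 2) (l 3) (l 4)
  | wBeta => .wBeta (l 0) (l 1) (l 2) (l 3) (l 4)
  | isTrunc => .unit 0
  | lem _ => .unit 0

/-- The meaning of a head, given the meaning of lemmas. -/
def Head.eval (L : ℕ → List ℕ → Tm) : Head → List ℕ → Tm
  | isTrunc, ls => isTruncTm (ls.getD 0 0) (ls.getD 1 0)
  | lem k, ls => L k ls
  | h, ls => .const (h.const ls)

namespace R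

/-- The term of the theory that is denoted by a symbolic term. -/
def eval (L : ℕ → List ℕ → Tm) (n : ℕ) (ρ : ℕ → ℕ) : R → Tm
  | var k => .var k
  | U l => .U (l.eval n ρ)
  | pi A B => .pi (eval L n ρ A) (eval L n ρ B)
  | lam A t => .lam (eval L n ρ A) (eval L n ρ t)
  | app f a => .app (eval L n ρ f) (eval L n ρ a)
  | con h ls => h.eval L (ls.map (Lvl.eval n ρ))

/-- Substitution for level variables. -/
def lsubst (σ : ℕ → Lvl) : R → R
  | var k => var k
  | U l => U (l.subst σ)
  | pi A B => pi (lsubst σ A) (lsubst σ B)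
  | lam A t => lam (lsubst σ A) (lsubst σ t)
  | app f a => app (lsubst σ f) (lsubst σ a)
  | con h ls => con h (ls.map (Lvl.subst σ))

/-- Weakening by `d` variables below `c` bound ones. -/
def lift (d : ℕ) : R → ℕ → R
  | var k, c => cond (Nat.ble c k) (var (k + d)) (var k)
  | U l, _ => U l
  | pi A B, c => pi (lift d A c) (lift d B (c + 1))
  | lam A t, c => lam (lift d A c) (lift d t (c + 1))
  | app f a, c => app (lift d f c) (lift d a c)
  | con h ls, _ => con h ls

/-- Substitution of `a` for the variable `c`, below `c` bound variables. -/
def instAt (a : R) : R → ℕ → R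
  | var k, c => cond (Nat.blt k c) (var k) (cond (Nat.beq k c) (lift c a 0) (var (k - 1)))
  | U l, _ => U l
  | pi A B, c => pi (instAt a A c) (instAt a B (c + 1))
  | lam A t, c => lam (instAt a A c) (instAt a t (c + 1))
  | app f b, c => app (instAt a f c) (instAt a b c)
  | con h ls, _ => con h ls

/-- `inst t a` is `t[a]`: the variable `0` is replaced by `a`. -/
def inst (t a : R) : R := instAt a t 0

/-- Weakening by one variable. -/
def shift (t : R) : R := lift 1 t 0

/-- Iterated application. -/
def apps (f : R) : List R → R
  | [] => f
  | a :: as => apps (app f a) as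

variable {L : ℕ → List ℕ → Tm} {n : ℕ} {ρ : ℕ → ℕ}

theorem eval_lsubst (σ : ℕ → Lvl) (t : R) :
    (t.lsubst σ).eval L n ρ = t.eval L n fun k => (σ k).eval n ρ := by
  induction t <;> simp_all [lsubst, eval, Lvl.eval_subst, Function.comp_def]

end R

/-! ### The types of the constants -/

/-! The combinators from here to `PiWElim` are those of `HoTT` of the same names, with symbolic
levels. `Head.eval_ty` states that they describe the same types. -/

/-- A term as a function of the number of binders around it. -/
abbrev H : Type := ℕ → R

/-- The variable bound by the binder with `d` binders around it. -/
def bvar (d : ℕ) : H := fun e => .var (e - (d + 1))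
def Pi (A : H) (B : H → H) : H := fun d => .pi (A d) (B (bvar d) (d + 1))
def Lam (A : H) (t : H → H) : H := fun d => .lam (A d) (t (bvar d) (d + 1))
def arr (A B : H) : H := Pi A fun _ => B
def Univ (i : Lvl) : H := fun _ => .U i
def ap (f : H) : List H → H
  | [] => f
  | a :: as => ap (fun d => .app (f d) (a d)) as
def cst (h : Head) (ls : List Lvl) (as : List H) : H := ap (fun _ => .con h ls) as

def Sig (i j : Lvl) (A : H) (B : H → H) : H := cst .sig [i, j] [A, Lam A B]
def Pair (i j : Lvl) (A : H) (B : H → H) (a b : H) : H := cst .pair [i, j] [A, Lam A B, a, b]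
/-- First projection. -/
def Fst (i j : Lvl) (A : H) (B : H → H) (z : H) : H :=
  cst .split [i, j, i] [A, Lam A B, Lam (Sig i j A B) fun _ => A,
    Lam A fun a => Lam (B a) fun _ => a, z]
def Eq (i : Lvl) (A x y : H) : H := cst .id [i] [A, x, y]
def Refl (i : Lvl) (A x : H) : H := cst .refl [i] [A, x]
/-- Based path induction. -/
def Ind (i k : Lvl) (A x : H) (C : H → H → H) (d y p : H) : H :=
  cst .J [i, k] [A, x, Lam A fun y => Lam (Eq i A x y) fun p => C y p, d, y, p]
def Transport (i k : Lvl) (A F x y p u : H) : H :=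
  ap (Ind i k A x (fun y _ => arr (ap F [x]) (ap F [y])) (Lam (ap F [x]) fun u => u) y p) [u]
/-- The type `A` is `(m-2)`-truncated. -/
def IsTrunc (i m : Lvl) (A : H) : H := cst .isTrunc [i, m] [A]

/-- The unfolding of `isTruncTm`. -/
def truncBody (i : Lvl) : Lvl → Option R
  | .z => some (Lam (Univ i) (fun A => Sig i i A fun c => Pi A fun x => Eq i A c x) 0)
  | .s m => some (Lam (Univ i) (fun A => Pi A fun x => Pi A fun y =>
      IsTrunc i m (Eq i A x y)) 0)
  | _ => none

/-- The fiber of `f` at `y`. -/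
def Fiber (i j : Lvl) (A B f y : H) : H := Sig i j A fun x => Eq j B (ap f [x]) y
/-- All fibers of `f` are contractible. -/
def IsEquiv (i j : Lvl) (A B f : H) : H :=
  Pi B fun y => IsTrunc (.mx i j) .z (Fiber i j A B f y)
/-- The equivalences of `A` and `B`. -/
def Equiv (i : Lvl) (A B : H) : H := Sig i i (arr A B) fun f => IsEquiv i i A B f
/-- The identity equivalence. -/
def IdEquiv (i : Lvl) (A : H) : H :=
  let idf : H := Lam A fun x => x
  let fib : H → H := fun y => Fiber i i A A idf y
  let pr : H → H → H → H := fun y x p => Pair i i A (fun x => Eq i A (ap idf [x]) y) x p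
  Pair i i (arr A A) (fun f => IsEquiv i i A A f) idf
    (Lam A fun y =>
      Pair i i (fib y) (fun c => Pi (fib y) fun z => Eq i (fib y) c z)
        (pr y y (Refl i A y))
        (Lam (fib y) fun z =>
          cst .split [i, i, i] [A, Lam A fun x => Eq i A (ap idf [x]) y,
            Lam (fib y) fun z => Eq i (fib y) (pr y y (Refl i A y)) z,
            Lam A fun x => Lam (Eq i A x y) fun p =>
              Ind i i A x (fun y p => Eq i (fib y) (pr y y (Refl i A y)) (pr y x p))
                (Refl i (fib x) (pr x x (Refl i A x))) y p,
            z]))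
/-- The canonical map `x₀ = x₁ → (Y x₀ ≃ Y x₁)`. -/
def IdToEquiv (k l : Lvl) (X : H) (Y : H → H) (x₀ x₁ : H) : H :=
  Lam (Eq k X x₀ x₁) fun p =>
    Ind k l X x₀ (fun x _ => Equiv l (Y x₀) (Y x)) (IdEquiv l (Y x₀)) x₁ p
/-- The family `Y` over `X` is univalent. -/
def Univalent (k l : Lvl) (X : H) (Y : H → H) : H :=
  Pi X fun x₀ => Pi X fun x₁ =>
    IsEquiv k l (Eq k X x₀ x₁) (Equiv l (Y x₀) (Y x₁)) (IdToEquiv k l X Y x₀ x₁)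
/-- The restriction of the family `Y` to the `(m-2)`-truncated types is univalent. -/
def UnivalentFor (m k l : Lvl) (X : H) (Y : H → H) : H :=
  Univalent (.mx k l) l (Sig k l X fun x => IsTrunc l m (Y x))
    (fun z => Y (Fst k l X (fun x => IsTrunc l m (Y x)) z))

/-- The type of the positions of a container. -/
def PosTy (b : Lvl) (I S : H) : H := Pi I fun i => arr (ap S [i]) (arr I (Univ b))
/-- The functions that assign elements of `F` to the positions of the shape `s`. -/
def Args (I Pos F i s : H) : H := Pi I fun j => arr (ap Pos [i, s, j]) (ap F [j])
/-- The extension of a container. -/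
def Ext (a m : Lvl) (I S Pos F i : H) : H := Sig a m (ap S [i]) fun s => Args I Pos F i s
/-- The level of a W-type. -/
def wLevel (k a b c : Lvl) : Lvl := .mx k (.mx a (.mx b c))
/-- Quantification over the data of a propositional indexed W-type. -/
def PiData (k a b c : Lvl) (body : H → H → H → H → H → H) : H :=
  Pi (Univ k) fun I => Pi (arr I (Univ a)) fun S => Pi (PosTy b I S) fun Pos =>
    Pi (arr I (Univ c)) fun P => Pi (Pi I fun i => IsTrunc c (.s .z) (ap P [i])) fun hP =>
      body I S Pos P hP
/-- The W-type as a family. -/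
def WFam (k a b c : Lvl) (I S Pos P hP : H) : H := cst .W [k, a, b, c] [I, S, Pos, P, hP]
/-- Quantification over the data of an induction on a W-type. -/
def PiWElim (k a b c l : Lvl) (body : (I S Pos P hP X d h : H) → H) : H :=
  PiData k a b c fun I S Pos P hP =>
    let W := WFam k a b c I S Pos P hP
    Pi (Pi I fun i => arr (ap W [i]) (Univ l)) fun X =>
    Pi (Pi I fun i => Pi (ap S [i]) fun s => Pi (Args I Pos W i s) fun t =>
      arr (Pi I fun j => Pi (ap Pos [i, s, j]) fun p => ap X [j, ap t [j, p]])
        (ap X [i, cst .sup [k, a, b, c] [I, S, Pos, P, hP, i, s, t]])) fun d =>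
    Pi (Pi I fun i => arr (ap P [i]) (Pi (ap W [i]) fun w =>
      IsTrunc l (.s .z) (ap X [i, w]))) fun h =>
      body I S Pos P hP X d h

/-- The type of a constant. For lemmas, this is a dummy value. -/
def Head.hty (h : Head) (ls : List Lvl) : H :=
  let l := Lvl.get ls
  match h with
  | sig => Pi (Univ (l 0)) fun A => arr (arr A (Univ (l 1))) (Univ (.mx (l 0) (l 1)))
  | pair => Pi (Univ (l 0)) fun A => Pi (arr A (Univ (l 1))) fun B =>
      Pi A fun a => arr (ap B [a]) (cst .sig [l 0, l 1] [A, B])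
  | split => Pi (Univ (l 0)) fun A => Pi (arr A (Univ (l 1))) fun B =>
      Pi (arr (cst .sig [l 0, l 1] [A, B]) (Univ (l 2))) fun C =>
      arr (Pi A fun a => Pi (ap B [a]) fun b => ap C [cst .pair [l 0, l 1] [A, B, a, b]])
        (Pi (cst .sig [l 0, l 1] [A, B]) fun z => ap C [z])
  | empty => Univ (l 0)
  | emptyElim => Pi (arr (cst .empty [l 0] []) (Univ (l 1))) fun C =>
      Pi (cst .empty [l 0] []) fun z => ap C [z]
  | unit => Univ (l 0)
  | star => cst .unit [l 0] []
  | unitElim => Pi (arr (cst .unit [l 0] []) (Univ (l 1))) fun C =>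
      arr (ap C [cst .star [l 0] []]) (Pi (cst .unit [l 0] []) fun z => ap C [z])
  | sum => arr (Univ (l 0)) (arr (Univ (l 1)) (Univ (.mx (l 0) (l 1))))
  | inl => Pi (Univ (l 0)) fun A => Pi (Univ (l 1)) fun B => arr A (cst .sum [l 0, l 1] [A, B])
  | inr => Pi (Univ (l 0)) fun A => Pi (Univ (l 1)) fun B => arr B (cst .sum [l 0, l 1] [A, B])
  | sumElim => Pi (Univ (l 0)) fun A => Pi (Univ (l 1)) fun B =>
      Pi (arr (cst .sum [l 0, l 1] [A, B]) (Univ (l 2))) fun C =>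
      arr (Pi A fun a => ap C [cst .inl [l 0, l 1] [A, B, a]])
        (arr (Pi B fun b => ap C [cst .inr [l 0, l 1] [A, B, b]])
          (Pi (cst .sum [l 0, l 1] [A, B]) fun z => ap C [z]))
  | id => Pi (Univ (l 0)) fun A => arr A (arr A (Univ (l 0)))
  | refl => Pi (Univ (l 0)) fun A => Pi A fun x => Eq (l 0) A x x
  | J => Pi (Univ (l 0)) fun A => Pi A fun x =>
      Pi (Pi A fun y => arr (Eq (l 0) A x y) (Univ (l 1))) fun C =>
      arr (ap C [x, Refl (l 0) A x]) (Pi A fun y => Pi (Eq (l 0) A x y) fun p => ap C [y, p])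
  | funext => Pi (Univ (l 0)) fun A => Pi (arr A (Univ (l 1))) fun B =>
      Pi (Pi A fun x => ap B [x]) fun f => Pi (Pi A fun x => ap B [x]) fun g =>
      arr (Pi A fun x => Eq (l 1) (ap B [x]) (ap f [x]) (ap g [x]))
        (Eq (.mx (l 0) (l 1)) (Pi A fun x => ap B [x]) f g)
  | ua => UnivalentFor (.s .n) (.s (l 0)) (l 0) (Univ (l 0)) (fun X => X)
  | W => PiData (l 0) (l 1) (l 2) (l 3) fun I _ _ _ _ =>
      arr I (Univ (wLevel (l 0) (l 1) (l 2) (l 3)))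
  | sup => PiData (l 0) (l 1) (l 2) (l 3) fun I S Pos P hP =>
      let W := WFam (l 0) (l 1) (l 2) (l 3) I S Pos P hP
      Pi I fun i => Pi (ap S [i]) fun s => arr (Args I Pos W i s) (ap W [i])
  | trunc => PiData (l 0) (l 1) (l 2) (l 3) fun I S Pos P hP =>
      let W := WFam (l 0) (l 1) (l 2) (l 3) I S Pos P hP
      Pi I fun i => arr (ap P [i]) (Pi (ap W [i]) fun x => Pi (ap W [i]) fun y =>
        Eq (wLevel (l 0) (l 1) (l 2) (l 3)) (ap W [i]) x y)
  | wElim => PiWElim (l 0) (l 1) (l 2) (l 3) (l 4) fun I S Pos P hP X _ _ =>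
      Pi I fun i => Pi (ap (WFam (l 0) (l 1) (l 2) (l 3) I S Pos P hP) [i]) fun w => ap X [i, w]
  | wBeta => PiWElim (l 0) (l 1) (l 2) (l 3) (l 4) fun I S Pos P hP X d h =>
      let elim : H → H → H := fun i w =>
        cst .wElim [l 0, l 1, l 2, l 3, l 4] [I, S, Pos, P, hP, X, d, h, i, w]
      Pi I fun i => Pi (ap S [i]) fun s =>
      Pi (Args I Pos (WFam (l 0) (l 1) (l 2) (l 3) I S Pos P hP) i s) fun t =>
        let w := cst .sup [l 0, l 1, l 2, l 3] [I, S, Pos, P, hP, i, s, t]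
        Eq (l 4) (ap X [i, w]) (elim i w)
          (ap d [i, s, t, Lam I fun j => Lam (ap Pos [i, s, j]) fun p => elim j (ap t [j, p])])
  | isTrunc => arr (Univ (l 0)) (Univ (l 0))
  | lem _ => Univ .z

/-- The type of a constant as a closed term. -/
def Head.ty (h : Head) (ls : List Lvl) : R := h.hty ls 0

/-- The head stands for a constant of the theory. -/
def Head.IsConst : Head → Prop
  | isTrunc => False
  | lem _ => False
  | _ => True

/-- The types that the checker assigns to the constants are their types in the theory. -/
theorem Head.eval_ty (L : ℕ → List ℕ → Tm) (n : ℕ) (ρ : ℕ → ℕ) {h : Head} (hc : h.IsConst)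
    (ls : List Lvl) :
    (h.ty ls).eval L n ρ = (h.const (ls.map (Lvl.eval n ρ))).ty n := by
  have e := Lvl.eval_get (n := n) (ρ := ρ) ls
  cases h
  case isTrunc => cases hc
  case lem => cases hc
  all_goals
    simp only [Head.const, ← e]
    rfl

end HoTT.Sym

namespace HoTT.Sym

namespace R

/-! ### Evaluation and substitution -/

/-- The meanings of lemmas are closed terms. -/
def ClosedL (L : ℕ → List ℕ → Tm) : Prop := ∀ k ns, (L k ns).Closed

variable {L : ℕ → List ℕ → Tm} {n : ℕ} {ρ : ℕ → ℕ}

theorem _root_.HoTT.Sym.Head.eval_closed (hL : ClosedL L) (h : Head) (ns : List ℕ) :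
    (h.eval L ns).Closed := by
  cases h
  case isTrunc => exact isTruncTm_closed _ _
  case lem => exact hL _ _
  all_goals exact fun _ => rfl

/-- The renaming that adds `d` to the variables from `c` on. -/
def liftRen (d c k : ℕ) : ℕ := cond (Nat.ble c k) (k + d) k

theorem upr_liftRen (d c : ℕ) : Tm.upr (liftRen d c) = liftRen d (c + 1) := by
  funext k
  cases k with
  | zero => simp [Tm.upr, liftRen, Nat.ble]
  | succ k =>
    simp only [Tm.upr, liftRen, Nat.ble]
    cases Nat.ble c k
    · rfl
    · simp only [cond_true]; omega

theorem eval_lift (hL : ClosedL L) (d : ℕ) (t : R) : ∀ c,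
    (t.lift d c).eval L n ρ = (t.eval L n ρ).rename (liftRen d c) := by
  induction t with
  | var k =>
    intro c
    simp only [lift, eval, Tm.rename, liftRen]
    cases Nat.ble c k <;> rfl
  | U l => intro c; rfl
  | pi A B ihA ihB => intro c; simp [lift, eval, Tm.rename, ihA, ihB, upr_liftRen]
  | lam A B ihA ihB => intro c; simp [lift, eval, Tm.rename, ihA, ihB, upr_liftRen]
  | app A B ihA ihB => intro c; simp [lift, eval, Tm.rename, ihA, ihB]
  | con h ls => intro c; simp [lift, eval, (h.eval_closed hL _).rename_eq]

theorem eval_shift (hL : ClosedL L) (t : R) :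
    t.shift.eval L n ρ = Tm.shift (t.eval L n ρ) := by
  rw [shift, eval_lift hL]; rfl

theorem eval_lift_zero (hL : ClosedL L) (t : R) (d : ℕ) :
    (t.lift d 0).eval L n ρ = (t.eval L n ρ).rename (· + d) := by
  rw [eval_lift hL]; rfl

/-- The substitution of `a` for the variable `c`. -/
def instSub (a : Tm) (c k : ℕ) : Tm :=
  cond (Nat.blt k c) (.var k) (cond (Nat.beq k c) (a.rename (· + c)) (.var (k - 1)))

theorem ups_instSub (a : Tm) (c : ℕ) : Tm.ups (instSub a c) = instSub a (c + 1) := by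
  funext k
  cases k with
  | zero => simp [Tm.ups, instSub, Nat.blt, Nat.ble]
  | succ k =>
    simp only [Tm.ups, instSub, Nat.blt, Nat.ble, Nat.beq]
    cases h : Nat.ble (k + 1) c
    · cases h' : Nat.beq k c
      · have h₁ : ¬ k + 1 ≤ c := fun hle => by simp [Nat.ble_eq_true_of_le hle] at h
        have h₂ : k ≠ c := fun he => by subst he; simp at h'
        simp only [cond_false, Tm.shift, Tm.rename, Tm.var.injEq]; omega
      · simp only [cond_false, cond_true, Tm.shift, Tm.rename_rename]; rfl
    · rfl

theorem instSub_zero (a : Tm) : instSub a 0 = Tm.single a := by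
  funext k
  cases k with
  | zero =>
    simp only [instSub, Nat.blt, Nat.ble, Nat.beq, Tm.single, cond_false, cond_true]
    rw [Tm.rename_eq_subst]; exact Tm.subst_var a
  | succ k => rfl

theorem eval_instAt (hL : ClosedL L) (a t : R) : ∀ c,
    (instAt a t c).eval L n ρ = (t.eval L n ρ).subst (instSub (a.eval L n ρ) c) := by
  induction t with
  | var k =>
    intro c
    simp only [instAt, eval, Tm.subst, instSub]
    cases Nat.blt k c
    · cases Nat.beq k c
      · rfl
      · exact eval_lift_zero hL a c
    · rfl
  | U l => intro c; rfl
  | pi A B ihA ihB => intro c; simp [instAt, eval, Tm.subst, ihA, ihB, ups_instSub]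
  | lam A B ihA ihB => intro c; simp [instAt, eval, Tm.subst, ihA, ihB, ups_instSub]
  | app A B ihA ihB => intro c; simp [instAt, eval, Tm.subst, ihA, ihB]
  | con h ls => intro c; simp [instAt, eval, h.eval_closed hL _ _]

theorem eval_inst (hL : ClosedL L) (t a : R) :
    (t.inst a).eval L n ρ = (t.eval L n ρ).inst (a.eval L n ρ) := by
  rw [inst, eval_instAt hL, instSub_zero, Tm.inst_eq]

/-! ### Reduction and conversion -/

/-- Unfold a truncation predicate at the head. -/
def delta : R → Option R
  | con .isTrunc [i, m] => truncBody i m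
  | app f a => match delta f with
    | some f' => some (app f' a)
    | none => none
  | _ => none

/-- Reduction of `split` applied to `as`. Here and below `whnf` reduces the scrutinee, and `cv`
decides whether the parameters of the constructor are those of the eliminator. -/
def iotaSplit (cv : R → R → Bool) (whnf : R → R) (ls : List Lvl) :
    List R → Option (R × List R)
  | A :: B :: _ :: g :: z :: as =>
    match whnf z with
    | app (app (app (app (con .pair ls') A') B') a) b =>
      cond (Lvl.eqvs (ls.take 2) ls' && cv A' A && cv B' B) (some (g, a :: b :: as)) none
    | _ => none
  | _ => none

/-- Reduction of `unitElim` applied to `as`. -/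
def iotaUnitElim (whnf : R → R) (ls : List Lvl) : List R → Option (R × List R)
  | _ :: d :: z :: as =>
    match whnf z with
    | con .star ls' => cond (Lvl.eqvs (ls.take 1) ls') (some (d, as)) none
    | _ => none
  | _ => none

/-- Reduction of `sumElim` applied to `as`. -/
def iotaSumElim (cv : R → R → Bool) (whnf : R → R) (ls : List Lvl) :
    List R → Option (R × List R)
  | A :: B :: _ :: f :: g :: z :: as =>
    match whnf z with
    | app (app (app (con .inl ls') A') B') a =>
      cond (Lvl.eqvs (ls.take 2) ls' && cv A' A && cv B' B) (some (f, a :: as)) none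
    | app (app (app (con .inr ls') A') B') a =>
      cond (Lvl.eqvs (ls.take 2) ls' && cv A' A && cv B' B) (some (g, a :: as)) none
    | _ => none
  | _ => none

/-- Reduction of `J` applied to `as`. The last endpoint has to be the first one. -/
def iotaJ (cv : R → R → Bool) (whnf : R → R) (ls : List Lvl) : List R → Option (R × List R)
  | A :: x :: _ :: d :: y :: p :: as =>
    match whnf p with
    | app (app (con .refl ls') A') x' =>
      cond (Lvl.eqvs (ls.take 1) ls' && cv A' A && cv x' x && cv y x) (some (d, as)) none
    | _ => none
  | _ => none

/-- Reduce the eliminator `h` applied to `as`. -/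
def iota (cv : R → R → Bool) (whnf : R → R) (h : Head) (ls : List Lvl) (as : List R) :
    Option (R × List R) :=
  match h with
  | .split => iotaSplit cv whnf ls as
  | .unitElim => iotaUnitElim whnf ls as
  | .sumElim => iotaSumElim cv whnf ls as
  | .J => iotaJ cv whnf ls as
  | _ => none

/-- Continue with the reduct of `t` applied to `as`, if there is one. -/
def resume (whnf : R → List R → R) (t : R) (as : List R) : Option (R × List R) → R
  | some (t', as') => whnf t' as'
  | none => apps t as

/-- One step of `whnf`. -/
def whnfStep (cv : R → R → Bool) (whnf : R → List R → R) (t : R) (as : List R) : R :=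
  match t with
  | app t a => whnf t (a :: as)
  | lam A t => match as with
    | a :: as => whnf (t.inst a) as
    | [] => lam A t
  | con h ls => resume whnf (con h ls) as (iota cv (fun t => whnf t []) h ls as)
  | t => apps t as

/-- The weak head normal form of `t` applied to `as`, without unfolding of truncation
predicates. The first number bounds the number of steps. -/
def whnf (cv : R → R → Bool) (f : ℕ) : R → List R → R :=
  Nat.rec apps (fun _ => whnfStep cv) f

/-- Comparison of neutral terms. -/
def neutral (cv : R → R → Bool) : R → R → Bool
  | app f a, app g b => neutral cv f g && cv a b
  | var j, var k => Nat.beq j k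
  | con h ls, con h' ls' => Nat.beq h.code h'.code && Lvl.eqvs ls ls'
  | _, _ => false

/-- Comparison after unfolding truncation predicates. -/
def unfolding (cv : R → R → Bool) (t u : R) : Bool :=
  match delta t with
  | some t' => match delta u with
    | some u' => cv t' u'
    | none => cv t' u
  | none => match delta u with
    | some u' => cv t u'
    | none => false

/-- Comparison of weak head normal forms. The domains of two abstractions are not compared; see
`Conv.lam_of_body`. -/
def compare (cv : R → R → Bool) (t u : R) : Bool :=
  match t with
  | U l => match u with
    | U l' => Lvl.eqv l l'
    | _ => false
  | lam _ t => match u with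
    | lam _ u => cv t u
    | u => cv t (app (shift u) (var 0))
  | pi A B => match u with
    | pi A' B' => cv A A' && cv B B'
    | u => unfolding cv (pi A B) u
  | t => match u with
    | lam _ u => cv (app (shift t) (var 0)) u
    | u => neutral cv t u || unfolding cv t u

/-- Syntactic equality. -/
def same : R → R → Bool
  | var j, var k => Nat.beq j k
  | U l, U l' => Lvl.same l l'
  | pi A B, pi A' B' => same A A' && same B B'
  | lam A t, lam A' t' => same A A' && same t t'
  | app f a, app g b => same f g && same a b
  | con h ls, con h' ls' => Nat.beq h.code h'.code && Lvl.sames ls ls'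
  | _, _ => false

/-- One step of `conv`: the recursive calls are those of `cv`. -/
def convStep (cv : R → R → Bool) (t u : R) : Bool :=
  same t u || compare cv (whnf cv 200 t []) (whnf cv 200 u [])

/-- A sufficient test for convertibility. The number bounds the depth of the comparison. Here and
in `whnf` and `infer`, a bound that is too small only makes the test fail. -/
def conv (f : ℕ) : R → R → Bool :=
  Nat.rec (fun _ _ => false) (fun _ => convStep) f

/-- The weak head normal form, with unfolding of truncation predicates. -/
def whnfD : ℕ → R → R
  | 0, t => t
  | f + 1, t =>
    match delta (whnf (conv 200) 200 t []) with
    | some t' => whnfD f t'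
    | none => whnf (conv 200) 200 t []

theorem eval_apps (as : List R) : ∀ t : R,
    (apps t as).eval L n ρ = Tm.apps (t.eval L n ρ) (as.map (eval L n ρ)) := by
  induction as with
  | nil => intro t; rfl
  | cons a as ih => intro t; exact ih (app t a)

theorem _root_.HoTT.Conv.apps {t u : Tm} (h : Conv t u) (as : List Tm) :
    Conv (Tm.apps t as) (Tm.apps u as) := by
  induction as generalizing t u with
  | nil => exact h
  | cons a as ih => exact ih (.app h (.refl _))

theorem delta_sound {t : R} : ∀ {u}, delta t = some u →
    Conv (t.eval L n ρ) (u.eval L n ρ) := by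
  induction t with
  | app f a ihf _ =>
    intro u h
    simp only [delta] at h
    split at h
    · rename_i f' hf
      cases h
      exact .app (ihf hf) (.refl _)
    · cases h
  | con h ls =>
    intro u hu
    unfold delta at hu
    split at hu
    · rename_i i m heq
      cases heq
      cases m <;> cases hu <;> exact .refl _
    all_goals simp_all
  | _ => intro u h; cases h

/-- Soundness of a convertibility test. -/
def Sound (L : ℕ → List ℕ → Tm) (n : ℕ) (ρ : ℕ → ℕ) (cv : R → R → Bool) : Prop :=
  ∀ t u, cv t u = true → Conv (t.eval L n ρ) (u.eval L n ρ)

theorem getD_eq_of_take {as bs : List ℕ} {m k : ℕ} (h : as.take m = bs) (hk : k < m) :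
    bs.getD k 0 = as.getD k 0 := by
  subst h
  simp [List.getD_eq_getElem?_getD, hk]

theorem eqvs_take {ls ls' : List Lvl} {m k : ℕ} (h : Lvl.eqvs (ls.take m) ls' = true)
    (hk : k < m) :
    (ls'.map (Lvl.eval n ρ)).getD k 0 = (ls.map (Lvl.eval n ρ)).getD k 0 :=
  getD_eq_of_take (by rw [← List.map_take]; exact Lvl.eqvs_sound h) hk

theorem _root_.HoTT.Conv.app4 {f a b c d a' b' c' d' : Tm} (ha : Conv a a') (hb : Conv b b')
    (hc : Conv c c') (hd : Conv d d') :
    Conv (.app (.app (.app (.app f a) b) c) d) (.app (.app (.app (.app f a') b') c') d') :=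
  .app (.app (.app (.app (.refl _) ha) hb) hc) hd

theorem iota_sound {cv : R → R → Bool} {wh : R → R} (hcv : Sound L n ρ cv)
    (hwh : ∀ t, Conv (t.eval L n ρ) ((wh t).eval L n ρ)) {h : Head} {ls : List Lvl}
    {as : List R} {r : R × List R} (e : iota cv wh h ls as = some r) :
    Conv ((apps (con h ls) as).eval L n ρ) ((apps r.1 r.2).eval L n ρ) := by
  simp only [eval_apps]
  unfold iota at e
  split at e
  · unfold iotaSplit at e
    split at e
    swap
    · cases e
    rename_i A B C g z as
    split at e
    · rename_i ls' A' B' a b hz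
      rw [cond_eq_ite] at e
      split at e
      · rename_i hb
        cases e
        simp only [Bool.and_eq_true] at hb
        obtain ⟨⟨hl, hA⟩, hB⟩ := hb
        have hz := hz ▸ hwh z
        refine Conv.apps (as := as.map (eval L n ρ)) (.trans ?_ (.split
          ((ls.map (Lvl.eval n ρ)).getD 0 0) ((ls.map (Lvl.eval n ρ)).getD 1 0)
          ((ls.map (Lvl.eval n ρ)).getD 2 0) (A.eval L n ρ) (B.eval L n ρ) (C.eval L n ρ)
          (g.eval L n ρ) (a.eval L n ρ) (b.eval L n ρ)))
        refine .app (.refl _) (hz.trans ?_)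
        have h0 := eqvs_take (n := n) (ρ := ρ) hl (k := 0) (by omega)
        have h1 := eqvs_take (n := n) (ρ := ρ) hl (k := 1) (by omega)
        simp only [eval, Head.eval, Head.const, h0, h1]
        exact .app4 (hcv _ _ hA) (hcv _ _ hB) (.refl _) (.refl _)
      · cases e
    · cases e
  · unfold iotaUnitElim at e
    split at e
    swap
    · cases e
    rename_i C d z as
    split at e
    · rename_i ls' hz
      rw [cond_eq_ite] at e
      split at e
      · rename_i hl
        cases e
        have hz := hz ▸ hwh z
        refine Conv.apps (as := as.map (eval L n ρ)) (.trans ?_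
          (.unitElim ((ls.map (Lvl.eval n ρ)).getD 0 0) ((ls.map (Lvl.eval n ρ)).getD 1 0)
            (C.eval L n ρ) (d.eval L n ρ)))
        refine .app (.refl _) (hz.trans ?_)
        have h0 := eqvs_take (n := n) (ρ := ρ) hl (k := 0) (by omega)
        simp only [eval, Head.eval, Head.const, h0]
        exact .refl _
      · cases e
    · cases e
  · unfold iotaSumElim at e
    split at e
    swap
    · cases e
    rename_i A B C f g z as
    split at e
    · rename_i ls' A' B' a hz
      rw [cond_eq_ite] at e
      split at e
      · rename_i hb
        cases e
        simp only [Bool.and_eq_true] at hb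
        obtain ⟨⟨hl, hA⟩, hB⟩ := hb
        have hz := hz ▸ hwh z
        refine Conv.apps (as := as.map (eval L n ρ)) (.trans ?_ (.sumInl
          ((ls.map (Lvl.eval n ρ)).getD 0 0) ((ls.map (Lvl.eval n ρ)).getD 1 0)
          ((ls.map (Lvl.eval n ρ)).getD 2 0) (A.eval L n ρ) (B.eval L n ρ) (C.eval L n ρ)
          (f.eval L n ρ) (g.eval L n ρ) (a.eval L n ρ)))
        refine .app (.refl _) (hz.trans ?_)
        have h0 := eqvs_take (n := n) (ρ := ρ) hl (k := 0) (by omega)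
        have h1 := eqvs_take (n := n) (ρ := ρ) hl (k := 1) (by omega)
        simp only [eval, Head.eval, Head.const, h0, h1]
        exact .app (.app (.app (.refl _) (hcv _ _ hA)) (hcv _ _ hB)) (.refl _)
      · cases e
    · rename_i ls' A' B' a hz
      rw [cond_eq_ite] at e
      split at e
      · rename_i hb
        cases e
        simp only [Bool.and_eq_true] at hb
        obtain ⟨⟨hl, hA⟩, hB⟩ := hb
        have hz := hz ▸ hwh z
        refine Conv.apps (as := as.map (eval L n ρ)) (.trans ?_ (.sumInr
          ((ls.map (Lvl.eval n ρ)).getD 0 0) ((ls.map (Lvl.eval n ρ)).getD 1 0)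
          ((ls.map (Lvl.eval n ρ)).getD 2 0) (A.eval L n ρ) (B.eval L n ρ) (C.eval L n ρ)
          (f.eval L n ρ) (g.eval L n ρ) (a.eval L n ρ)))
        refine .app (.refl _) (hz.trans ?_)
        have h0 := eqvs_take (n := n) (ρ := ρ) hl (k := 0) (by omega)
        have h1 := eqvs_take (n := n) (ρ := ρ) hl (k := 1) (by omega)
        simp only [eval, Head.eval, Head.const, h0, h1]
        exact .app (.app (.app (.refl _) (hcv _ _ hA)) (hcv _ _ hB)) (.refl _)
      · cases e
    · cases e
  · unfold iotaJ at e
    split at e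
    swap
    · cases e
    rename_i A x C d y p as
    split at e
    · rename_i ls' A' x' hp
      rw [cond_eq_ite] at e
      split at e
      · rename_i hb
        cases e
        simp only [Bool.and_eq_true] at hb
        obtain ⟨⟨⟨hl, hA⟩, hx⟩, hy⟩ := hb
        have hp := hp ▸ hwh p
        refine Conv.apps (as := as.map (eval L n ρ)) (.trans ?_ (.J
          ((ls.map (Lvl.eval n ρ)).getD 0 0) ((ls.map (Lvl.eval n ρ)).getD 1 0)
          (A.eval L n ρ) (x.eval L n ρ) (C.eval L n ρ) (d.eval L n ρ)))
        refine .app (.app (.refl _) (hcv _ _ hy)) (hp.trans ?_)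
        have h0 := eqvs_take (n := n) (ρ := ρ) hl (k := 0) (by omega)
        simp only [eval, Head.eval, Head.const, h0]
        exact .app (.app (.refl _) (hcv _ _ hA)) (hcv _ _ hx)
      · cases e
    · cases e
  · cases e

theorem whnf_sound (hL : ClosedL L) {cv : R → R → Bool} (hcv : Sound L n ρ cv) (f : ℕ) :
    ∀ (t : R) (as : List R), Conv ((apps t as).eval L n ρ) ((whnf cv f t as).eval L n ρ) := by
  induction f with
  | zero => intro t as; exact .refl _
  | succ f ih =>
    intro t as
    change Conv _ ((whnfStep cv (whnf cv f) t as).eval L n ρ)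
    unfold whnfStep
    split
    · exact ih _ (_ :: _)
    · split
      · refine .trans ?_ (ih _ _)
        simp only [eval_apps, eval_inst hL]
        exact Conv.apps (.beta _ _ _) _
      · exact .refl _
    · rename_i h ls
      cases e : iota cv (fun t => whnf cv f t []) h ls as with
      | some r => exact (iota_sound hcv (fun t => ih t []) e).trans (ih _ _)
      | none => exact .refl _
    · exact .refl _

theorem neutral_sound {cv : R → R → Bool} (hcv : Sound L n ρ cv) (t : R) :
    ∀ u, neutral cv t u = true → Conv (t.eval L n ρ) (u.eval L n ρ) := by
  induction t with
  | app f a ihf _ =>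
    intro u h
    cases u with
    | app g b =>
      simp only [neutral, Bool.and_eq_true] at h
      exact .app (ihf _ h.1) (hcv _ _ h.2)
    | _ => simp [neutral] at h
  | var j =>
    intro u h
    cases u with
    | var k => rw [Nat.eq_of_beq_eq_true h]; exact .refl _
    | _ => simp [neutral] at h
  | con h ls =>
    intro u hu
    cases u with
    | con h' ls' =>
      simp only [neutral, Bool.and_eq_true] at hu
      simp only [eval, Head.eq_of_code hu.1, Lvl.eqvs_sound hu.2]; exact .refl _
    | _ => simp [neutral] at hu
  | _ => intro u h; simp [neutral] at h

theorem unfolding_sound {cv : R → R → Bool} (hcv : Sound L n ρ cv) :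
    Sound L n ρ (unfolding cv) := by
  intro t u h
  unfold unfolding at h
  split at h
  · rename_i t' ht
    have h₁ := delta_sound (L := L) (n := n) (ρ := ρ) ht
    split at h
    · rename_i u' hu
      exact (h₁.trans (hcv _ _ h)).trans (delta_sound hu).symm
    · exact h₁.trans (hcv _ _ h)
  · split at h
    · rename_i u' hu
      exact (hcv _ _ h).trans (delta_sound hu).symm
    · cases h

/-- The domain of a function abstraction does not matter for conversion, because of eta. -/
theorem _root_.HoTT.Conv.lam_of_body (A A' : Tm) {t u : Tm} (h : Conv t u) :
    Conv (.lam A t) (.lam A' u) := by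
  have e : Tm.inst (u.rename (Tm.upr Nat.succ)) (.var 0) = u := by
    rw [Tm.inst_eq, Tm.subst_rename]
    have : (fun k => Tm.single (.var 0) (Tm.upr Nat.succ k)) = Tm.var := by
      funext k; cases k <;> rfl
    rw [this, Tm.subst_var]
  have h₁ := Conv.beta (A'.rename Nat.succ) (u.rename (Tm.upr Nat.succ)) (.var 0)
  rw [e] at h₁
  exact (Conv.lam (.refl A) (h.trans h₁.symm)).trans (.eta A (.lam A' u))

/-- Eta as a way to compare an abstraction with another function. -/
theorem conv_eta (hL : ClosedL L) (A : Tm) {t u : R}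
    (h : Conv (t.eval L n ρ) ((app (shift u) (var 0)).eval L n ρ)) :
    Conv (.lam A (t.eval L n ρ)) (u.eval L n ρ) := by
  refine (Conv.lam (.refl A) h).trans ?_
  simp only [eval, eval_shift hL]
  exact .eta _ _

theorem compare_sound (hL : ClosedL L) {cv : R → R → Bool} (hcv : Sound L n ρ cv) :
    Sound L n ρ (compare cv) := by
  intro t u h
  unfold compare at h
  split at h
  · split at h
    · simp only [eval, Lvl.eqv_sound (n := n) (ρ := ρ) h]; exact .refl _
    · cases h
  · split at h
    · exact Conv.lam_of_body _ _ (hcv _ _ h)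
    · exact conv_eta hL _ (hcv _ _ h)
  · split at h
    · simp only [Bool.and_eq_true] at h
      exact .pi (hcv _ _ h.1) (hcv _ _ h.2)
    · exact unfolding_sound hcv _ _ h
  · split at h
    · exact (conv_eta hL _ (hcv _ _ h).symm).symm
    · simp only [Bool.or_eq_true] at h
      rcases h with h | h
      · exact neutral_sound hcv _ _ h
      · exact unfolding_sound hcv _ _ h

theorem eq_of_same {t : R} : ∀ {u}, same t u = true → t = u := by
  induction t with
  | var j =>
    intro u h
    cases u with
    | var k => rw [Nat.eq_of_beq_eq_true h]
    | _ => simp [same] at h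
  | U l =>
    intro u h
    cases u with
    | U l' => rw [Lvl.eq_of_same h]
    | _ => simp [same] at h
  | con h ls =>
    intro u hu
    cases u with
    | con h' ls' =>
      simp only [same, Bool.and_eq_true] at hu
      rw [Head.eq_of_code hu.1, Lvl.eq_of_sames hu.2]
    | _ => simp [same] at hu
  | _ _ _ ih₁ ih₂ =>
    intro u h
    cases u <;> simp only [same, Bool.and_eq_true, Bool.false_eq_true] at h
    rw [ih₁ h.1, ih₂ h.2]

theorem conv_sound (hL : ClosedL L) (f : ℕ) : Sound L n ρ (conv f) := by
  induction f with
  | zero => intro t u h; cases h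
  | succ f ih =>
    intro t u h
    change convStep (conv f) t u = true at h
    simp only [convStep, Bool.or_eq_true] at h
    rcases h with h | h
    · rw [eq_of_same h]; exact .refl _
    exact ((whnf_sound hL ih _ t []).trans (compare_sound hL ih _ _ h)).trans
      (whnf_sound hL ih _ u []).symm

theorem whnfD_sound (hL : ClosedL L) (f : ℕ) :
    ∀ t, Conv (t.eval L n ρ) ((whnfD f t).eval L n ρ) := by
  induction f with
  | zero => intro t; exact .refl _
  | succ f ih =>
    intro t
    have h₁ := whnf_sound (n := n) (ρ := ρ) hL (conv_sound hL 200) 200 t []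
    unfold whnfD
    split
    · rename_i t' ht
      exact (h₁.trans (delta_sound ht)).trans (ih t')
    · exact h₁

/-! ### Type inference -/

/-- The level of a universe. -/
def sort (T : R) : Option Lvl :=
  match whnfD 200 T with
  | U l => some l
  | _ => none

/-- The level `l`, if the given type `T` of a term is the universe `U l`. -/
def inferSort (T : Option R) : Option Lvl :=
  match T with
  | some T => sort T
  | none => none

/-- The type of a product, from the types of its parts. -/
def inferPi (T T' : Option R) : Option R :=
  match inferSort T with
  | some i => match inferSort T' with
    | some j => some (U (.mx i j))
    | none => none
  | none => none

/-- The type of an abstraction, from the type of its domain `A` and the type of its body. -/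
def inferLam (A : R) (T B : Option R) : Option R :=
  match inferSort T with
  | some _ => match B with
    | some B => some (pi A B)
    | none => none
  | none => none

/-- The type `B[a]` of an application, where `A'` is the type of `a`. -/
def inferArg (A B a : R) (A' : Option R) : Option R :=
  match A' with
  | some A' => cond (conv 200 A' A) (some (B.inst a)) none
  | none => none

/-- The type of an application, if the type of the function reduces to `T`. As subject reduction
is not available, `T` has to be type-checked. -/
def inferRed (infer : R → Option R) (T a : R) : Option R :=
  match T with
  | pi A B => match inferSort (infer (pi A B)) with
    | some _ => inferArg A B a (infer a)
    | none => none
  | _ => none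

/-- The type of an application, from the type of the function. -/
def inferApp (infer : R → Option R) (T : Option R) (a : R) : Option R :=
  match T with
  | some T => match T with
    | pi A B => inferArg A B a (infer a)
    | T => inferRed infer (whnfD 200 T) a
  | none => none

/-- One step of `infer`. -/
def inferStep (sig : Head → List Lvl → Option R) (infer : List R → R → Option R) (Γ : List R)
    (t : R) : Option R :=
  match t with
  | var k => match Γ[k]? with
    | some A => some (lift (k + 1) A 0)
    | none => none
  | U l => some (U (.s l))
  | pi A B => inferPi (infer Γ A) (infer (A :: Γ) B)
  | lam A t => inferLam A (infer Γ A) (infer (A :: Γ) t)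
  | app g a => inferApp (infer Γ) (infer Γ g) a
  | con h ls => sig h ls

/-- Type inference. The number bounds the depth of the recursion, and `sig` gives the types
of the constants that may be used. -/
def infer (sig : Head → List Lvl → Option R) (f : ℕ) : List R → R → Option R :=
  Nat.rec (fun _ _ => none) (fun _ => inferStep sig) f

/-- The constants are well-typed. -/
def SigSound (L : ℕ → List ℕ → Tm) (n : ℕ) (ρ : ℕ → ℕ) (sig : Head → List Lvl → Option R) :
    Prop :=
  ∀ h ls A, sig h ls = some A →
    Typing n [] ((con h ls).eval L n ρ) (A.eval L n ρ) ∧ IsTy n [] (A.eval L n ρ)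

theorem sort_sound (hL : ClosedL L) {T : R} {l : Lvl} (h : sort T = some l) :
    Conv (T.eval L n ρ) (.U (l.eval n ρ)) := by
  unfold sort at h
  split at h
  · rename_i l' hl
    cases h
    have := whnfD_sound (n := n) (ρ := ρ) hL 200 T
    rw [hl] at this
    exact this
  · cases h

/-- What soundness of type inference says about a term and its inferred type. -/
def Typed (L : ℕ → List ℕ → Tm) (n : ℕ) (ρ : ℕ → ℕ) (Γ : List R) (t A : R) : Prop :=
  Typing n (Γ.map (eval L n ρ)) (t.eval L n ρ) (A.eval L n ρ) ∧
    IsTy n (Γ.map (eval L n ρ)) (A.eval L n ρ)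

theorem Typed.sort (hL : ClosedL L) {Γ : List R} {t T : R} {l : Lvl}
    (h : Typed L n ρ Γ t T) (hl : sort T = some l) :
    Typing n (Γ.map (eval L n ρ)) (t.eval L n ρ) (.U (l.eval n ρ)) :=
  h.1.conv (sort_sound hL hl) (.univ _ _)

theorem Typed.app (hL : ClosedL L) {Γ : List R} {g a T A B A' : R} (hg : Typed L n ρ Γ g T)
    (hT : Conv (T.eval L n ρ) ((pi A B).eval L n ρ))
    (hP : IsTy n (Γ.map (eval L n ρ)) ((pi A B).eval L n ρ))
    (ha : Typed L n ρ Γ a A') (hA : conv 200 A' A = true) :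
    Typed L n ρ Γ (app g a) (B.inst a) := by
  obtain ⟨i, hi⟩ := hP
  obtain ⟨⟨j, hj⟩, ⟨l, hl⟩⟩ := IsTy.pi_inv ⟨i, hi⟩
  have hg' := hg.1.conv hT hi
  have ha' := ha.1.conv (conv_sound hL 200 _ _ hA) hj
  unfold Typed
  rw [eval_inst hL]
  exact ⟨hg'.app ha', l, hl.inst ha'⟩

theorem inferSort_eq_some {T : Option R} {l : Lvl} (h : inferSort T = some l) :
    ∃ T', T = some T' ∧ R.sort T' = some l := by
  cases T with
  | none => cases h
  | some T => exact ⟨T, rfl, h⟩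

theorem inferArg_sound (hL : ClosedL L) {Γ : List R} {g a T A B C : R} {A' : Option R}
    (hg : Typed L n ρ Γ g T) (hT : Conv (T.eval L n ρ) ((pi A B).eval L n ρ))
    (hP : IsTy n (Γ.map (eval L n ρ)) ((pi A B).eval L n ρ))
    (ha : ∀ T, A' = some T → Typed L n ρ Γ a T) (h : inferArg A B a A' = some C) :
    Typed L n ρ Γ (app g a) C := by
  unfold inferArg at h
  split at h
  · rw [cond_eq_ite] at h
    split at h
    · rename_i hA
      cases h
      exact hg.app hL hT hP (ha _ rfl) hA
    · cases h
  · cases h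

/-- A term with an inferred type has this type in the theory, and the inferred type is a type. The
second part is carried along because the conversion rule requires it. -/
theorem infer_sound (hL : ClosedL L) {sig : Head → List Lvl → Option R}
    (hsig : SigSound L n ρ sig) (f : ℕ) :
    ∀ (Γ : List R) (t A : R), WF n (Γ.map (eval L n ρ)) → infer sig f Γ t = some A →
      Typed L n ρ Γ t A := by
  induction f with
  | zero => intro Γ t A _ h; cases h
  | succ f ih =>
    intro Γ t A hΓ h
    change inferStep sig (infer sig f) Γ t = some A at h
    unfold inferStep at h
    split at h
    · rename_i k
      split at h
      · rename_i B hk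
        cases h
        have hv : VarTy (Γ.map (eval L n ρ)) k ((B.lift (k + 1) 0).eval L n ρ) :=
          ⟨B.eval L n ρ, by rw [List.getElem?_map, hk]; rfl, eval_lift_zero hL _ _⟩
        exact ⟨hv.typing, hΓ _ _ hv⟩
      · cases h
    · cases h; exact ⟨.univ _ _, _, .univ _ _⟩
    · rename_i B C
      unfold inferPi at h
      split at h
      · rename_i i hi
        split at h
        · rename_i j hj
          cases h
          obtain ⟨T, hT, hi⟩ := inferSort_eq_some hi
          obtain ⟨T', hT', hj⟩ := inferSort_eq_some hj
          have h₁ := (ih Γ B T hΓ hT).sort hL hi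
          have h₂ := (ih (B :: Γ) C T' (hΓ.cons ⟨_, h₁⟩) hT').sort hL hj
          exact ⟨.pi h₁ h₂, _, .univ _ _⟩
        · cases h
      · cases h
    · rename_i B u
      unfold inferLam at h
      split at h
      · rename_i i hi
        split at h
        · rename_i C hC
          cases h
          obtain ⟨T, hT, hi⟩ := inferSort_eq_some hi
          have h₁ := (ih Γ B T hΓ hT).sort hL hi
          have h₂ := ih (B :: Γ) u C (hΓ.cons ⟨_, h₁⟩) hC
          obtain ⟨j, hj⟩ := h₂.2
          exact ⟨.lam h₁ hj h₂.1, _, .pi h₁ hj⟩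
        · cases h
      · cases h
    · rename_i g a
      have ha := fun T => ih Γ a T hΓ
      unfold inferApp at h
      split at h
      · rename_i T hg
        have hg := ih _ _ _ hΓ hg
        split at h
        · exact inferArg_sound hL hg (.refl _) hg.2 ha h
        · have hT := whnfD_sound (n := n) (ρ := ρ) hL 200 T
          unfold inferRed at h
          split at h
          · rename_i B C hBC
            rw [hBC] at hT
            split at h
            · rename_i i hi
              obtain ⟨T', hT', hi⟩ := inferSort_eq_some hi
              exact inferArg_sound hL hg hT ⟨_, (ih _ _ _ hΓ hT').sort hL hi⟩ ha h
            · cases h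
          · cases h
      · cases h
    · exact ⟨((hsig _ _ _ h).1.weaken (hsig _ _ _ h).2.choose_spec.closed _),
        _, (hsig _ _ _ h).2.choose_spec.weaken (fun _ => rfl) _⟩

end R

end HoTT.Sym

namespace HoTT.Sym

open R

/-! ### The constants are well-typed -/

/-- The term is a closed type. -/
def isType (sig : Head → List Lvl → Option R) (T : R) : Bool :=
  match (infer sig 400 [] T).bind sort with
  | some _ => true
  | none => false

/-- The closed term `t` has the type `T`. -/
def hasType (sig : Head → List Lvl → Option R) (t T : R) : Bool :=
  match infer sig 400 [] t with
  | some T' => R.conv 200 T' T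
  | none => false

variable {L : ℕ → List ℕ → Tm} {n : ℕ} {ρ : ℕ → ℕ} {sig : Head → List Lvl → Option R}

theorem isType_sound (hL : ClosedL L) (hsig : SigSound L n ρ sig) {T : R}
    (h : isType sig T = true) : IsTy n [] (T.eval L n ρ) := by
  unfold isType at h
  split at h
  · rename_i l hl
    obtain ⟨T', hT', hl⟩ := Option.bind_eq_some_iff.1 hl
    exact ⟨_, (infer_sound hL hsig _ [] T T' (WF.nil n) hT').sort hL hl⟩
  · cases h

theorem hasType_sound (hL : ClosedL L) (hsig : SigSound L n ρ sig) {t T : R}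
    (hT : IsTy n [] (T.eval L n ρ)) (h : hasType sig t T = true) :
    Typing n [] (t.eval L n ρ) (T.eval L n ρ) := by
  unfold hasType at h
  split at h
  · rename_i T' hT'
    obtain ⟨i, hi⟩ := hT
    exact (infer_sound hL hsig _ [] t T' (WF.nil n) hT').1.conv (conv_sound hL _ _ _ h) hi
  · cases h

/-- The type of a constant uses only constants of smaller rank. -/
def Head.rank : Head → ℕ
  | .sig | .empty | .unit | .sum | .id => 0
  | .pair | .star | .inl | .inr | .refl => 1
  | .split | .emptyElim | .unitElim | .sumElim | .J | .funext => 2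
  | .isTrunc => 3
  | .ua | .W => 4
  | .sup | .trunc => 5
  | .wElim => 6
  | .wBeta => 7
  | .lem _ => 8

/-- The constants of rank below `r`. -/
def sigBelow (r : ℕ) (h : Head) (ls : List Lvl) : Option R :=
  cond (Nat.blt h.rank r) (some (h.ty ls)) none

/-- Generic levels. -/
def genericLevels : List Lvl := [.v 0, .v 1, .v 2, .v 3, .v 4]

theorem Head.eval_ty_generic (h : Head) (ls : List Lvl) :
    (h.ty ls).eval L n ρ =
      (h.ty genericLevels).eval L n fun k => (Lvl.get ls k).eval n ρ := by
  cases h <;> rfl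

/-- The types of the constants are types, by evaluation of the checker at generic levels. -/
theorem Head.isType_ty (h : Head) : isType (sigBelow h.rank) (h.ty genericLevels) = true := by
  cases h
  case lem k => exact (by decide +kernel : isType (sigBelow 8) (.U .z) = true)
  all_goals decide +kernel

/-- The signature with the constants of rank below `3` and one instance of `isTrunc`, which stands
for the predicate of the truncation level below. -/
def sigTrunc : Head → List Lvl → Option R
  | .isTrunc, [.v 0, .v 1] => some (Head.isTrunc.ty genericLevels)
  | .isTrunc, _ => none
  | h, ls => sigBelow 3 h ls

theorem isTruncTm_typing (hL : ClosedL L) (h₃ : ∀ ρ, SigSound L n ρ (sigBelow 3)) (i m : ℕ) :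
    Typing n [] (isTruncTm i m) (.pi (.U i) (.U i)) := by
  have ty : IsTy n [] (.pi (.U i) (.U i)) := ⟨_, .pi (.univ _ _) (.univ _ _)⟩
  induction m with
  | zero =>
    let ρ : ℕ → ℕ := fun _ => i
    exact hasType_sound hL (h₃ ρ) (T := Head.isTrunc.ty genericLevels)
      (t := (truncBody (.v 0) .z).getD (.U .z)) ty (by decide +kernel)
  | succ m ih =>
    let ρ : ℕ → ℕ := fun k => match k with
      | 0 => i
      | _ => m
    refine hasType_sound (ρ := ρ) (sig := sigTrunc) hL ?_ (T := Head.isTrunc.ty genericLevels)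
      (t := (truncBody (.v 0) (.s (.v 1))).getD (.U .z)) ty (by decide +kernel)
    intro h ls A hA
    unfold sigTrunc at hA
    split at hA
    · cases hA; exact ⟨ih, ty⟩
    · cases hA
    · exact h₃ ρ _ _ _ hA

theorem sigBelow_sound (hL : ClosedL L) (r : ℕ) (hr : r ≤ 8) :
    ∀ ρ, SigSound L n ρ (sigBelow r) := by
  induction r with
  | zero => intro ρ h ls A hA; simp [sigBelow, Nat.blt, Nat.ble] at hA
  | succ r ih =>
    have ih := ih (by omega)
    intro ρ h ls A hA
    by_cases hlt : h.rank < r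
    · refine ih ρ h ls A ?_
      rw [← hA, sigBelow, sigBelow, Nat.blt, Nat.blt, Nat.ble_eq_true_of_le (by omega),
        Nat.ble_eq_true_of_le (by omega)]
    · have hle : h.rank = r := by
        by_contra hne
        have : Nat.blt h.rank (r + 1) = false := by
          rw [Bool.eq_false_iff]
          intro hb
          have := Nat.le_of_ble_eq_true hb
          omega
        rw [sigBelow, this] at hA
        cases hA
      have e : A = h.ty ls := by
        unfold sigBelow at hA
        rw [cond_eq_ite] at hA
        split at hA <;> cases hA
        rfl
      subst e
      have ty : IsTy n [] ((h.ty ls).eval L n ρ) := by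
        rw [h.eval_ty_generic]
        exact isType_sound hL (ih _) (hle ▸ h.isType_ty)
      refine ⟨?_, ty⟩
      by_cases hc : h.IsConst
      · rw [h.eval_ty L n ρ hc]
        have := Typing.const (n := n) [] (h.const (ls.map (Lvl.eval n ρ)))
        cases h <;> first | exact this | cases hc
      · cases h
        case isTrunc =>
          have hr : 3 = r := hle
          subst hr
          have := isTruncTm_typing hL ih ((Lvl.get ls 0).eval n ρ) ((Lvl.get ls 1).eval n ρ)
          simp only [Lvl.eval_get] at this
          simp only [Head.ty, Head.hty, arr, Pi, Univ, R.eval, Lvl.eval_get]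
          exact this
        case lem => have : 8 = r := hle; omega
        all_goals exact absurd trivial hc

/-! ### Theorems -/

/-- The term mentions no lemmas. -/
def R.pure : R → Bool
  | var _ => true
  | U _ => true
  | pi A B => pure A && pure B
  | lam A t => pure A && pure t
  | app f a => pure f && pure a
  | con (.lem _) _ => false
  | con _ _ => true

theorem R.eval_eq_of_pure {t : R} (hp : t.pure = true) (L L' : ℕ → List ℕ → Tm) :
    t.eval L n ρ = t.eval L' n ρ := by
  induction t with
  | con h ls =>
    cases h
    case lem => cases (hp : false = true)
    all_goals rfl
  | var | U => rfl
  | _ => simp_all [R.pure, R.eval]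

/-- A dummy meaning of lemmas. -/
def noLemmas : ℕ → List ℕ → Tm := fun _ _ => .U 0

/-- The closed type `A`, which depends on levels, is inhabited in the empty context under the
valuation `ρ` of the levels. -/
def Inhabited (n : ℕ) (ρ : ℕ → ℕ) (A : R) : Prop :=
  ∃ t, Typing n [] t (A.eval noLemmas n ρ)

/-- The closed type `A` is a theorem of the type theory, for all values of its levels. -/
structure Thm (n : ℕ) (A : R) : Prop where
  pure : A.pure = true
  isTy : ∀ ρ, IsTy n [] (A.eval noLemmas n ρ)
  inhabited : ∀ ρ, Inhabited n ρ A

/-- The `k`-th statement of a list, and `A` beyond its end. -/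
def stmt (env : List R) (A : R) (k : ℕ) : R := env.getD k A

/-- The signature with all constants, and with lemmas whose statements are the list `env`.
Lemmas beyond the list stand for the statement `self` that is being proved by induction on its
level variable `0`; they are allowed only if this variable is unchanged. -/
def libSig (env : List R) (self : Option R) : Head → List Lvl → Option R
  | .lem k, ls =>
    match env[k]? with
    | some A => some (A.lsubst (Lvl.get ls))
    | none => match self with
      | some A => match ls with
        | .v 0 :: _ => some (A.lsubst (Lvl.get ls))
        | _ => none
      | none => none
  | h, ls => some (h.ty ls)

open Classical in
/-- Lemmas are interpreted by arbitrary inhabitants of their types. So the proof of a lemma is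
type-checked once, and is not copied into the proofs that use the lemma. -/
noncomputable def lemMeaning (n : ℕ) (env : List R) (A : R) (k : ℕ) (ns : List ℕ) : Tm :=
  if h : Inhabited n (fun j => ns.getD j 0) (stmt env A k) then h.choose else .U 0

theorem lemMeaning_closed (n : ℕ) (env : List R) (A : R) : ClosedL (lemMeaning n env A) := by
  intro k ns
  unfold lemMeaning
  split
  · rename_i h; exact h.choose_spec.closed
  · exact fun _ => rfl

theorem lemMeaning_typing {env : List R} {A B : R} {k : ℕ} {ls : List Lvl}
    (hB : stmt env A k = B) (hp : B.pure = true)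
    (ty : IsTy n [] (B.eval noLemmas n fun j => (Lvl.get ls j).eval n ρ))
    (h : Inhabited n (fun j => (Lvl.get ls j).eval n ρ) B) :
    Typing n [] ((con (.lem k) ls).eval (lemMeaning n env A) n ρ)
      ((B.lsubst (Lvl.get ls)).eval (lemMeaning n env A) n ρ) ∧
    IsTy n [] ((B.lsubst (Lvl.get ls)).eval (lemMeaning n env A) n ρ) := by
  subst hB
  rw [eval_lsubst, eval_eq_of_pure hp _ noLemmas]
  refine ⟨?_, ty⟩
  have e : (fun j => (ls.map (Lvl.eval n ρ)).getD j 0) = fun j => (Lvl.get ls j).eval n ρ := by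
    funext j; exact (Lvl.eval_get ls j).symm
  have h' : Inhabited n (fun j => (ls.map (Lvl.eval n ρ)).getD j 0) (stmt env A k) := by
    rw [e]; exact h
  have := h'.choose_spec
  simp only [R.eval, Head.eval, lemMeaning, dif_pos h']
  convert this using 2
  exact e.symm

theorem libSig_sound {env : List R} (henv : ∀ A ∈ env, Thm n A) (A : R) (self : Option R)
    (hself : ∀ B, self = some B → B = A ∧ A.pure = true ∧
      ∀ ρ', ρ' 0 = ρ 0 → IsTy n [] (A.eval noLemmas n ρ') ∧ Inhabited n ρ' A) :
    SigSound (lemMeaning n env A) n ρ (libSig env self) := by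
  intro h ls T hT
  unfold libSig at hT
  split at hT
  · rename_i k
    split at hT
    · rename_i B hB
      cases hT
      have hm := henv B (List.mem_of_getElem? hB)
      exact lemMeaning_typing (by simp [stmt, hB]) hm.pure (hm.isTy _) (hm.inhabited _)
    · rename_i hk
      -- The lemma is not in the list, so it is the induction hypothesis.
      split at hT
      · rename_i B
        obtain ⟨rfl, hp, hB⟩ := hself B rfl
        split at hT
        · cases hT
          obtain ⟨h₁, h₂⟩ := hB (fun j => (Lvl.get (.v 0 :: _) j).eval n ρ) rfl
          exact lemMeaning_typing (by simp [stmt, hk]) hp h₁ h₂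
        · cases hT
      · cases hT
  · rename_i hne
    cases hT
    refine sigBelow_sound (lemMeaning_closed n env A) 8 (le_refl 8) ρ h ls _ ?_
    cases h
    case lem k => exact absurd rfl (hne k)
    all_goals rfl

/-- The term `t` proves the type `A` with the help of the lemmas `env`. -/
def proves (env : List R) (A t : R) : Bool :=
  R.pure A && isType (libSig env none) A && hasType (libSig env none) t A

theorem Thm.of_proves {env : List R} {A : R} (henv : ∀ B ∈ env, Thm n B) (t : R)
    (h : proves env A t = true) : Thm n A := by
  simp only [proves, Bool.and_eq_true] at h
  obtain ⟨⟨hp, hty⟩, ht⟩ := h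
  have hs : ∀ ρ, SigSound (lemMeaning n env A) n ρ (libSig env none) := fun ρ =>
    libSig_sound henv A none (by simp)
  have ty : ∀ ρ, IsTy n [] (A.eval (lemMeaning n env A) n ρ) := fun ρ =>
    isType_sound (lemMeaning_closed n env A) (hs ρ) hty
  refine ⟨hp, fun ρ => ?_, fun ρ => ⟨t.eval (lemMeaning n env A) n ρ, ?_⟩⟩ <;>
    rw [eval_eq_of_pure hp _ (lemMeaning n env A)]
  · exact ty ρ
  · exact hasType_sound (lemMeaning_closed n env A) (hs ρ) (ty ρ) ht

/-- The substitution of `l` for the level variable `0`. -/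
def setZero (l : Lvl) : ℕ → Lvl
  | 0 => l
  | k + 1 => .v (k + 1)

/-- The terms `t₀` and `t₁` are the base case and the induction step of a proof of `A` by
induction on the level variable `0`. -/
def provesByInduction (env : List R) (A t₀ t₁ : R) : Bool :=
  R.pure A && isType (libSig env none) A &&
    hasType (libSig env none) t₀ (A.lsubst (setZero .z)) &&
    hasType (libSig env (some A)) t₁ (A.lsubst (setZero (.s (.v 0))))

/-- The truncation index is external to the theory, so an induction on it is an induction of the
metatheory; the induction step may use the statement at the previous index as a lemma. -/
theorem Thm.of_provesByInduction {env : List R} {A : R} (henv : ∀ B ∈ env, Thm n B)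
    (t₀ t₁ : R) (h : provesByInduction env A t₀ t₁ = true) : Thm n A := by
  simp only [provesByInduction, Bool.and_eq_true] at h
  obtain ⟨⟨⟨hp, hty⟩, h₀⟩, h₁⟩ := h
  have hL := lemMeaning_closed n env A
  have hs : ∀ ρ, SigSound (lemMeaning n env A) n ρ (libSig env none) := fun ρ =>
    libSig_sound henv A none (by simp)
  have ty' : ∀ ρ, IsTy n [] (A.eval (lemMeaning n env A) n ρ) := fun ρ =>
    isType_sound hL (hs ρ) hty
  have ty : ∀ ρ, IsTy n [] (A.eval noLemmas n ρ) := fun ρ => by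
    rw [eval_eq_of_pure hp _ (lemMeaning n env A)]; exact ty' ρ
  have key : ∀ m ρ, ρ 0 = m → Inhabited n ρ A := by
    intro m
    induction m with
    | zero =>
      intro ρ hρ
      have e : (fun k => (setZero .z k).eval n ρ) = ρ := by
        funext k; cases k
        · exact hρ.symm
        · rfl
      refine ⟨t₀.eval (lemMeaning n env A) n ρ, ?_⟩
      have := hasType_sound hL (hs ρ) (by rw [eval_lsubst, e]; exact ty' ρ) h₀
      rw [eval_lsubst, e] at this
      rwa [eval_eq_of_pure hp _ (lemMeaning n env A)]
    | succ m ih =>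
      intro ρ hρ
      let ρ' : ℕ → ℕ := fun k => match k with
        | 0 => m
        | k => ρ k
      have e : (fun k => (setZero (.s (.v 0)) k).eval n ρ') = ρ := by
        funext k; cases k
        · exact hρ.symm
        · rfl
      refine ⟨t₁.eval (lemMeaning n env A) n ρ', ?_⟩
      have hs' : SigSound (lemMeaning n env A) n ρ' (libSig env (some A)) :=
        libSig_sound henv A (some A) fun B hB =>
          ⟨(Option.some.inj hB).symm, hp, fun ρ'' h'' => ⟨ty _, ih _ h''⟩⟩
      have := hasType_sound hL hs' (by rw [eval_lsubst, e]; exact ty' ρ) h₁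
      rw [eval_lsubst, e] at this
      rwa [eval_eq_of_pure hp _ (lemMeaning n env A)]
  exact ⟨hp, ty, fun ρ => key _ ρ rfl⟩

/-- A proof of a statement: a term, or the base case and the induction step of a proof by
induction on the level variable `0`. -/
inductive Proof : Type
  | direct (t : R)
  | induction (t₀ t₁ : R)

/-- A statement with its proof. -/
structure Entry : Type where
  stmt : R
  proof : Proof

/-- The entry is correct relative to the lemmas `env`. -/
def Entry.check (env : List R) (e : Entry) : Bool :=
  match e.proof with
  | .direct t => proves env e.stmt t
  | .induction t₀ t₁ => provesByInduction env e.stmt t₀ t₁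

/-- Every entry is correct relative to the lemmas `env` and the entries before it. So the lemma
`lem k` is the entry number `k` of the list, if `env` is empty. -/
def checkAll (env : List R) : List Entry → Bool
  | [] => true
  | e :: es => e.check env && checkAll (env ++ [e.stmt]) es

theorem thm_of_checkAll (es : List Entry) : ∀ {env : List R}, (∀ A ∈ env, Thm n A) →
    checkAll env es = true → ∀ A ∈ env ++ es.map Entry.stmt, Thm n A := by
  induction es with
  | nil => intro env henv _ A hA; exact henv A (by simpa using hA)
  | cons e es ih =>
    intro env henv h
    simp only [checkAll, Bool.and_eq_true] at h
    have he : Thm n e.stmt := by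
      have := h.1
      unfold Entry.check at this
      split at this
      · exact .of_proves henv _ this
      · exact .of_provesByInduction henv _ _ this
    have := ih (env := env ++ [e.stmt]) (fun A hA => by
      rcases List.mem_append.1 hA with hA | hA
      · exact henv A hA
      · rw [List.mem_singleton.1 hA]; exact he) h.2
    simpa using this

theorem Thm.provable {A : R} (h : Thm n A) (ρ : ℕ → ℕ) {B : HTm}
    (hB : B 0 = A.eval noLemmas n ρ) : Provable n B := by
  unfold Provable
  rw [hB]
  exact ⟨h.isTy ρ, h.inhabited ρ⟩

end HoTT.Sym

namespace HoTT.Sym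

/-! ### A typed surface syntax -/

/-- A term that is meant to have the type `A`. The index `A` only guides the elaboration of
implicit arguments; it carries no guarantee, as the terms are type-checked by `proves`. -/
structure E (A : H) where
  tm : H

/-- A term that is meant to be a type of level `i`. -/
abbrev Ty (i : Lvl) : Type := E (Univ i)

instance (i : Lvl) : CoeSort (Ty i) Type := ⟨fun A => E A.tm⟩

/-- Regard a term as a term of another type, which should be convertible to its type. -/
def cv {A B : H} (x : E A) : E B := ⟨x.tm⟩

/-- The universe of level `i`. -/
@[reducible] def univ (i : Lvl) : Ty (.s i) := ⟨Univ i⟩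

variable {i j k l m : Lvl}

/-- Dependent products. This type former and those below are irreducible, so that unification
recovers implicit arguments from types. -/
@[irreducible] def pi (A : Ty i) (B : A → Ty j) : Ty (.mx i j) := ⟨Pi A.tm fun x => (B ⟨x⟩).tm⟩

/-- Function types. -/
abbrev fn (A : Ty i) (B : Ty j) : Ty (.mx i j) := pi A fun _ => B

infixr:30 " ⇒ " => fn

def lam {A : Ty i} {B : A → Ty j} (f : (x : A) → B x) : pi A B :=
  ⟨Lam A.tm fun x => (f ⟨x⟩).tm⟩

def app {A : Ty i} {B : A → Ty j} (f : pi A B) (a : A) : B a := ⟨ap f.tm [a.tm]⟩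

instance (A : Ty i) (B : A → Ty j) : CoeFun (E (pi A B).tm) fun _ => (a : A) → B a := ⟨app⟩

/-- A family of types as a function into the universe. -/
def fam {A : Ty i} (B : A → Ty j) : A ⇒ univ j := lam B

/-- Dependent sums. -/
@[irreducible] def sg (A : Ty i) (B : A → Ty j) : Ty (.mx i j) :=
  ⟨Sig i j A.tm fun x => (B ⟨x⟩).tm⟩

def pair {A : Ty i} {B : A → Ty j} (a : A) (b : B a) : sg A B :=
  ⟨Pair i j A.tm (fun x => (B ⟨x⟩).tm) a.tm b.tm⟩

def sgElim {A : Ty i} {B : A → Ty j} (C : sg A B → Ty k) (f : (a : A) → (b : B a) → C (pair a b))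
    (z : sg A B) : C z :=
  ⟨cst .split [i, j, k] [A.tm, Lam A.tm fun x => (B ⟨x⟩).tm,
    Lam (Sig i j A.tm fun x => (B ⟨x⟩).tm) fun z => (C ⟨z⟩).tm,
    Lam A.tm fun a => Lam (B ⟨a⟩).tm fun b => (f ⟨a⟩ ⟨b⟩).tm, z.tm]⟩

def fst {A : Ty i} {B : A → Ty j} (z : sg A B) : A :=
  ⟨Fst i j A.tm (fun x => (B ⟨x⟩).tm) z.tm⟩

def snd {A : Ty i} {B : A → Ty j} (z : sg A B) : B (fst z) :=
  sgElim (fun z => B (fst z)) (fun _ b => cv b) z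

/-- The components of a pair, for use in a type that does not depend on it. -/
def unpack {A : Ty i} {B : A → Ty j} {C : Ty k} (z : sg A B) (f : (a : A) → B a → C) : C :=
  sgElim (fun _ => C) f z

/-- Identity types. -/
@[irreducible] def eq {A : Ty i} (x y : A) : Ty i := ⟨Eq i A.tm x.tm y.tm⟩

infix:50 " ≐ " => eq

def refl {A : Ty i} (x : A) : x ≐ x := ⟨Refl i A.tm x.tm⟩

/-- Based path induction. -/
def ind {A : Ty i} {x : A} (C : (y : A) → x ≐ y → Ty k) (d : C x (refl x)) {y : A}
    (p : x ≐ y) : C y p :=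
  ⟨Ind i k A.tm x.tm (fun y p => (C ⟨y⟩ ⟨p⟩).tm) d.tm y.tm p.tm⟩

/-- Transport along a path. -/
def transport {A : Ty i} (F : A ⇒ univ k) {x y : A} (p : x ≐ y) (u : F x) : E (F y).tm :=
  ⟨Transport i k A.tm F.tm x.tm y.tm p.tm u.tm⟩

def sym {A : Ty i} {x y : A} (p : x ≐ y) : y ≐ x := ind (fun y _ => y ≐ x) (refl x) p

def concat {A : Ty i} {x y z : A} (p : x ≐ y) (q : y ≐ z) : x ≐ z :=
  ind (fun z _ => x ≐ z) p q

def cong {A : Ty i} {B : Ty j} (f : A → B) {x y : A} (p : x ≐ y) : f x ≐ f y :=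
  ind (fun y _ => f x ≐ f y) (refl (f x)) p

def funext {A : Ty i} {B : A → Ty j} {f g : pi A B} (h : pi A fun x => f x ≐ g x) : f ≐ g :=
  ⟨cst .funext [i, j] [A.tm, Lam A.tm fun x => (B ⟨x⟩).tm, f.tm, g.tm, h.tm]⟩

/-- The type `A` is `(m-2)`-truncated. -/
@[irreducible] def isTrunc (m : Lvl) (A : Ty i) : Ty i := ⟨IsTrunc i m A.tm⟩

/-- The type `A` is a proposition. -/
abbrev isProp (A : Ty i) : Ty i := isTrunc (.s .z) A

def ofContr {A : Ty i} (h : sg A fun c => pi A fun x => c ≐ x) : isTrunc .z A := cv h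

/-- The center of a contractible type. -/
def center {A : Ty i} (h : isTrunc .z A) : A :=
  fst (cv h : sg A fun c => pi A fun x => c ≐ x)

def contraction {A : Ty i} (h : isTrunc .z A) (x : A) : center h ≐ x :=
  snd (cv h : sg A fun c => pi A fun x => c ≐ x) x

def ofPaths {A : Ty i} (h : pi A fun x => pi A fun y => isTrunc m (x ≐ y)) : isTrunc (.s m) A :=
  cv h

def paths {A : Ty i} (h : isTrunc (.s m) A) (x y : A) : isTrunc m (x ≐ y) :=
  (cv h : pi A fun x => pi A fun y => isTrunc m (x ≐ y)) x y

def unit (i : Lvl) : Ty i := ⟨cst .unit [i] []⟩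

def star (i : Lvl) : unit i := ⟨cst .star [i] []⟩

def unitElim (C : unit i → Ty k) (d : C (star i)) (z : unit i) : C z :=
  ⟨cst .unitElim [i, k] [Lam (unit i).tm fun z => (C ⟨z⟩).tm, d.tm, z.tm]⟩

/-- The lemma with the number `k` at the levels `ls`, with the statement `T`. For a lemma `foo` of
the theory, `fooT` is its statement, depending on levels, `fooEntry` is its statement and its proof, and
`foo` is the application of the lemma, with implicit arguments. The numbers of the lemmas are their
positions in `allEntries`. -/
def lem (k : ℕ) (ls : List Lvl) (T : Ty j) : T := ⟨fun _ => .con (.lem k) ls⟩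

/-- The closed type as a statement. -/
def Ty.stmt (T : Ty j) : R := T.tm 0

/-- The closed term as a proof. -/
def E.pf {A : H} (t : E A) : R := t.tm 0

end HoTT.Sym

namespace HoTT.Sym

set_option linter.unusedVariables false

variable {i j k l m a b c q r e w u : Lvl}

/-! ### Truncated types -/

abbrev symConcatT (i : Lvl) := pi (univ i) fun A => pi A fun x => pi A fun y =>
  pi (x ≐ y) fun p => concat (sym p) p ≐ refl y

def symConcat {A : Ty i} {x y : A} (p : x ≐ y) : concat (sym p) p ≐ refl y :=
  lem 0 [i] (symConcatT i) A x y p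

def symConcatEntry : Entry where
  stmt := (symConcatT (.v 0)).stmt
  proof := .direct <| E.pf (A := (symConcatT (.v 0)).tm) <|
    lam fun _ => lam fun x => lam fun _ => lam fun p =>
      ind (fun y p => concat (sym p) p ≐ refl y) (cv (refl (refl x))) p

abbrev truncRetractT (m i j : Lvl) := pi (univ i) fun A => pi (univ j) fun B =>
  pi (A ⇒ B) fun s => pi (B ⇒ A) fun r => (pi A fun a => r (s a) ≐ a) ⇒ isTrunc m B ⇒ isTrunc m A

/-- A retract of a truncated type is truncated. -/
def truncRetract {A : Ty i} {B : Ty j} (s : A → B) (r : B → A)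
    (h : (a : A) → r (s a) ≐ a) (H : isTrunc m B) : isTrunc m A :=
  lem 1 [m, i, j] (truncRetractT m i j) A B (lam s) (lam r) (cv (lam h)) H

/-- The identity types of `Z` at `z₀` are retracts of a family `C` with an element of `C z₀` and
a map from `C` to the identity types: after a correction by a loop, this map sends the given
element to `refl`. -/
def encodeDecode {Z : Ty i} {z₀ : Z} (C : Z → Ty j) (c : C z₀)
    (dec : (z : Z) → C z → z₀ ≐ z) (z : Z) (H : isTrunc m (C z)) : isTrunc m (z₀ ≐ z) :=
  truncRetract (fun p => ind (fun z _ => C z) c p)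
    (fun x => concat (sym (dec z₀ c)) (dec z x))
    (fun p => ind
      (fun z p => concat (sym (dec z₀ c)) (dec z (ind (fun z _ => C z) c p)) ≐ p)
      (cv (symConcat (dec z₀ c))) p) H

def truncRetractEntry : Entry where
  stmt := (truncRetractT (.v 0) (.v 1) (.v 2)).stmt
  proof := .induction
    (E.pf (A := (truncRetractT .z (.v 1) (.v 2)).tm) <|
      lam fun _ => lam fun _ => lam fun s => lam fun r => lam fun h => lam fun H =>
        ofContr (pair (r (center H)) (lam fun x => concat (cong r (contraction H (s x))) (h x))))
    (E.pf (A := (truncRetractT (.s (.v 0)) (.v 1) (.v 2)).tm) <|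
      lam fun _ => lam fun _ => lam fun s => lam fun r => lam fun h => lam fun H =>
        ofPaths (lam fun x => lam fun y =>
          encodeDecode (fun y => s x ≐ s y) (refl (s x))
            (fun y q => concat (sym (h x)) (concat (cong r q) (h y))) y (paths H (s x) (s y))))

abbrev encodeDecodeT (m i j : Lvl) := pi (univ i) fun Z => pi Z fun z₀ => pi (Z ⇒ univ j) fun C =>
  C z₀ ⇒ (pi Z fun z => C z ⇒ z₀ ≐ z) ⇒ pi Z fun z => isTrunc m (C z) ⇒ isTrunc m (z₀ ≐ z)

def encodeDecodeEntry : Entry where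
  stmt := (encodeDecodeT (.v 0) (.v 1) (.v 2)).stmt
  proof := .direct <| E.pf (A := (encodeDecodeT (.v 0) (.v 1) (.v 2)).tm) <|
    lam fun _ => lam fun _ => lam fun C => lam fun c => lam fun dec => lam fun z => lam fun H =>
      encodeDecode (fun z => C z) c (fun z x => dec z x) z H

/-- The folded form of `encodeDecode`. -/
def truncCode {Z : Ty i} {z₀ : Z} (C : Z → Ty j) (c : C z₀)
    (dec : (z : Z) → C z → z₀ ≐ z) (z : Z) (H : isTrunc m (C z)) : isTrunc m (z₀ ≐ z) :=
  lem 2 [m, i, j] (encodeDecodeT m i j) Z z₀ (fam C) (cv c)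
    (cv (lam (A := Z) (B := fun z => C z ⇒ z₀ ≐ z) fun z => lam fun x => dec z x)) z (cv H)

abbrev unitContrT (i : Lvl) := isTrunc .z (unit i)

def unitContr : isTrunc .z (unit i) := lem 3 [i] (unitContrT i)

def unitContrEntry : Entry where
  stmt := (unitContrT (.v 0)).stmt
  proof := .direct <| E.pf (A := (unitContrT (.v 0)).tm) <|
    ofContr (pair (star _) (lam fun x => unitElim (fun x => star _ ≐ x) (refl _) x))

abbrev propOfPathsT (i : Lvl) := pi (univ i) fun A =>
  (pi A fun x => pi A fun y => x ≐ y) ⇒ isProp A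

def propOfPaths {A : Ty i} (h : (x y : A) → x ≐ y) : isProp A :=
  lem 4 [i] (propOfPathsT i) A (lam fun x => lam fun y => h x y)

def propOfPathsEntry : Entry where
  stmt := (propOfPathsT (.v 0)).stmt
  proof := .direct <| E.pf (A := (propOfPathsT (.v 0)).tm) <|
    lam fun _ => lam fun h => cv <| ofPaths (m := .z) <| lam fun x => lam fun y =>
      truncCode (fun _ => unit .z) (star _) (fun y _ => h x y) y unitContr

/-- The equality of two elements of a proposition. -/
def propPath {A : Ty i} (h : isProp A) (x y : A) : x ≐ y :=
  center (paths (m := .z) (cv h) x y)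

abbrev truncSuccT (m i : Lvl) := pi (univ i) fun A => isTrunc m A ⇒ isTrunc (.s m) A

def truncSucc {A : Ty i} (h : isTrunc m A) : isTrunc (.s m) A :=
  lem 5 [m, i] (truncSuccT m i) A h

def truncSuccEntry : Entry where
  stmt := (truncSuccT (.v 0) (.v 1)).stmt
  proof := .induction
    (E.pf (A := (truncSuccT .z (.v 1)).tm) <| lam fun _ => lam fun h => cv <|
      propOfPaths fun x y => concat (sym (contraction h x)) (contraction h y))
    (E.pf (A := (truncSuccT (.s (.v 0)) (.v 1)).tm) <| lam fun _ => lam fun h =>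
      ofPaths (lam fun x => lam fun y => truncSucc (paths h x y)))

abbrev truncOfPropT (m i : Lvl) := pi (univ i) fun A => isProp A ⇒ isTrunc (.s m) A

def truncOfProp {A : Ty i} (h : isProp A) : isTrunc (.s m) A :=
  lem 6 [m, i] (truncOfPropT m i) A h

def truncOfPropEntry : Entry where
  stmt := (truncOfPropT (.v 0) (.v 1)).stmt
  proof := .induction
    (E.pf (A := (truncOfPropT .z (.v 1)).tm) <| lam fun _ => lam fun h => cv h)
    (E.pf (A := (truncOfPropT (.s (.v 0)) (.v 1)).tm) <| lam fun _ => lam fun h =>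
      truncSucc (truncOfProp h))

abbrev truncPiT (m i j : Lvl) := pi (univ i) fun A => pi (A ⇒ univ j) fun B =>
  (pi A fun x => isTrunc m (B x)) ⇒ isTrunc m (pi A fun x => B x)

def truncPi {A : Ty i} {B : A → Ty j} (h : (x : A) → isTrunc m (B x)) : isTrunc m (pi A B) :=
  cv (lem 7 [m, i, j] (truncPiT m i j) A (fam B) (cv (lam h)))

def truncPiEntry : Entry where
  stmt := (truncPiT (.v 0) (.v 1) (.v 2)).stmt
  proof := .induction
    (E.pf (A := (truncPiT .z (.v 1) (.v 2)).tm) <| lam fun A => lam fun B => lam fun h =>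
      ofContr (pair (lam fun x => center (h x))
        (lam fun f => funext (lam fun x => cv (contraction (h x) (f x))))))
    (E.pf (A := (truncPiT (.s (.v 0)) (.v 1) (.v 2)).tm) <| lam fun A => lam fun B => lam fun h =>
      ofPaths (lam fun f => lam fun g =>
        truncCode (fun g : pi A fun x => B x => pi A fun x => f x ≐ g x) (lam fun x => refl (f x))
          (fun g p => funext p) g (truncPi fun x => paths (h x) (f x) (g x))))

abbrev pairPathT (i j : Lvl) := pi (univ i) fun A => pi (A ⇒ univ j) fun B =>
  pi A fun a => pi (B a) fun b => pi A fun a' => pi (B a') fun b' =>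
  pi (a ≐ a') fun p => (transport B p b ≐ b') ⇒
    pair (A := A) (B := fun a => B a) a b ≐ pair (A := A) (B := fun a => B a) a' b'

/-- The equality of two pairs, from equalities of the components. -/
def pairPath {A : Ty i} {B : A → Ty j} {a a' : A} {b : B a} {b' : B a'} (p : a ≐ a')
    (q : E (Eq j (B a').tm (Transport i j A.tm (fam B).tm a.tm a'.tm p.tm b.tm) b'.tm)) :
    pair (A := A) (B := B) a b ≐ pair (A := A) (B := B) a' b' :=
  cv (lem 8 [i, j] (pairPathT i j) A (fam B) a (cv b) a' (cv b') p (cv q))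

def pairPathEntry : Entry where
  stmt := (pairPathT (.v 0) (.v 1)).stmt
  proof := .direct <| E.pf (A := (pairPathT (.v 0) (.v 1)).tm) <|
    lam fun A => lam fun B => lam fun a => lam fun b => lam fun a' => lam fun b' =>
      lam fun p => lam fun q =>
        ind (fun a' p => pi (B a') fun b' => (transport B p b ≐ b') ⇒
            pair (A := A) (B := fun a => B a) a b ≐ pair (A := A) (B := fun a => B a) a' b')
          (lam fun b' => lam fun q => ind (fun b' _ =>
              pair (A := A) (B := fun a => B a) a b ≐ pair (A := A) (B := fun a => B a) a b')
            (refl _) (cv q : b ≐ b')) p b' q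

/-- The paths from `z` to `z'` in `Σ (x : A), B x`, as pairs. -/
def sgPath {A : Ty i} {B : A ⇒ univ j} (z z' : sg A fun x => B x) : Ty (.mx i j) :=
  sg (fst z ≐ fst z') fun p => transport B p (snd z) ≐ snd z'

abbrev truncSgPathT (m i j : Lvl) := pi (univ i) fun A => pi (A ⇒ univ j) fun B =>
  pi (sg A fun x => B x) fun z => pi (sg A fun x => B x) fun z' =>
    isTrunc m (sgPath z z') ⇒ isTrunc m (z ≐ z')

def truncSgPath {A : Ty i} {B : A ⇒ univ j} {z z' : sg A fun x => B x}
    (h : isTrunc m (sgPath z z')) : isTrunc m (z ≐ z') :=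
  lem 9 [m, i, j] (truncSgPathT m i j) A B z z' h

def truncSgPathEntry : Entry where
  stmt := (truncSgPathT (.v 0) (.v 1) (.v 2)).stmt
  proof := .direct <| E.pf (A := (truncSgPathT (.v 0) (.v 1) (.v 2)).tm) <|
    lam fun A => lam fun B => lam fun z => lam fun z' => lam fun h =>
      truncCode (fun z' => sgPath z z') (pair (refl _) (cv (refl (snd z))))
        (fun z' w => sgElim (fun z => sgPath z z' ⇒ z ≐ z')
          (fun a b => sgElim (fun z' => sgPath (pair a b) z' ⇒ pair a b ≐ z')
            (fun a' b' => lam fun w => pairPath (cv (fst w)) (cv (snd w))) z') z w) z' h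

abbrev truncSgT (m i j : Lvl) := pi (univ i) fun A => pi (A ⇒ univ j) fun B =>
  isTrunc m A ⇒ (pi A fun x => isTrunc m (B x)) ⇒ isTrunc m (sg A fun x => B x)

def truncSg {A : Ty i} {B : A → Ty j} (hA : isTrunc m A) (hB : (x : A) → isTrunc m (B x)) :
    isTrunc m (sg A B) :=
  cv (lem 10 [m, i, j] (truncSgT m i j) A (fam B) hA (cv (lam hB)))

def truncSgEntry : Entry where
  stmt := (truncSgT (.v 0) (.v 1) (.v 2)).stmt
  proof := .induction
    (E.pf (A := (truncSgT .z (.v 1) (.v 2)).tm) <| lam fun A => lam fun B => lam fun hA =>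
      lam fun hB => ofContr (pair (pair (center hA) (center (hB (center hA))))
        (lam fun z => sgElim (fun z => pair (center hA) (center (hB (center hA))) ≐ z)
          (fun a b => pairPath (contraction hA a)
            (cv (concat (sym (contraction (hB a) (transport B (contraction hA a)
              (center (hB (center hA)))))) (contraction (hB a) b)))) z)))
    (E.pf (A := (truncSgT (.s (.v 0)) (.v 1) (.v 2)).tm) <| lam fun A => lam fun B =>
      lam fun hA => lam fun hB => ofPaths (lam fun z => lam fun z' =>
        truncSgPath (truncSg (paths hA (fst z) (fst z'))
          fun p => paths (hB (fst z')) (transport B p (snd z)) (snd z'))))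

abbrev isPropTruncT (m i : Lvl) := pi (univ i) fun A => isProp (isTrunc m A)

/-- Being truncated is a proposition. -/
def isPropTrunc {A : Ty i} : isProp (isTrunc m A) := lem 11 [m, i] (isPropTruncT m i) A

/-- A type is a proposition if it is one as soon as it has an element. -/
def propOfSelf {A : Ty i} (h : A → isProp A) : isProp A :=
  cv <| ofPaths (m := .z) <| lam fun x => lam fun y => paths (m := .z) (cv (h x)) x y

def isPropTruncEntry : Entry where
  stmt := (isPropTruncT (.v 0) (.v 1)).stmt
  proof := .induction
    (E.pf (A := (isPropTruncT .z (.v 1)).tm) <| lam fun A =>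
      propOfSelf (A := isTrunc .z A) fun c => cv (truncSucc (m := .z)
        (truncSg (A := A) (B := fun a => pi A fun x => a ≐ x) c fun a => truncPi fun x =>
          paths (truncSucc c) a x)))
    (E.pf (A := (isPropTruncT (.s (.v 0)) (.v 1)).tm) <| lam fun A =>
      cv (truncPi (m := .s .z) fun x : A => truncPi (m := .s .z) fun y : A =>
        (isPropTrunc (m := .v 0) (A := x ≐ y))))

def truncEntries : List Entry :=
  [symConcatEntry, truncRetractEntry, encodeDecodeEntry, unitContrEntry, propOfPathsEntry,
    truncSuccEntry, truncOfPropEntry, truncPiEntry, pairPathEntry, truncSgPathEntry,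
    truncSgEntry, isPropTruncEntry]

/-! ### Univalence -/

/-- The function `f` is an equivalence. -/
def isEquiv {A : Ty i} {B : Ty j} (f : A ⇒ B) : Ty (.mx j (.mx i j)) :=
  pi B fun y => isTrunc .z (sg A fun x => f x ≐ y)

/-- The equivalences of `A` and `B`. -/
def equiv (A B : Ty i) : Ty (.mx (.mx i i) (.mx i (.mx i i))) :=
  sg (A ⇒ B) fun f => isEquiv f

/-- The `(n-1)`-types in a universe. -/
abbrev truncUniv (U : Ty k) (El : U ⇒ univ l) : Ty (.mx k l) :=
  sg U fun X => isTrunc (.s .n) (El X)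

/-- The universe `(U, El)` is univalent for `(n-1)`-types. -/
def univalentFor (U : Ty k) (El : U ⇒ univ l) : Ty (.mx k l) :=
  ⟨UnivalentFor (.s .n) k l U.tm fun X => ap El.tm [X]⟩

abbrev preimageT (i j : Lvl) := pi (univ i) fun A => pi (univ j) fun B => pi (A ⇒ B) fun f =>
  isEquiv f ⇒ B ⇒ A

/-- The inverse of an equivalence, as a function. -/
def preimage {A : Ty i} {B : Ty j} (f : A ⇒ B) (h : isEquiv f) (y : B) : A :=
  lem 12 [i, j] (preimageT i j) A B f h y

def preimageEntry : Entry where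
  stmt := (preimageT (.v 0) (.v 1)).stmt
  proof := .direct <| E.pf (A := (preimageT (.v 0) (.v 1)).tm) <|
    lam fun A => lam fun B => lam fun f => lam fun h => lam fun y =>
      fst (center (A := sg A fun x => f x ≐ y)
        (app (B := fun y => isTrunc .z (sg A fun x => f x ≐ y)) (cv h) y))

abbrev pathOfEquivT (k l : Lvl) := pi (univ k) fun U => pi (U ⇒ univ l) fun El =>
  univalentFor U El ⇒ pi (truncUniv U El) fun x => pi (truncUniv U El) fun y =>
    equiv (El (fst x)) (El (fst y)) ⇒ x ≐ y

/-- Equivalent `(n-1)`-types of a univalent universe are equal. -/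
def pathOfEquiv {U : Ty k} {El : U ⇒ univ l} (h : univalentFor U El) {x y : truncUniv U El}
    (f : equiv (El (fst x)) (El (fst y))) : x ≐ y :=
  lem 13 [k, l] (pathOfEquivT k l) U El h x y f

def pathOfEquivEntry : Entry where
  stmt := (pathOfEquivT (.v 0) (.v 1)).stmt
  proof := .direct <| E.pf (A := (pathOfEquivT (.v 0) (.v 1)).tm) <|
    lam fun U => lam fun El => lam fun h => lam fun x => lam fun y => lam fun f =>
      let X := truncUniv U El
      let Y := equiv (El (fst x)) (El (fst y))
      let g : (x ≐ y) ⇒ Y :=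
        ⟨IdToEquiv (.mx (.v 0) (.v 1)) (.v 1) X.tm (fun z => (El (fst (⟨z⟩ : X))).tm) x.tm y.tm⟩
      preimage g (cv (app (A := X) (B := fun y => isEquiv g) (cv (app (A := X)
        (B := fun x => pi X fun y => isEquiv g) (cv h) x)) y)) f

abbrev contrPathT (i : Lvl) := pi (univ i) fun A => pi (univ i) fun B =>
  isTrunc .z A ⇒ isTrunc .z B ⇒ eq (A := univ i) A B

/-- Contractible types are equal. They are `(n-1)`-types for all `n`, so the univalence of the
universes for `(n-1)`-types suffices. -/
def contrPath {A B : Ty i} (hA : isTrunc .z A) (hB : isTrunc .z B) : eq (A := univ i) A B :=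
  lem 14 [i] (contrPathT i) A B hA hB

/-- The universes of the theory are univalent. -/
def univalence (i : Lvl) : univalentFor (univ i) (lam fun X => X) := ⟨cst .ua [i] []⟩

def contrPathEntry : Entry where
  stmt := (contrPathT (.v 0)).stmt
  proof := .direct <| E.pf (A := (contrPathT (.v 0)).tm) <|
    lam fun A => lam fun B => lam fun hA => lam fun hB =>
      let X := truncUniv (univ (.v 0)) (lam fun X => X)
      let f : A ⇒ B := lam fun _ => center hB
      let x : X := pair A (cv (truncOfProp (m := .n) (truncSucc hA)))
      let y : X := pair B (cv (truncOfProp (m := .n) (truncSucc hB)))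
      let h : equiv A B := pair f (lam fun y => cv (truncSg hA fun _ =>
        paths (truncSucc hB) (center hB) y))
      cv (cong (fun x : X => fst x) (pathOfEquiv (univalence (.v 0)) (x := x) (y := y) (cv h)))

/-- Families of types over `R` that are contractible if `P` holds. -/
abbrev contrFam (j : Lvl) (P : Ty c) (R : Ty r) : Ty (.mx (.mx r (.s j)) (.mx c (.mx r j))) :=
  sg (R ⇒ univ j) fun T => P ⇒ pi R fun x => isTrunc .z (T x)

abbrev isPropContrFamT (j c r : Lvl) := pi (univ c) fun P => pi (univ r) fun R =>
  P ⇒ isProp (contrFam j P R)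

/-- If `P` holds, these families are all equal. So they can be the values of a function on a W-type
that is a proposition if `P` holds. -/
def isPropContrFam {P : Ty c} {R : Ty r} (p : P) : isProp (contrFam j P R) :=
  lem 15 [j, c, r] (isPropContrFamT j c r) P R p

def isPropContrFamEntry : Entry where
  stmt := (isPropContrFamT (.v 0) (.v 1) (.v 2)).stmt
  proof := .direct <| E.pf (A := (isPropContrFamT (.v 0) (.v 1) (.v 2)).tm) <|
    lam fun P => lam fun R => lam fun p => propOfPaths fun x y =>
      sgElim (fun x : contrFam (.v 0) P R => x ≐ y)
        (fun T h => sgElim (fun y : contrFam (.v 0) P R => pair T h ≐ y)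
          (fun T' h' =>
            let F : (R ⇒ univ (.v 0)) → Ty _ := fun T => P ⇒ pi R fun x => isTrunc .z (T x)
            let e : T ≐ T' := funext (lam fun x => contrPath (h p x) (h' p x))
            cv <| pairPath (B := F) (b := h) (b' := h') e
              (cv (propPath (A := F T') (truncPi fun _ => truncPi fun _ => isPropTrunc)
                (cv (transport (fam F) e (cv h))) h'))) y) x

/-! ### Propositional indexed W-types -/

/-- The type of the positions of a container. -/
abbrev posTy (b : Lvl) (I : Ty k) (S : I ⇒ univ a) : Ty (.mx k (.mx a (.mx k (.s b)))) :=
  pi I fun i => S i ⇒ I ⇒ univ b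

/-- The data of a propositional indexed W-type: an indexed container and a family of
propositions over its indices. -/
structure Data (k a b c : Lvl) where
  I : Ty k
  S : I ⇒ univ a
  Pos : posTy b I S
  P : I ⇒ univ c
  hP : pi I fun i => isProp (P i)

/-- Quantification over the data of a W-type. -/
abbrev piData (k a b c : Lvl) (T : Data k a b c → Ty l) :=
  pi (univ k) fun I => pi (I ⇒ univ a) fun S => pi (posTy b I S) fun Pos =>
    pi (I ⇒ univ c) fun P => pi (pi I fun i => isProp (P i)) fun hP => T ⟨I, S, Pos, P, hP⟩

def lamData {T : Data k a b c → Ty l} (f : (D : Data k a b c) → T D) : piData k a b c T :=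
  lam fun I => lam fun S => lam fun Pos => lam fun P => lam fun hP => f ⟨I, S, Pos, P, hP⟩

def appData {T : Data k a b c → Ty l} (f : piData k a b c T) (D : Data k a b c) : T D :=
  f D.I D.S D.Pos D.P D.hP

namespace Data

/-- The W-type as a family. -/
def Wf (D : Data k a b c) : D.I ⇒ univ (wLevel k a b c) :=
  ⟨WFam k a b c D.I.tm D.S.tm D.Pos.tm D.P.tm D.hP.tm⟩

abbrev W (D : Data k a b c) (i : D.I) : Ty (wLevel k a b c) := D.Wf i

/-- The functions that assign elements of `F` to the positions of the shape `s`. -/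
def Args (D : Data k a b c) (F : D.I ⇒ univ l) (i : D.I) (s : D.S i) : Ty (.mx k (.mx b l)) :=
  pi D.I fun j => D.Pos i s j ⇒ F j

/-- The point constructor. -/
def sup (D : Data k a b c) (i : D.I) (s : D.S i) (t : D.Args D.Wf i s) : D.W i :=
  ⟨cst .sup [k, a, b, c] [D.I.tm, D.S.tm, D.Pos.tm, D.P.tm, D.hP.tm, i.tm, s.tm, t.tm]⟩

/-- The path constructor. -/
def trunc (D : Data k a b c) (i : D.I) (p : D.P i) (x y : D.W i) : x ≐ y :=
  ⟨cst .trunc [k, a, b, c] [D.I.tm, D.S.tm, D.Pos.tm, D.P.tm, D.hP.tm, i.tm, p.tm, x.tm, y.tm]⟩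

/-- The argument at the position `p`. -/
def arg (D : Data k a b c) {i : D.I} {s : D.S i} (t : D.Args D.Wf i s) (j : D.I)
    (p : D.Pos i s j) : D.W j :=
  app (app (cv t : pi D.I fun j => D.Pos i s j ⇒ D.W j) j) p

section Elim

variable (D : Data k a b c) (X : (i : D.I) → D.W i → Ty l)
  (d : (i : D.I) → (s : D.S i) → (t : D.Args D.Wf i s) →
    (pi D.I fun j => pi (D.Pos i s j) fun p => X j (D.arg t j p)) → X i (D.sup i s t))
  (h : (i : D.I) → D.P i → (w : D.W i) → isProp (X i w))

/-- The arguments of an induction on the W-type. -/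
def elimArgs : List H :=
  [D.I.tm, D.S.tm, D.Pos.tm, D.P.tm, D.hP.tm,
    (lam (B := fun i => D.W i ⇒ univ l) fun i => lam fun w => X i w).tm,
    (lam fun i => lam fun s => lam fun t => lam fun ih => d i s t ih).tm,
    (lam fun i => lam fun p => lam fun w => h i p w).tm]

/-- Induction on the W-type. -/
def elim (i : D.I) (w : D.W i) : X i w :=
  ⟨cst .wElim [k, a, b, c, l] (elimArgs D X d h ++ [i.tm, w.tm])⟩

/-- The computation rule of the induction, up to the identity type. -/
def beta (i : D.I) (s : D.S i) (t : D.Args D.Wf i s) :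
    elim D X d h i (D.sup i s t) ≐ d i s t (lam fun j => lam fun p =>
      elim D X d h j (D.arg t j p)) :=
  ⟨cst .wBeta [k, a, b, c, l] (elimArgs D X d h ++ [i.tm, s.tm, t.tm])⟩

end Elim

/-- The extension of the container at the W-type. -/
def Ext (D : Data k a b c) (i : D.I) : Ty (wLevel k a b c) :=
  ⟨(sg (D.S i) fun s => D.Args D.Wf i s).tm⟩

/-- The element `(s, t)` of the extension. -/
def ext (D : Data k a b c) {i : D.I} (s : D.S i) (t : D.Args D.Wf i s) : D.Ext i :=
  cv (pair (B := fun s => D.Args D.Wf i s) s t)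

def shape (D : Data k a b c) {i : D.I} (x : D.Ext i) : D.S i :=
  fst (cv x : sg (D.S i) fun s => D.Args D.Wf i s)

def args (D : Data k a b c) {i : D.I} (x : D.Ext i) : D.Args D.Wf i (D.shape x) :=
  snd (cv x : sg (D.S i) fun s => D.Args D.Wf i s)

/-- The constructor `sup`, on the extension. -/
def supE (D : Data k a b c) {i : D.I} (x : D.Ext i) : D.W i := D.sup i (D.shape x) (D.args x)

/-- The total space of the extension. -/
abbrev Z (D : Data k a b c) := sg D.I fun i => D.Ext i

def isPropW (D : Data k a b c) (i : D.I) (p : D.P i) : isProp (D.W i) :=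
  propOfPaths fun x y => D.trunc i p x y

def isContrW (D : Data k a b c) (i : D.I) (p : D.P i) (x : D.W i) : isTrunc .z (D.W i) :=
  ofContr (pair x (lam fun y => D.trunc i p x y))

end Data

def univEntries : List Entry :=
  [preimageEntry, pathOfEquivEntry, contrPathEntry, isPropContrFamEntry]

/-! ### Closed modalities -/

def sum (A : Ty i) (B : Ty j) : Ty (.mx i j) := ⟨cst .sum [i, j] [A.tm, B.tm]⟩

def inl {A : Ty i} {B : Ty j} (a : A) : sum A B := ⟨cst .inl [i, j] [A.tm, B.tm, a.tm]⟩

def inr {A : Ty i} {B : Ty j} (b : B) : sum A B := ⟨cst .inr [i, j] [A.tm, B.tm, b.tm]⟩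

def sumElim {A : Ty i} {B : Ty j} (C : sum A B → Ty k) (f : (a : A) → C (inl a))
    (g : (b : B) → C (inr b)) (z : sum A B) : C z :=
  ⟨cst .sumElim [i, j, k] [A.tm, B.tm, Lam (sum A B).tm fun z => (C ⟨z⟩).tm,
    Lam A.tm fun a => (f ⟨a⟩).tm, Lam B.tm fun b => (g ⟨b⟩).tm, z.tm]⟩

def empty (i : Lvl) : Ty i := ⟨cst .empty [i] []⟩

def emptyElim (C : Ty k) (z : empty i) : C :=
  ⟨cst .emptyElim [i, k] [Lam (empty i).tm fun _ => C.tm, z.tm]⟩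

/-- The family `x ↦ P ⋆ A x` over `Q`, where `P ⋆ A` is the join of the proposition `P` with `A`.
It is the W-type without arguments whose constructors are the elements of `A x` and those of `P`,
and which is a proposition if `P` holds. -/
def closedData (Q : Ty q) (A : Q → Ty a) (P : Ty c) (hP : isProp P) : Data q (.mx a c) .z c where
  I := Q
  S := fam fun x => sum (A x) P
  Pos := lam fun _ => lam fun _ => lam fun _ => empty .z
  P := fam fun _ => P
  hP := lam fun _ => cv hP

section closedData

variable {Q : Ty q} {A : Q → Ty a} {P : Ty c} {hP : isProp P}

/-- The empty family of arguments. -/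
def noArgs {x : Q} (s : (closedData Q A P hP).S x) :
    (closedData Q A P hP).Args (closedData Q A P hP).Wf x s :=
  lam fun y => lam fun z => emptyElim ((closedData Q A P hP).W y) (cv z : empty .z)

/-- The constructor of the join for the elements of `P`. -/
def point (x : Q) (p : P) : (closedData Q A P hP).W x :=
  (closedData Q A P hP).sup x (cv (inr p : sum (A x) P)) (noArgs _)

end closedData

/-- The total space of `x ↦ P ⋆ A x`. -/
abbrev closedTotal (Q : Ty q) (A : Q → Ty a) (P : Ty c) (hP : isProp P) :=
  sg Q fun x => (closedData Q A P hP).W x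

abbrev truncClosedOfT (m q a c : Lvl) := pi (univ q) fun Q => pi (Q ⇒ univ a) fun A =>
  pi (univ c) fun P => pi (isProp P) fun hP => P ⇒ isTrunc m Q ⇒
    isTrunc m (closedTotal Q (fun x => A x) P hP)

/-- If `P` holds, the total space of `x ↦ P ⋆ A x` is a retract of `Q`. -/
def truncClosedOf {Q : Ty q} {A : Q → Ty a} {P : Ty c} {hP : isProp P} (p : P)
    (h : isTrunc m Q) : isTrunc m (closedTotal Q A P hP) :=
  cv (lem 16 [m, q, a, c] (truncClosedOfT m q a c) Q (fam A) P hP p h)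

def truncClosedOfEntry : Entry where
  stmt := (truncClosedOfT (.v 0) (.v 1) (.v 2) (.v 3)).stmt
  proof := .direct <| E.pf (A := (truncClosedOfT (.v 0) (.v 1) (.v 2) (.v 3)).tm) <|
    lam fun Q => lam fun A => lam fun P => lam fun hP => lam fun p => lam fun h =>
      truncRetract (A := closedTotal Q (fun x => A x) P hP) (fun z => fst z)
        (fun x => pair x (point x p))
        (fun z => sgElim (fun z => pair (fst z) (point (fst z) p) ≐ z)
          (fun x y => cv (cong (fun y => pair (B := (closedData Q (fun x => A x) P hP).W) x y)
            ((closedData Q (fun x => A x) P hP).trunc x (cv p) (point x p) y))) z) h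

abbrev closedContrT (q a c : Lvl) := pi (univ q) fun Q => pi (Q ⇒ univ a) fun A =>
  pi (univ c) fun P => pi (isProp P) fun hP => pi Q fun x => P ⇒
    isTrunc .z ((closedData Q (fun x => A x) P hP).W x)

/-- If `P` holds, then `P ⋆ A x` is contractible. -/
def closedContr {Q : Ty q} {A : Q → Ty a} {P : Ty c} {hP : isProp P} (x : Q) (p : P) :
    isTrunc .z ((closedData Q A P hP).W x) :=
  cv (lem 17 [q, a, c] (closedContrT q a c) Q (fam A) P hP x p)

def closedContrEntry : Entry where
  stmt := (closedContrT (.v 0) (.v 1) (.v 2)).stmt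
  proof := .direct <| E.pf (A := (closedContrT (.v 0) (.v 1) (.v 2)).tm) <|
    lam fun Q => lam fun A => lam fun P => lam fun hP => lam fun x => lam fun p =>
      (closedData Q (fun x => A x) P hP).isContrW x (cv p) (point x p)

/-- The inclusion of `A x`, as an element of the extension. -/
def inlE {Q : Ty q} {A : Q → Ty a} {P : Ty c} {hP : isProp P} {x : Q} (y : A x)
    (t : (closedData Q A P hP).Args (closedData Q A P hP).Wf x (cv (inl y : sum (A x) P))) :
    (closedData Q A P hP).Ext x :=
  (closedData Q A P hP).ext (cv (inl y : sum (A x) P)) t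

/-- The type of the arguments of the shape `inl y`. -/
abbrev InlArgs {Q : Ty q} (A : Q → Ty a) (P : Ty c) (hP : isProp P) {x : Q} (y : A x) :=
  (closedData Q A P hP).Args (closedData Q A P hP).Wf x (cv (inl y : sum (A x) P))

abbrev inlPathT (q a c : Lvl) := pi (univ q) fun Q => pi (Q ⇒ univ a) fun A =>
  pi (univ c) fun P => pi (isProp P) fun hP =>
  pi (sg Q fun x => A x) fun z => pi (InlArgs (fun x => A x) P hP (snd z)) fun t =>
  pi (sg Q fun x => A x) fun z' => pi (InlArgs (fun x => A x) P hP (snd z')) fun t' =>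
    (z ≐ z') ⇒
      pair (B := fun x => (closedData Q (fun x => A x) P hP).Ext x) (fst z) (inlE (snd z) t)
      ≐ pair (fst z') (inlE (snd z') t')

/-- Equal elements of the total space of `A` give equal elements of the total space of the
extension, whatever the arguments, of which there is only one choice. The type of `p` is left open, so that it
may be any type convertible to the equality. -/
def inlPath {Q : Ty q} {A : Q → Ty a} {P : Ty c} {hP : isProp P} {x x' : Q} {y : A x} {y' : A x'}
    {t : InlArgs A P hP y} {t' : InlArgs A P hP y'} {B : H} (p : E B) :
    pair (B := fun x => (closedData Q A P hP).Ext x) x (inlE y t) ≐ pair x' (inlE y' t') :=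
  cv (lem 18 [q, a, c] (inlPathT q a c) Q (fam A) P hP (cv (pair x y)) (cv t) (cv (pair x' y'))
    (cv t') (cv p))

def inlPathEntry : Entry where
  stmt := (inlPathT (.v 0) (.v 1) (.v 2)).stmt
  proof := .direct <| E.pf (A := (inlPathT (.v 0) (.v 1) (.v 2)).tm) <|
    lam fun Q => lam fun A => lam fun P => lam fun hP => lam fun z => lam fun t =>
      lam fun z' => lam fun t' => lam fun p =>
        let D := closedData Q (fun x => A x) P hP
        let el : (z : sg Q fun x => A x) → InlArgs (fun x => A x) P hP (snd z) → D.Z :=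
          fun z t => pair (fst z) (inlE (snd z) t)
        let T := InlArgs (fun x => A x) P hP (snd z)
        let hT : isProp T := cv (truncPi (m := .s .z) fun y : Q => truncPi (m := .s .z)
          fun v : empty .z => emptyElim (isProp (D.W y)) v)
        app (ind (fun z' _ => pi (InlArgs (fun x => A x) P hP (snd z')) fun t' =>
            el z t ≐ el z' t')
          (lam fun t' => cong (fun t => el z t) (propPath hT t t')) p) t'

abbrev inlTruncT (m q a c : Lvl) := pi (univ q) fun Q => pi (Q ⇒ univ a) fun A =>
  pi (univ c) fun P => pi (isProp P) fun hP => isTrunc (.s m) (sg Q fun x => A x) ⇒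
  pi Q fun x => pi (A x) fun y => pi (InlArgs (fun x => A x) P hP y) fun t =>
  pi Q fun x' => pi (A x') fun y' => pi (InlArgs (fun x => A x) P hP y') fun t' =>
    isTrunc m (pair (B := fun x => (closedData Q (fun x => A x) P hP).Ext x) x (inlE y t)
      ≐ pair x' (inlE y' t'))

/-- The shapes `inl y` and those of the form `inr p` are disjoint, and there are no arguments. So
the equalities of the elements of the extension with shapes `inl y` and `inl y'` are those of the
elements of `A`. -/
def inlTruncEntry : Entry where
  stmt := (inlTruncT (.v 0) (.v 1) (.v 2) (.v 3)).stmt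
  proof := .direct <| E.pf (A := (inlTruncT (.v 0) (.v 1) (.v 2) (.v 3)).tm) <|
    lam fun Q => lam fun A => lam fun P => lam fun hP => lam fun h =>
    lam fun x => lam fun y => lam fun t => lam fun x' => lam fun y' => lam fun t' =>
      let D := closedData Q (fun x => A x) P hP
      let F := sg Q fun x => A x
      let v : F := pair x y
      let z : D.Z := pair x (inlE y t)
      -- the equalities of `z` with the elements of the extension
      let code : (x : Q) → D.Ext x → Ty (.mx (.v 1) (.v 2)) := fun x e =>
        cv (sumElim (A := A x) (B := P) (fun _ => univ (.mx (.v 1) (.v 2)))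
          (fun y => v ≐ pair x y) (fun _ => empty _) (cv (D.shape e)))
      truncCode (fun z => code (fst z) (snd z)) (cv (refl v))
        (fun z' p => app (sgElim (fun z' : D.Z => code (fst z') (snd z') ⇒ z ≐ z')
          (fun x₁ e => cv (sgElim (A := D.S x₁) (B := fun s => D.Args D.Wf x₁ s)
            (fun e => code x₁ (cv e) ⇒ z ≐ pair x₁ (cv e))
            (fun s t₁ => cv (app (sumElim (A := A x₁) (B := P)
              (fun s => pi (D.Args D.Wf x₁ (cv s)) fun t₁ =>
                code x₁ (D.ext (cv s) t₁) ⇒ z ≐ pair x₁ (D.ext (cv s) t₁))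
              (fun y₁ => lam fun t₁ => lam fun p => cv (inlPath (t := t) (t' := t₁) p))
              (fun _ => lam fun _ => lam fun p =>
                emptyElim _ (cv p : empty (.mx (.v 1) (.v 2)))) (cv s)) t₁))
            (cv e))) z') p)
        (pair x' (inlE y' t')) (cv (paths h v (pair x' y')))

def closedEntries : List Entry :=
  [truncClosedOfEntry, closedContrEntry, inlPathEntry, inlTruncEntry]

/-! ### The identity types of propositional indexed W-types -/

abbrev truncFibersT (m i j : Lvl) := pi (univ i) fun A => pi (univ j) fun B => pi (A ⇒ B) fun f =>
  isTrunc m A ⇒ isTrunc m (sg B fun y => sg A fun x => f x ≐ y)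

/-- The total space of the fibers of a map is a retract of its domain. -/
def truncFibers {A : Ty i} {B : Ty j} (f : A → B) (h : isTrunc m A) :
    isTrunc m (sg B fun y => sg A fun x => f x ≐ y) :=
  cv (lem 20 [m, i, j] (truncFibersT m i j) A B (lam f) h)

def truncFibersEntry : Entry where
  stmt := (truncFibersT (.v 0) (.v 1) (.v 2)).stmt
  proof := .direct <| E.pf (A := (truncFibersT (.v 0) (.v 1) (.v 2)).tm) <|
    lam fun A => lam fun B => lam fun f => lam fun h =>
      let F : B → Ty _ := fun y => sg A fun x => f x ≐ y
      let r : A → sg B F := fun x => pair (f x) (pair x (refl (f x)))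
      truncRetract (A := sg B F) (fun z => fst (snd z)) r
        (fun z => sgElim (fun z : sg B F => r (fst (snd z)) ≐ z)
          (fun y v => cv (sgElim (fun v : F y => r (fst v) ≐ pair y v)
            (fun x p => cv (ind (fun y p => r x ≐ pair y (pair x p)) (refl (r x)) p)) v)) z) h

/-- The equalities of `x₀` and `x₁` in the total space of the extension that lie over the equality
`p` of the indices. -/
def fiberOver {D : Data k a b c} {i₀ i₁ : D.I} (x₀ : D.Ext i₀) (x₁ : D.Ext i₁) (p : i₀ ≐ i₁) :=
  sg (pair (B := D.Ext) i₀ x₀ ≐ pair i₁ x₁) fun v =>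
    (cv (cong (fun z : D.Z => fst z) v) : i₀ ≐ i₁) ≐ p

/-- The codes for the equalities of `sup x₀` and `sup x₁` over an equality `p` of the indices: the
join of the proposition `P i₁` with the type of the equalities of `x₀` and `x₁` over `p`. -/
abbrev codeData {D : Data k a b c} {i₀ i₁ : D.I} (x₀ : D.Ext i₀) (x₁ : D.Ext i₁) :=
  closedData (i₀ ≐ i₁) (fun p => fiberOver x₀ x₁ p) (D.P i₁) (D.hP i₁)

abbrev mapPathT (k e w : Lvl) := pi (univ k) fun I => pi (I ⇒ univ e) fun X =>
  pi (I ⇒ univ w) fun W => pi (pi I fun i => X i ⇒ W i) fun g =>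
  pi I fun i₀ => pi (X i₀) fun x₀ => pi I fun i₁ => pi (X i₁) fun x₁ => pi (i₀ ≐ i₁) fun p =>
    (sg (pair (B := fun i => X i) i₀ x₀ ≐ pair i₁ x₁) fun v =>
      (cv (cong (fun z : sg I fun i => X i => fst z) v) : i₀ ≐ i₁) ≐ p) ⇒
    transport W p (g i₀ x₀) ≐ g i₁ x₁

/-- A map of families sends equalities over `p` to equalities over `p`. -/
def mapPathEntry : Entry where
  stmt := (mapPathT (.v 0) (.v 1) (.v 2)).stmt
  proof := .direct <| E.pf (A := (mapPathT (.v 0) (.v 1) (.v 2)).tm) <|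
    lam fun I => lam fun X => lam fun W => lam fun g => lam fun i₀ => lam fun x₀ => lam fun i₁ =>
    lam fun x₁ => lam fun p => lam fun v =>
      ind (fun p _ => transport W p (g i₀ x₀) ≐ g i₁ x₁)
        (cv (ind (fun z v => transport W (cong (fun z : sg I fun i => X i => fst z) v)
            (cv (g i₀ x₀)) ≐ g (fst z) (snd z))
          (cv (refl (g i₀ x₀))) (fst v))) (snd v)

abbrev supPathT (k a b c : Lvl) := piData k a b c fun D =>
  pi D.I fun i₀ => pi (D.Ext i₀) fun x₀ => pi D.I fun i₁ => pi (D.Ext i₁) fun x₁ =>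
  pi (i₀ ≐ i₁) fun p => fiberOver x₀ x₁ p ⇒ transport D.Wf p (D.supE x₀) ≐ D.supE x₁

/-- Equalities in the extension give equalities in the W-type. -/
def supPath {D : Data k a b c} {i₀ i₁ : D.I} {x₀ : D.Ext i₀} {x₁ : D.Ext i₁} {p : i₀ ≐ i₁}
    (v : fiberOver x₀ x₁ p) : transport D.Wf p (D.supE x₀) ≐ D.supE x₁ :=
  appData (lem 22 [k, a, b, c] (supPathT k a b c)) D i₀ x₀ i₁ x₁ p v

def supPathEntry : Entry where
  stmt := (supPathT (.v 0) (.v 1) (.v 2) (.v 3)).stmt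
  proof := .direct <| E.pf (A := (supPathT (.v 0) (.v 1) (.v 2) (.v 3)).tm) <|
    lamData fun D => lam fun i₀ => lam fun x₀ => lam fun i₁ => lam fun x₁ => lam fun p =>
      lam fun v => cv (lem 21 [.v 0, wLevel (.v 0) (.v 1) (.v 2) (.v 3),
          wLevel (.v 0) (.v 1) (.v 2) (.v 3)] (mapPathT (.v 0) (wLevel (.v 0) (.v 1) (.v 2) (.v 3))
          (wLevel (.v 0) (.v 1) (.v 2) (.v 3))) D.I (fam D.Ext) D.Wf
        (cv (lam fun i : D.I => lam fun x : D.Ext i => D.supE x)) i₀ (cv x₀) i₁ (cv x₁) p (cv v))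

abbrev decodeT (k a b c : Lvl) := piData k a b c fun D =>
  pi D.I fun i₀ => pi (D.Ext i₀) fun x₀ => pi D.I fun i₁ => pi (D.Ext i₁) fun x₁ =>
  pi (i₀ ≐ i₁) fun p => (codeData x₀ x₁).W p ⇒ transport D.Wf p (D.supE x₀) ≐ D.supE x₁

/-- Codes give equalities: by `supPath`, and by the path constructor where `P i₁` holds. -/
def decode {D : Data k a b c} {i₀ i₁ : D.I} {x₀ : D.Ext i₀} {x₁ : D.Ext i₁} {p : i₀ ≐ i₁}
    (v : (codeData x₀ x₁).W p) : transport D.Wf p (D.supE x₀) ≐ D.supE x₁ :=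
  appData (lem 23 [k, a, b, c] (decodeT k a b c)) D i₀ x₀ i₁ x₁ p v

def decodeEntry : Entry where
  stmt := (decodeT (.v 0) (.v 1) (.v 2) (.v 3)).stmt
  proof := .direct <| E.pf (A := (decodeT (.v 0) (.v 1) (.v 2) (.v 3)).tm) <|
    lamData fun D => lam fun i₀ => lam fun x₀ => lam fun i₁ => lam fun x₁ => lam fun p =>
      lam fun v => (codeData x₀ x₁).elim
        (fun p _ => transport D.Wf p (D.supE x₀) ≐ D.supE x₁)
        (fun p s _ _ => sumElim (A := fiberOver x₀ x₁ p) (B := D.P i₁)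
          (fun _ => transport D.Wf p (D.supE x₀) ≐ D.supE x₁)
          (fun v => supPath v) (fun P => D.trunc i₁ P _ _) (cv s))
        (fun p P _ => truncSucc (m := .z) (paths (m := .z) (D.isPropW i₁ (cv P)) _ _)) p v

abbrev wRecT (k a b c l : Lvl) := piData k a b c fun D => pi (D.I ⇒ univ l) fun X =>
  pi (pi D.I fun i => pi (D.S i) fun s => D.Args D.Wf i s ⇒ X i) fun d =>
  (pi D.I fun i => D.P i ⇒ isProp (X i)) ⇒
    sg (pi D.I fun i => D.W i ⇒ X i) fun f =>
      pi D.I fun i => pi (D.S i) fun s => pi (D.Args D.Wf i s) fun t =>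
        f i (D.sup i s t) ≐ d i s t

/-- Case distinction on the elements of the W-type, with values in a family over the indices. -/
def wRec (D : Data k a b c) {X : D.I → Ty l}
    (d : (i : D.I) → (s : D.S i) → D.Args D.Wf i s → X i)
    (h : (i : D.I) → D.P i → isProp (X i)) :
    sg (pi D.I fun i => D.W i ⇒ X i) fun f =>
      pi D.I fun i => pi (D.S i) fun s => pi (D.Args D.Wf i s) fun t =>
        f i (D.sup i s t) ≐ d i s t :=
  cv (appData (lem 24 [k, a, b, c, l] (wRecT k a b c l)) D (fam X)
    (cv (lam fun i => lam fun s => lam fun t => d i s t)) (cv (lam fun i => lam fun p => h i p)))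

def wRecEntry : Entry where
  stmt := (wRecT (.v 0) (.v 1) (.v 2) (.v 3) (.v 4)).stmt
  proof := .direct <| E.pf (A := (wRecT (.v 0) (.v 1) (.v 2) (.v 3) (.v 4)).tm) <|
    lamData fun D => lam fun X => lam fun d => lam fun h =>
      pair (lam fun i => lam fun w => D.elim (fun i _ => X i) (fun i s t _ => d i s t)
          (fun i p _ => h i p) i w)
        (lam fun i => lam fun s => lam fun t =>
          cv (D.beta (fun i _ => X i) (fun i s t _ => d i s t) (fun i p _ => h i p) i s t))

/-- The families over the elements `sup i s t`. -/
abbrev SupFam (D : Data k a b c) (R : D.I → Ty r) (u : Lvl) :=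
  pi D.I fun i => pi (D.S i) fun s => D.Args D.Wf i s ⇒ R i ⇒ univ u

/-- A family over the elements `sup i s t` is contractible where the W-type is a proposition. -/
abbrev SupContr (D : Data k a b c) (R : D.I → Ty r) (B : SupFam D R u) :=
  pi D.I fun i => D.P i ⇒ pi (D.S i) fun s => pi (D.Args D.Wf i s) fun t => pi (R i) fun x =>
    isTrunc .z (B i s t x)

abbrev extendFamT (k a b c r u : Lvl) := piData k a b c fun D => pi (D.I ⇒ univ r) fun R =>
  pi (SupFam D (fun i => R i) u) fun B => SupContr D (fun i => R i) B ⇒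
    sg (pi D.I fun i => D.W i ⇒ R i ⇒ univ u) fun C =>
      pi D.I fun i => pi (D.S i) fun s => pi (D.Args D.Wf i s) fun t =>
        C i (D.sup i s t) ≐ B i s t

/-- A family of types over the elements `sup i s t` extends to the W-type, if it is contractible
where the W-type is a proposition. The extension is a function on the W-type with values in
`contrFam`, and it agrees with the given family up to the identity type. -/
def extendFam (D : Data k a b c) {R : D.I → Ty r} (B : SupFam D R u) (h : SupContr D R B) :
    sg (pi D.I fun i => D.W i ⇒ R i ⇒ univ u) fun C =>
      pi D.I fun i => pi (D.S i) fun s => pi (D.Args D.Wf i s) fun t =>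
        C i (D.sup i s t) ≐ B i s t :=
  cv (appData (lem 25 [k, a, b, c, r, u] (extendFamT k a b c r u)) D (fam R) (cv B) (cv h))

def extendFamEntry : Entry where
  stmt := (extendFamT (.v 0) (.v 1) (.v 2) (.v 3) (.v 4) (.v 5)).stmt
  proof := .direct <| E.pf (A := (extendFamT (.v 0) (.v 1) (.v 2) (.v 3) (.v 4) (.v 5)).tm) <|
    lamData fun D => lam fun R => lam fun B => lam fun h =>
      let X : D.I → Ty _ := fun i => contrFam (.v 5) (D.P i) (R i)
      let d : (i : D.I) → (s : D.S i) → (t : D.Args D.Wf i s) → X i := fun i s t =>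
        pair (B i s t) (lam fun p => lam fun x => cv (h i p s t x))
      unpack (wRec D d fun i p => isPropContrFam p) fun f e =>
        pair (lam fun i => lam fun w => fst (f i w))
          (lam fun i => lam fun s => lam fun t => cv (cong (fun x => fst x) (e i s t)))

/-- The equalities of `(i₀, w₀)` and `(i₁, w₁)` in the total space of `W`. -/
abbrev transportPath {I : Ty k} (W : I ⇒ univ w) {i₀ i₁ : I} (w₀ : W i₀) (w₁ : W i₁) :=
  sg (i₀ ≐ i₁) fun p => transport W p w₀ ≐ w₁

abbrev truncTransportT (m k w u : Lvl) := pi (univ k) fun I => pi (I ⇒ univ w) fun W =>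
  pi I fun i₀ => pi (W i₀) fun w₀ => pi (pi I fun i₁ => W i₁ ⇒ (i₀ ≐ i₁) ⇒ univ u) fun C =>
  C i₀ w₀ (refl i₀) ⇒ (pi I fun i₁ => pi (W i₁) fun w₁ => pi (i₀ ≐ i₁) fun p =>
    C i₁ w₁ p ⇒ transport W p w₀ ≐ w₁) ⇒
  pi I fun i₁ => pi (W i₁) fun w₁ => isTrunc m (sg (i₀ ≐ i₁) fun p => C i₁ w₁ p) ⇒
    isTrunc m (transportPath W w₀ w₁)

/-- The encode-decode argument for equalities over equalities of indices: a family `C` with an element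
over `refl` and a map to the equalities has these as retracts. The map is corrected by `loop`, its value at the given element. -/
def truncTransportEntry : Entry where
  stmt := (truncTransportT (.v 0) (.v 1) (.v 2) (.v 3)).stmt
  proof := .direct <| E.pf (A := (truncTransportT (.v 0) (.v 1) (.v 2) (.v 3)).tm) <|
    lam fun I => lam fun W => lam fun i₀ => lam fun w₀ => lam fun C => lam fun x₀ =>
    lam fun dec => lam fun i₁ => lam fun w₁ => lam fun h =>
      let start : (i₁ : I) → (p : i₀ ≐ i₁) → C i₁ (transport W p w₀) p := fun i₁ p =>
        ind (fun i₁ p => C i₁ (transport W p w₀) p) (cv x₀) p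
      let loop : transport W (refl i₀) w₀ ≐ w₀ := dec i₀ w₀ (refl i₀) x₀
      let fix : (i₁ : I) → (p : i₀ ≐ i₁) → transport W p w₀ ≐ transport W p w₀ := fun i₁ p =>
        ind (fun i₁ p => transport W p w₀ ≐ transport W p w₀) (cv (sym loop)) p
      let enc : (p : i₀ ≐ i₁) → transport W p w₀ ≐ w₁ → C i₁ w₁ p := fun p v =>
        ind (fun w₁ _ => C i₁ w₁ p) (start i₁ p) v
      truncRetract (A := transportPath W w₀ w₁) (B := sg (i₀ ≐ i₁) fun p => C i₁ w₁ p)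
        (fun z => pair (fst z) (enc (fst z) (snd z)))
        (fun z => pair (fst z) (concat (fix i₁ (fst z)) (dec i₁ w₁ (fst z) (snd z))))
        (fun z => cv <| sgElim (fun z : transportPath W w₀ w₁ =>
            pair (B := fun p => transport W p w₀ ≐ w₁) (fst z)
              (concat (fix i₁ (fst z)) (dec i₁ w₁ (fst z) (enc (fst z) (snd z)))) ≐ z)
          (fun p v => cv (cong (fun v => pair (B := fun p => transport W p w₀ ≐ w₁) p v)
            (ind (fun w₁ v => concat (fix i₁ p) (dec i₁ w₁ p
                (ind (fun w₁ _ => C i₁ w₁ p) (start i₁ p) v)) ≐ v)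
              (cv (ind (fun i₁ p => concat (fix i₁ p) (dec i₁ (transport W p w₀) p (start i₁ p))
                  ≐ refl (transport W p w₀)) (cv (symConcat loop)) p)) v))) z) h

abbrev truncFamT (m k a b c u : Lvl) := piData k a b c fun D =>
  pi D.I fun i₀ => pi (D.S i₀) fun s₀ => pi (D.Args D.Wf i₀ s₀) fun t₀ =>
  pi (SupFam D (fun i => i₀ ≐ i) u) fun B => SupContr D (fun i => i₀ ≐ i) B ⇒
  B i₀ s₀ t₀ (refl i₀) ⇒
  (pi D.I fun i₁ => pi (D.S i₁) fun s₁ => pi (D.Args D.Wf i₁ s₁) fun t₁ => pi (i₀ ≐ i₁) fun p =>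
    B i₁ s₁ t₁ p ⇒ transport D.Wf p (D.sup i₀ s₀ t₀) ≐ D.sup i₁ s₁ t₁) ⇒
  pi D.I fun i₁ => pi (D.S i₁) fun s₁ => pi (D.Args D.Wf i₁ s₁) fun t₁ =>
    isTrunc m (sg (i₀ ≐ i₁) fun p => B i₁ s₁ t₁ p) ⇒
      isTrunc m (transportPath D.Wf (D.sup i₀ s₀ t₀) (D.sup i₁ s₁ t₁))

/-- The argument of `truncTransport` for codes that are given only for the elements `sup i s t`.
They are extended to the W-type by `extendFam`. -/
def truncFamEntry : Entry where
  stmt := (truncFamT (.v 0) (.v 1) (.v 2) (.v 3) (.v 4) (.v 5)).stmt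
  proof := .direct <| E.pf (A := (truncFamT (.v 0) (.v 1) (.v 2) (.v 3) (.v 4) (.v 5)).tm) <|
    lamData fun D => lam fun i₀ => lam fun s₀ => lam fun t₀ => lam fun B => lam fun hB =>
    lam fun b₀ => lam fun dec => lam fun i₁ => lam fun s₁ => lam fun t₁ => lam fun H =>
      let w := wLevel (.v 1) (.v 2) (.v 3) (.v 4)
      let x₀ := D.sup i₀ s₀ t₀
      let R : D.I → Ty (.v 1) := fun i => i₀ ≐ i
      let u : Lvl := .v 5
      unpack (extendFam D (R := R) B hB) fun C e =>
        let start : C i₀ x₀ (refl i₀) :=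
          cv (transport (lam fun T : R i₀ ⇒ univ u => T (refl i₀)) (sym (e i₀ s₀ t₀)) (cv b₀))
        let dec : pi D.I fun i => pi (D.W i) fun y => pi (i₀ ≐ i) fun p =>
            C i y p ⇒ transport D.Wf p x₀ ≐ y :=
          lam fun i => lam fun y => D.elim
            (fun i y => pi (i₀ ≐ i) fun p => C i y p ⇒ transport D.Wf p x₀ ≐ y)
            (fun i s t _ => lam fun p => lam fun v => dec i s t p
              (cv (transport (lam fun T : R i ⇒ univ u => T p) (e i s t) (cv v))))
            (fun i P y => truncPi fun p => truncPi fun _ =>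
              truncSucc (m := .z) (paths (m := .z) (D.isPropW i P) _ y)) i y
        let H' : isTrunc (.v 0) (sg (i₀ ≐ i₁) fun p => C i₁ (D.sup i₁ s₁ t₁) p) :=
          cv (transport (lam fun T : R i₁ ⇒ univ u =>
              isTrunc (.v 0) (sg (i₀ ≐ i₁) fun p => T p)) (sym (e i₁ s₁ t₁)) (cv H))
        lem 26 [.v 0, .v 1, w, u] (truncTransportT (.v 0) (.v 1) w u) D.I D.Wf i₀ x₀
          C start dec i₁ (D.sup i₁ s₁ t₁) H'

abbrev truncSupT (m k a b c : Lvl) := piData k a b c fun D =>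
  pi D.I fun i₀ => pi (D.S i₀) fun s₀ => pi (D.Args D.Wf i₀ s₀) fun t₀ =>
  pi D.I fun i₁ => pi (D.S i₁) fun s₁ => pi (D.Args D.Wf i₁ s₁) fun t₁ =>
    isTrunc m (sg (i₀ ≐ i₁) fun p => (codeData (D.ext s₀ t₀) (D.ext s₁ t₁)).W p) ⇒
      isTrunc m (transportPath D.Wf (D.sup i₀ s₀ t₀) (D.sup i₁ s₁ t₁))

/-- The equalities of two elements that are given by `sup` are truncated if their codes are. -/
def truncSup {D : Data k a b c} {i₀ i₁ : D.I} (s₀ : D.S i₀) (t₀ : D.Args D.Wf i₀ s₀)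
    (s₁ : D.S i₁) (t₁ : D.Args D.Wf i₁ s₁)
    (h : isTrunc m (sg (i₀ ≐ i₁) fun p => (codeData (D.ext s₀ t₀) (D.ext s₁ t₁)).W p)) :
    isTrunc m (transportPath D.Wf (D.sup i₀ s₀ t₀) (D.sup i₁ s₁ t₁)) :=
  appData (lem 28 [m, k, a, b, c] (truncSupT m k a b c)) D i₀ s₀ t₀ i₁ s₁ t₁ h

def truncSupEntry : Entry where
  stmt := (truncSupT (.v 0) (.v 1) (.v 2) (.v 3) (.v 4)).stmt
  proof := .direct <| E.pf (A := (truncSupT (.v 0) (.v 1) (.v 2) (.v 3) (.v 4)).tm) <|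
    lamData fun D => lam fun i₀ => lam fun s₀ => lam fun t₀ => lam fun i₁ => lam fun s₁ =>
    lam fun t₁ => lam fun H =>
      let w := wLevel (.v 1) (.v 2) (.v 3) (.v 4)
      let u := wLevel (.v 1) (.mx (.mx w (.v 1)) (.v 4)) .z (.v 4)
      let x₀ := D.ext s₀ t₀
      appData (lem 27 [.v 0, .v 1, .v 2, .v 3, .v 4, u]
          (truncFamT (.v 0) (.v 1) (.v 2) (.v 3) (.v 4) u)) D i₀ s₀ t₀
        (lam fun i => lam fun s => lam fun t => (cv (codeData x₀ (D.ext s t)).Wf :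
          (i₀ ≐ i) ⇒ univ u))
        (cv (lam fun i : D.I => lam fun P : D.P i => lam fun s : D.S i =>
            lam fun t : D.Args D.Wf i s => lam fun p : i₀ ≐ i =>
          closedContr (A := fun p => fiberOver x₀ (D.ext s t) p) (hP := D.hP i) p P))
        (cv ((codeData x₀ x₀).sup (refl i₀) (cv (inl (pair (refl _) (cv (refl (refl i₀))))
          : sum (fiberOver x₀ x₀ (refl i₀)) (D.P i₀))) (noArgs _)))
        (lam fun i => lam fun s => lam fun t => lam fun p => lam fun v =>
          cv (decode (x₀ := x₀) (x₁ := D.ext s t) (p := p) (cv v)))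
        i₁ s₁ t₁ (cv H)

def codeEntries : List Entry :=
  [truncFibersEntry, mapPathEntry, supPathEntry, decodeEntry, wRecEntry, extendFamEntry,
    truncTransportEntry, truncFamEntry, truncSupEntry]

/-! ### The truncation level of closed modalities -/

abbrev truncTotalT (m i j : Lvl) := pi (univ i) fun A => pi (A ⇒ univ j) fun B =>
  (pi A fun x => pi (B x) fun y => pi A fun x' => pi (B x') fun y' =>
    isTrunc m (transportPath B y y')) ⇒ isTrunc (.s m) (sg A fun x => B x)

/-- A total space is truncated if its equalities, taken over equalities of the base, are. -/
def truncTotal {A : Ty i} {B : A ⇒ univ j}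
    (h : pi A fun x => pi (B x) fun y => pi A fun x' => pi (B x') fun y' =>
      isTrunc m (transportPath B y y')) : isTrunc (.s m) (sg A fun x => B x) :=
  lem 29 [m, i, j] (truncTotalT m i j) A B h

def truncTotalEntry : Entry where
  stmt := (truncTotalT (.v 0) (.v 1) (.v 2)).stmt
  proof := .direct <| E.pf (A := (truncTotalT (.v 0) (.v 1) (.v 2)).tm) <|
    lam fun A => lam fun B => lam fun h => ofPaths <| lam fun z => lam fun z' =>
      truncSgPath (cv (h (fst z) (snd z) (fst z') (snd z')))

abbrev truncOfContrT (m i : Lvl) := pi (univ i) fun A => isTrunc .z A ⇒ isTrunc m A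

def truncOfContr {A : Ty i} (h : isTrunc .z A) : isTrunc m A :=
  lem 30 [m, i] (truncOfContrT m i) A h

def truncOfContrEntry : Entry where
  stmt := (truncOfContrT (.v 0) (.v 1)).stmt
  proof := .induction
    (E.pf (A := (truncOfContrT .z (.v 1)).tm) <| lam fun _ => lam fun h => h)
    (E.pf (A := (truncOfContrT (.s (.v 0)) (.v 1)).tm) <| lam fun _ => lam fun h =>
      truncSucc (truncOfContr h))

abbrev truncPropPathT (m k a b c : Lvl) := piData k a b c fun D =>
  pi D.I fun i₀ => pi (D.W i₀) fun w₀ => pi D.I fun i₁ => pi (D.W i₁) fun w₁ =>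
    D.P i₁ ⇒ isTrunc m (i₀ ≐ i₁) ⇒ isTrunc m (transportPath D.Wf w₀ w₁)

/-- Where the W-type is a proposition, the equalities of its elements are truncated if those of the
indices are. -/
def truncPropPath {D : Data k a b c} {i₀ i₁ : D.I} {w₀ : D.W i₀} {w₁ : D.W i₁} (p : D.P i₁)
    (h : isTrunc m (i₀ ≐ i₁)) : isTrunc m (transportPath D.Wf w₀ w₁) :=
  appData (lem 31 [m, k, a, b, c] (truncPropPathT m k a b c)) D i₀ w₀ i₁ w₁ p h

def truncPropPathEntry : Entry where
  stmt := (truncPropPathT (.v 0) (.v 1) (.v 2) (.v 3) (.v 4)).stmt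
  proof := .direct <| E.pf (A := (truncPropPathT (.v 0) (.v 1) (.v 2) (.v 3) (.v 4)).tm) <|
    lamData fun D => lam fun i₀ => lam fun w₀ => lam fun i₁ => lam fun w₁ => lam fun P =>
    lam fun h => truncSg h fun p =>
      truncOfContr (paths (m := .z) (D.isPropW i₁ P) (transport D.Wf p w₀) w₁)

/-- The inclusion of `A x`, as an element of the W-type. -/
def inlW {Q : Ty q} {A : Q → Ty a} {P : Ty c} {hP : isProp P} {x : Q} (y : A x)
    (t : InlArgs A P hP y) : (closedData Q A P hP).W x :=
  (closedData Q A P hP).sup x (cv (inl y : sum (A x) P)) t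

abbrev closedElimT (q a c l : Lvl) := pi (univ q) fun Q => pi (Q ⇒ univ a) fun A =>
  pi (univ c) fun P => pi (isProp P) fun hP =>
  pi (pi Q fun x => (closedData Q (fun x => A x) P hP).W x ⇒ univ l) fun G =>
  (pi Q fun x => pi (A x) fun y => pi (InlArgs (fun x => A x) P hP y) fun t => G x (inlW y t)) ⇒
  (P ⇒ pi Q fun x => pi ((closedData Q (fun x => A x) P hP).W x) fun w => G x w) ⇒
  (P ⇒ pi Q fun x => pi ((closedData Q (fun x => A x) P hP).W x) fun w => isProp (G x w)) ⇒
    pi Q fun x => pi ((closedData Q (fun x => A x) P hP).W x) fun w => G x w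

/-- A property of the elements of `P ⋆ A x` holds if it holds for those of `A x`, and for all
elements if `P` holds. -/
def closedElim {Q : Ty q} {A : Q → Ty a} {P : Ty c} {hP : isProp P}
    (G : (x : Q) → (closedData Q A P hP).W x → Ty l)
    (f : (x : Q) → (y : A x) → (t : InlArgs A P hP y) → G x (inlW y t))
    (g : P → (x : Q) → (w : (closedData Q A P hP).W x) → G x w)
    (h : P → (x : Q) → (w : (closedData Q A P hP).W x) → isProp (G x w))
    (x : Q) (w : (closedData Q A P hP).W x) : G x w :=
  cv (lem 32 [q, a, c, l] (closedElimT q a c l) Q (fam A) P hP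
    (cv (lam (B := fun x => (closedData Q A P hP).W x ⇒ univ l) fun x => lam fun w => G x w))
    (cv (lam fun x => lam fun y => lam fun t => f x y t))
    (cv (lam fun p => lam fun x => lam fun w => g p x w))
    (cv (lam fun p => lam fun x => lam fun w => h p x w)) x (cv w))

def closedElimEntry : Entry where
  stmt := (closedElimT (.v 0) (.v 1) (.v 2) (.v 3)).stmt
  proof := .direct <| E.pf (A := (closedElimT (.v 0) (.v 1) (.v 2) (.v 3)).tm) <|
    lam fun Q => lam fun A => lam fun P => lam fun hP => lam fun G => lam fun f => lam fun g =>
    lam fun h => lam fun x => lam fun w =>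
      let D := closedData Q (fun x => A x) P hP
      D.elim (fun x w => G x w)
        (fun x s t _ => app (sumElim (A := A x) (B := P)
          (fun s => pi (D.Args D.Wf x (cv s)) fun t => G x (D.sup x (cv s) t))
          (fun y => lam fun t => f x y t) (fun p => lam fun t => g p x _) (cv s)) t)
        (fun x p w => h (cv p) x w) x w

abbrev closedElim₂T (q a c l : Lvl) := pi (univ q) fun Q => pi (Q ⇒ univ a) fun A =>
  pi (univ c) fun P => pi (isProp P) fun hP =>
  pi (pi Q fun x => (closedData Q (fun x => A x) P hP).W x ⇒ pi Q fun x' =>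
    (closedData Q (fun x => A x) P hP).W x' ⇒ univ l) fun G =>
  (pi Q fun x => pi (A x) fun y => pi (InlArgs (fun x => A x) P hP y) fun t =>
    pi Q fun x' => pi (A x') fun y' => pi (InlArgs (fun x => A x) P hP y') fun t' =>
      G x (inlW y t) x' (inlW y' t')) ⇒
  (P ⇒ pi Q fun x => pi ((closedData Q (fun x => A x) P hP).W x) fun w =>
    pi Q fun x' => pi ((closedData Q (fun x => A x) P hP).W x') fun w' => G x w x' w') ⇒
  (pi Q fun x => pi ((closedData Q (fun x => A x) P hP).W x) fun w => pi Q fun x' =>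
    pi ((closedData Q (fun x => A x) P hP).W x') fun w' => isProp (G x w x' w')) ⇒
  pi Q fun x => pi ((closedData Q (fun x => A x) P hP).W x) fun w =>
    pi Q fun x' => pi ((closedData Q (fun x => A x) P hP).W x') fun w' => G x w x' w'

/-- `closedElim` for two elements. -/
def closedElim₂ {Q : Ty q} {A : Q → Ty a} {P : Ty c} {hP : isProp P}
    (G : (x : Q) → (closedData Q A P hP).W x → (x' : Q) → (closedData Q A P hP).W x' → Ty l)
    (f : (x : Q) → (y : A x) → (t : InlArgs A P hP y) → (x' : Q) → (y' : A x') →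
      (t' : InlArgs A P hP y') → G x (inlW y t) x' (inlW y' t'))
    (g : P → (x : Q) → (w : (closedData Q A P hP).W x) → (x' : Q) →
      (w' : (closedData Q A P hP).W x') → G x w x' w')
    (h : (x : Q) → (w : (closedData Q A P hP).W x) → (x' : Q) →
      (w' : (closedData Q A P hP).W x') → isProp (G x w x' w')) :
    pi Q fun x => pi ((closedData Q A P hP).W x) fun w =>
      pi Q fun x' => pi ((closedData Q A P hP).W x') fun w' => G x w x' w' :=
  cv (lem 33 [q, a, c, l] (closedElim₂T q a c l) Q (fam A) P hP
    (cv (lam (B := fun x => (closedData Q A P hP).W x ⇒ pi Q fun x' =>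
      (closedData Q A P hP).W x' ⇒ univ l) fun x => lam fun w => lam fun x' => lam fun w' =>
        G x w x' w'))
    (cv (lam fun x => lam fun y => lam fun t => lam fun x' => lam fun y' => lam fun t' =>
      f x y t x' y' t'))
    (cv (lam fun p => lam fun x => lam fun w => lam fun x' => lam fun w' => g p x w x' w'))
    (cv (lam fun x => lam fun w => lam fun x' => lam fun w' => h x w x' w')))

def closedElim₂Entry : Entry where
  stmt := (closedElim₂T (.v 0) (.v 1) (.v 2) (.v 3)).stmt
  proof := .direct <| E.pf (A := (closedElim₂T (.v 0) (.v 1) (.v 2) (.v 3)).tm) <|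
    lam fun Q => lam fun A => lam fun P => lam fun hP => lam fun G => lam fun f => lam fun g =>
    lam fun h => lam fun x => lam fun w =>
      let D := closedData Q (fun x => A x) P hP
      closedElim (fun x w => pi Q fun x' => pi (D.W x') fun w' => G x w x' w')
        (fun x y t => lam fun x' => lam fun w' => closedElim (fun x' w' => G x (inlW y t) x' w')
          (fun x' y' t' => f x y t x' y' t') (fun p x' w' => g p x (inlW y t) x' w')
          (fun p x' w' => h x (inlW y t) x' w') x' w')
        (fun p x w => g p x w)
        (fun p x w => truncPi fun x' => truncPi fun w' => h x w x' w') x w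

abbrev truncClosedT (m q a c : Lvl) := pi (univ q) fun Q => pi (Q ⇒ univ a) fun A =>
  pi (univ c) fun P => pi (isProp P) fun hP => isTrunc m (sg Q fun x => A x) ⇒
    (P ⇒ isTrunc m Q) ⇒ isTrunc m (closedTotal Q (fun x => A x) P hP)

abbrev wPathT (m k a b c : Lvl) := truncClosedT m k (.mx (.mx k (wLevel k a b c)) k) c ⇒
  piData k a b c fun D =>
  pi D.I fun i₀ => pi (D.S i₀) fun s₀ => pi (D.Args D.Wf i₀ s₀) fun t₀ =>
  pi D.I fun i₁ => pi (D.S i₁) fun s₁ => pi (D.Args D.Wf i₁ s₁) fun t₁ =>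
    isTrunc m (pair (B := D.Ext) i₀ (D.ext s₀ t₀) ≐ pair i₁ (D.ext s₁ t₁)) ⇒
    (D.P i₁ ⇒ isTrunc m (i₀ ≐ i₁)) ⇒
      isTrunc m (transportPath D.Wf (D.sup i₀ s₀ t₀) (D.sup i₁ s₁ t₁))

/-- The equalities of elements of the W-type inherit truncatedness from those of the total space of
the extension, and, where the W-type is a proposition, from those of the indices. The argument `T`
is `truncClosed`, which is proved by induction on `m` with `wPath` in the induction step. -/
def wPath (T : truncClosedT m k (.mx (.mx k (wLevel k a b c)) k) c) {D : Data k a b c}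
    {i₀ i₁ : D.I} {s₀ : D.S i₀} {t₀ : D.Args D.Wf i₀ s₀} {s₁ : D.S i₁} {t₁ : D.Args D.Wf i₁ s₁}
    (h : isTrunc m (pair (B := D.Ext) i₀ (D.ext s₀ t₀) ≐ pair i₁ (D.ext s₁ t₁)))
    (h' : D.P i₁ ⇒ isTrunc m (i₀ ≐ i₁)) :
    isTrunc m (transportPath D.Wf (D.sup i₀ s₀ t₀) (D.sup i₁ s₁ t₁)) :=
  appData ((lem 34 [m, k, a, b, c] (wPathT m k a b c)) T) D i₀ s₀ t₀ i₁ s₁ t₁ h h'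

def wPathEntry : Entry where
  stmt := (wPathT (.v 0) (.v 1) (.v 2) (.v 3) (.v 4)).stmt
  proof := .direct <| E.pf (A := (wPathT (.v 0) (.v 1) (.v 2) (.v 3) (.v 4)).tm) <|
    lam fun T => lamData fun D => lam fun i₀ => lam fun s₀ => lam fun t₀ => lam fun i₁ =>
    lam fun s₁ => lam fun t₁ => lam fun h => lam fun h' =>
      truncSup s₀ t₀ s₁ t₁ (cv (T (i₀ ≐ i₁)
        (fam fun p => fiberOver (D.ext s₀ t₀) (D.ext s₁ t₁) p) (D.P i₁) (D.hP i₁)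
        (cv (truncFibers (fun v => cong (fun z : D.Z => fst z) v) h)) h'))

abbrev contrTotalT (q a c : Lvl) := pi (univ q) fun Q => pi (Q ⇒ univ a) fun A =>
  pi (univ c) fun P => pi (isProp P) fun hP =>
  pi (closedTotal Q (fun x => A x) P hP) fun o =>
  (pi Q fun x => pi (A x) fun y => pi (InlArgs (fun x => A x) P hP y) fun t =>
    o ≐ pair x (inlW y t)) ⇒
  (P ⇒ isTrunc .z (closedTotal Q (fun x => A x) P hP)) ⇒
    isTrunc .z (closedTotal Q (fun x => A x) P hP)

/-- The total space of `x ↦ P ⋆ A x` is contractible if it is so when `P` holds and there is an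
element that is equal to all elements that come from `A`. -/
def contrTotalEntry : Entry where
  stmt := (contrTotalT (.v 0) (.v 1) (.v 2)).stmt
  proof := .direct <| E.pf (A := (contrTotalT (.v 0) (.v 1) (.v 2)).tm) <|
    lam fun Q => lam fun A => lam fun P => lam fun hP => lam fun o => lam fun f => lam fun h =>
      let T := closedTotal Q (fun x => A x) P hP
      ofContr <| pair o <| lam fun z' => sgElim (fun z' : T => o ≐ z')
        (fun x w => closedElim (fun x w => o ≐ pair x w) (fun x y t => f x y t)
          (fun p x w => propPath (cv (truncSucc (h p))) o (pair x w))
          (fun p x w => cv (paths (m := .s .z) (truncSucc (truncSucc (h p))) o (pair x w))) x w)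
        z'

/-- An element of the total space of `x ↦ A x`, as one of the total space of `x ↦ P ⋆ A x`. -/
def inlTotal {Q : Ty q} {A : Q → Ty a} {P : Ty c} {hP : isProp P} (z : sg Q A) :
    closedTotal Q A P hP :=
  pair (fst z) (inlW (snd z) (noArgs _))

abbrev supTotalPathT (k a b c : Lvl) := piData k a b c fun D => pi D.Z fun z => pi D.Z fun z' =>
  z ≐ z' ⇒ pair (B := D.W) (fst z) (D.supE (snd z)) ≐ pair (fst z') (D.supE (snd z'))

def supTotalPath {D : Data k a b c} {z z' : D.Z} (p : z ≐ z') :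
    pair (B := D.W) (fst z) (D.supE (snd z)) ≐ pair (fst z') (D.supE (snd z')) :=
  appData (lem 36 [k, a, b, c] (supTotalPathT k a b c)) D z z' p

def supTotalPathEntry : Entry where
  stmt := (supTotalPathT (.v 0) (.v 1) (.v 2) (.v 3)).stmt
  proof := .direct <| E.pf (A := (supTotalPathT (.v 0) (.v 1) (.v 2) (.v 3)).tm) <|
    lamData fun D => lam fun z => lam fun z' => lam fun p =>
      cong (fun z : D.Z => pair (B := D.W) (fst z) (D.supE (snd z))) p

abbrev inlTotalPathT (q a c : Lvl) := pi (univ q) fun Q => pi (Q ⇒ univ a) fun A =>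
  pi (univ c) fun P => pi (isProp P) fun hP => pi (sg Q fun x => A x) fun z =>
    pi Q fun x => pi (A x) fun y => pi (InlArgs (fun x => A x) P hP y) fun t =>
      z ≐ pair x y ⇒ (inlTotal z : closedTotal Q (fun x => A x) P hP) ≐ pair x (inlW y t)

def inlTotalPathEntry : Entry where
  stmt := (inlTotalPathT (.v 0) (.v 1) (.v 2)).stmt
  proof := .direct <| E.pf (A := (inlTotalPathT (.v 0) (.v 1) (.v 2)).tm) <|
    lam fun Q => lam fun A => lam fun P => lam fun hP => lam fun z => lam fun x => lam fun y =>
    lam fun t => lam fun p =>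
      let D := closedData Q (fun x => A x) P hP
      cv (supTotalPath (D := D)
        (lem 18 [.v 0, .v 1, .v 2] (inlPathT (.v 0) (.v 1) (.v 2)) Q A P hP z (noArgs _)
          (pair x y) (cv t) p))

/-- The total space of `x ↦ P ⋆ A x` is as truncated as that of `A`, if `P` implies that `Q` is as
truncated. -/
def truncClosed (m q a c : Lvl) : truncClosedT m q a c :=
  lem 38 [m, q, a, c] (truncClosedT m q a c)

/-- The family `x ↦ P ⋆ A x` is itself a propositional indexed W-type, so in the induction step its
equalities are computed by `wPath`; the codes are again of the form `P ⋆ A'`, where `A'` consists of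
equalities in the extension. These have the lower truncation level by `inlTrunc`, and the induction
hypothesis applies. -/
def truncClosedEntry : Entry where
  stmt := (truncClosedT (.v 0) (.v 1) (.v 2) (.v 3)).stmt
  proof := .induction
    (E.pf (A := (truncClosedT .z (.v 1) (.v 2) (.v 3)).tm) <|
      lam fun Q => lam fun A => lam fun P => lam fun hP => lam fun H => lam fun K =>
        unpack (cv H : sg (sg Q fun x => A x) fun z => pi (sg Q fun x => A x) fun z' => z ≐ z')
          fun z e => lem 35 [.v 1, .v 2, .v 3] (contrTotalT (.v 1) (.v 2) (.v 3)) Q A P hP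
            (inlTotal z)
            (lam fun x => lam fun y => lam fun t =>
              lem 37 [.v 1, .v 2, .v 3] (inlTotalPathT (.v 1) (.v 2) (.v 3)) Q A P hP z x y t
                (e (pair x y)))
            (lam fun p => truncClosedOf p (K p)))
    (E.pf (A := (truncClosedT (.s (.v 0)) (.v 1) (.v 2) (.v 3)).tm) <|
      lam fun Q => lam fun A => lam fun P => lam fun hP => lam fun H => lam fun K =>
        let D := closedData Q (fun x => A x) P hP
        let M : Lvl := .v 0
        truncTotal (cv (closedElim₂ (fun x w x' w' => isTrunc M (transportPath D.Wf w w'))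
          (fun x y t x' y' t' => cv (wPath (D := D) (i₀ := x) (i₁ := x')
            (truncClosed M (.v 1)
              (.mx (.mx (.v 1) (wLevel (.v 1) (.mx (.v 2) (.v 3)) .z (.v 3))) (.v 1)) (.v 3))
            (lem 19 [M, .v 1, .v 2, .v 3] (inlTruncT M (.v 1) (.v 2) (.v 3)) Q A P hP H
              x y t x' y' t')
            (lam fun p => paths (K (cv p)) x x')))
          (fun p x w x' w' => truncPropPath (cv p) (paths (K p) x x'))
          (fun _ _ _ _ => isPropTrunc))))

def truncWEntries : List Entry :=
  [truncTotalEntry, truncOfContrEntry, truncPropPathEntry, closedElimEntry, closedElim₂Entry,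
    wPathEntry, contrTotalEntry, supTotalPathEntry, inlTotalPathEntry, truncClosedEntry]

/-! ### The equality of types -/

/-- The identity equivalence. -/
def idEquiv (A : Ty i) : equiv A A := ⟨IdEquiv i A.tm⟩

def truncEquiv {A B : Ty i} (h : isTrunc (.s m) B) : isTrunc (.s m) (equiv A B) :=
  truncSg (truncPi fun _ => h) fun f => truncOfProp (cv (truncPi (m := .s .z) fun y : B =>
    (isPropTrunc (m := .z) (A := sg A fun x => f x ≐ y))))

/-- A type is truncated if it is so as soon as it has an element. -/
def truncOfSelf {A : Ty i} (h : A → isTrunc (.s m) A) : isTrunc (.s m) A :=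
  ofPaths <| lam fun x => lam fun y => paths (h x) x y

/-- The subuniverse of `n`-types. -/
abbrev nTypes (U : Ty k) (El : U ⇒ univ l) : Ty (.mx k l) :=
  sg U fun X => isTrunc (.s (.s .n)) (El X)

abbrev nTypesPathT (k l : Lvl) := pi (univ k) fun U => pi (U ⇒ univ l) fun El =>
  univalentFor U El ⇒ pi (nTypes U El) fun x => pi (nTypes U El) fun y =>
    isTrunc (.s .n) (El (fst x)) ⇒ isTrunc (.s .n) (El (fst y)) ⇒
      equiv (El (fst x)) (El (fst y)) ⇒ x ≐ y

/-- Equivalent `(n-1)`-types are equal in the subuniverse of `n`-types. -/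
def nTypesPath {U : Ty k} {El : U ⇒ univ l} (hU : univalentFor U El) {x y : nTypes U El}
    (hx : isTrunc (.s .n) (El (fst x))) (hy : isTrunc (.s .n) (El (fst y)))
    (f : equiv (El (fst x)) (El (fst y))) : x ≐ y :=
  lem 39 [k, l] (nTypesPathT k l) U El hU x y hx hy f

def nTypesPathEntry : Entry where
  stmt := (nTypesPathT (.v 0) (.v 1)).stmt
  proof := .direct <| E.pf (A := (nTypesPathT (.v 0) (.v 1)).tm) <|
    lam fun U => lam fun El => lam fun hU =>
      let N := nTypes U El
      let C : N → N → Ty _ := fun x y => isTrunc (.s .n) (El (fst x)) ⇒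
        isTrunc (.s .n) (El (fst y)) ⇒ equiv (El (fst x)) (El (fst y)) ⇒ x ≐ y
      let B : U → Ty _ := fun X => isTrunc (.s (.s .n)) (El X)
      -- the truncatedness proof in the second component does not matter
      let fix : (X : U) → (H H' : B X) → pair (B := B) X H ≐ pair X H' := fun X H H' =>
        cong (fun H => pair (B := B) X H) (propPath isPropTrunc H H')
      lam fun x => lam fun y => sgElim (fun x => C x y) (fun X Hx =>
        cv (sgElim (fun y : N => C (pair X Hx) y) (fun Y Hy =>
          lam fun hx => lam fun hy => lam fun f =>
            let x' : truncUniv U El := pair X (cv hx)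
            let y' : truncUniv U El := pair Y (cv hy)
            concat (fix X Hx (truncSucc (cv hx)))
              (concat
                (cv (cong (fun x : truncUniv U El => pair (B := B) (fst x) (truncSucc (snd x)))
                  (pathOfEquiv hU (x := x') (y := y') (cv f))))
                (fix Y (truncSucc (cv hy)) Hy))) y)) x

abbrev truncNTypesT (k l : Lvl) := pi (univ k) fun U => pi (U ⇒ univ l) fun El =>
  univalentFor U El ⇒ pi (nTypes U El) fun x => pi (nTypes U El) fun y =>
    isTrunc (.s .n) (El (fst y)) ⇒ isTrunc (.s .n) (x ≐ y)

/-- The equality of an `n`-type and an `(n-1)`-type is an `(n-1)`-type, even though univalence is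
available for `(n-1)`-types only: if there is an equality at all, then both are `(n-1)`-types. -/
def truncNTypes {U : Ty k} {El : U ⇒ univ l} (hU : univalentFor U El) {x y : nTypes U El}
    (h : isTrunc (.s .n) (El (fst y))) : isTrunc (.s .n) (x ≐ y) :=
  lem 40 [k, l] (truncNTypesT k l) U El hU x y h

def truncNTypesEntry : Entry where
  stmt := (truncNTypesT (.v 0) (.v 1)).stmt
  proof := .direct <| E.pf (A := (truncNTypesT (.v 0) (.v 1)).tm) <|
    lam fun U => lam fun El => lam fun hU => lam fun x => lam fun y => lam fun h =>
      truncOfSelf fun p =>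
        let hx : isTrunc (.s .n) (El (fst x)) :=
          cv (transport (fam fun y : nTypes U El => isTrunc (.s .n) (El (fst y))) (sym p) (cv h))
        let C : nTypes U El → Ty _ := fun y => sg (isTrunc (.s .n) (El (fst y))) fun _ =>
          equiv (El (fst x)) (El (fst y))
        truncCode C (pair hx (idEquiv _))
          (fun y c => nTypesPath hU hx (fst c) (cv (snd c))) y
          (truncSg (truncOfProp isPropTrunc) fun _ => truncEquiv h)

def nTypesEntries : List Entry := [nTypesPathEntry, truncNTypesEntry]

/-! ### Truncatedness of the type of codes -/

/-- The container `(S, Pos)` retains truncatedness: `HoTT.Retains`, for symbolic levels. -/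
def Retains (o k a m : Lvl) (I S Pos : H) : H :=
  Pi (arr I (Univ m)) fun F =>
  Pi I fun i₀ => Pi I fun i₁ =>
  Pi (ap S [i₀]) fun s₀ => Pi (Args I Pos F i₀ s₀) fun t₀ =>
  Pi (ap S [i₁]) fun s₁ => Pi (Args I Pos F i₁ s₁) fun t₁ =>
  arr
    (Pi I fun j₀ => Pi I fun j₁ =>
      Pi (ap Pos [i₀, s₀, j₀]) fun p₀ => Pi (ap Pos [i₁, s₁, j₁]) fun p₁ =>
      IsTrunc m (.s o) (Sig k m (Eq k I j₀ j₁) fun q =>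
        Eq m (ap F [j₁]) (Transport k m I F j₀ j₁ q (ap t₀ [j₀, p₀])) (ap t₁ [j₁, p₁])))
    (let E : H → H := fun i => Ext a m I S Pos F i
     let el : H → H → H → H := fun i s t =>
      Pair k m I E i (Pair a m (ap S [i]) (fun s => Args I Pos F i s) s t)
     IsTrunc m (.s o) (Eq m (Sig k m I E) (el i₀ s₀ t₀) (el i₁ s₁ t₁)))

/-- The container retains `n`-truncatedness, for the family `W`. -/
abbrev RetainsW (D : Data k a b c) :=
  pi D.I fun i₀ => pi D.I fun i₁ =>
  pi (D.S i₀) fun s₀ => pi (D.Args D.Wf i₀ s₀) fun t₀ =>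
  pi (D.S i₁) fun s₁ => pi (D.Args D.Wf i₁ s₁) fun t₁ =>
    (pi D.I fun j₀ => pi D.I fun j₁ => pi (D.Pos i₀ s₀ j₀) fun p₀ => pi (D.Pos i₁ s₁ j₁) fun p₁ =>
      isTrunc (.s .n) (transportPath D.Wf (D.arg t₀ j₀ p₀) (D.arg t₁ j₁ p₁))) ⇒
    isTrunc (.s .n) (pair (B := D.Ext) i₀ (D.ext s₀ t₀) ≐ pair i₁ (D.ext s₁ t₁))

abbrev truncWT (k a b c : Lvl) := piData k a b c fun D => RetainsW D ⇒
  (pi D.I fun i₀ => pi D.I fun i₁ => D.P i₁ ⇒ isTrunc (.s .n) (i₀ ≐ i₁)) ⇒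
    isTrunc (.s (.s .n)) (sg D.I fun i => D.W i)

/-- The total space of a propositional indexed W-type is an `n`-type if its container retains
`n`-truncatedness and the equalities `i₀ = i₁` with `P i₁` are `(n-1)`-types. -/
def truncW {D : Data k a b c} (R : RetainsW D)
    (h : pi D.I fun i₀ => pi D.I fun i₁ => D.P i₁ ⇒ isTrunc (.s .n) (i₀ ≐ i₁)) :
    isTrunc (.s (.s .n)) (sg D.I fun i => D.W i) :=
  appData (lem 41 [k, a, b, c] (truncWT k a b c)) D R h

/-- By induction on both elements; the induction hypothesis on the first one suffices for the
arguments, as it holds for all second elements. -/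
def truncWEntry : Entry where
  stmt := (truncWT (.v 0) (.v 1) (.v 2) (.v 3)).stmt
  proof := .direct <| E.pf (A := (truncWT (.v 0) (.v 1) (.v 2) (.v 3)).tm) <|
    lamData fun D => lam fun R => lam fun h =>
      truncTotal (lam fun i₀ => lam fun w₀ => D.elim
        (fun i₀ w₀ => pi D.I fun i₁ => pi (D.W i₁) fun w₁ =>
          isTrunc (.s .n) (transportPath D.Wf w₀ w₁))
        (fun i₀ s₀ t₀ ih => lam fun i₁ => lam fun w₁ => D.elim
          (fun i₁ w₁ => isTrunc (.s .n) (transportPath D.Wf (D.sup i₀ s₀ t₀) w₁))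
          (fun i₁ s₁ t₁ _ => wPath (truncClosed _ _ _ _)
            (R i₀ i₁ s₀ t₀ s₁ t₁ (lam fun j₀ => lam fun j₁ => lam fun p₀ => lam fun p₁ =>
              ih j₀ p₀ j₁ (D.arg t₁ j₁ p₁)))
            (h i₀ i₁))
          (fun _ _ _ => isPropTrunc) i₁ w₁)
        (fun _ _ _ => truncPi fun _ => truncPi fun _ => isPropTrunc) i₀ w₀)

/-- The container retains `n`-truncatedness. -/
def retains (D : Data k a b c) : Ty (.mx (.mx k (.s (wLevel k a b c))) (wLevel k a b c)) :=
  ⟨Retains .n k a (wLevel k a b c) D.I.tm D.S.tm D.Pos.tm⟩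

/-- The statement of the theorem at symbolic levels. -/
abbrev truncVT (k l a b c : Lvl) := pi (univ k) fun U => pi (U ⇒ univ l) fun El =>
  univalentFor U El ⇒ pi (nTypes U El ⇒ univ a) fun S => pi (posTy b (nTypes U El) S) fun Pos =>
  pi (nTypes U El ⇒ univ c) fun P => pi (pi (nTypes U El) fun X => isProp (P X)) fun hP =>
  retains ⟨nTypes U El, S, Pos, P, hP⟩ ⇒
  (pi (nTypes U El) fun X => P X ⇒ isTrunc (.s .n) (El (fst X))) ⇒
    isTrunc (i := wLevel (.mx k l) a b c) (.s (.s .n))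
      ⟨(sg (nTypes U El) fun X => Data.W ⟨nTypes U El, S, Pos, P, hP⟩ X).tm⟩

def truncVEntry : Entry where
  stmt := (truncVT (.v 0) (.v 1) (.v 2) (.v 3) (.v 4)).stmt
  proof := .direct <| E.pf (A := (truncVT (.v 0) (.v 1) (.v 2) (.v 3) (.v 4)).tm) <|
    lam fun U => lam fun El => lam fun hU => lam fun S => lam fun Pos => lam fun P =>
    lam fun hP => lam fun R => lam fun h =>
      let D : Data (.mx (.v 0) (.v 1)) (.v 2) (.v 3) (.v 4) := ⟨nTypes U El, S, Pos, P, hP⟩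
      cv <| truncW (D := D)
        (cv (app (cv R : pi (D.I ⇒ univ _) fun _ => RetainsW D) D.Wf))
        (lam fun x => lam fun y => lam fun p => truncNTypes hU (h y p))

/-- The checked statement denotes the statement `HoTT.VTruncated`. -/
theorem eval_truncVEntry (n k l a b c : ℕ) : HoTT.VTruncated n k l a b c 0 =
    truncVEntry.stmt.eval noLemmas n (fun i => [k, l, a, b, c].getD i 0) := by
  -- The type formers of the surface syntax are irreducible.
  with_unfolding_all rfl

def truncVEntries : List Entry := [truncWEntry, truncVEntry]

/-! ### The checked derivation -/

/-- The lemmas of the derivation, in the order in which they are proved. -/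
def allEntries : List Entry :=
  truncEntries ++ univEntries ++ closedEntries ++ codeEntries ++ truncWEntries ++ nTypesEntries ++
    truncVEntries

set_option maxRecDepth 100000 in
/-- The whole derivation is type-checked, by evaluation of the verified checker in the kernel. -/
theorem checkAll_allEntries : checkAll [] allEntries = true := by decide +kernel

theorem truncVEntry_mem : truncVEntry ∈ allEntries :=
  List.mem_append_right _ (by simp [truncVEntries])

end HoTT.Sym

theorem mainTheorem4 (n k l a b c : ℕ) :
    HoTT.Provable n (HoTT.VTruncated n k l a b c) :=
  (HoTT.Sym.thm_of_checkAll HoTT.Sym.allEntries (env := []) (by simp)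
    HoTT.Sym.checkAll_allEntries HoTT.Sym.truncVEntry.stmt
    (List.mem_append_right _ (List.mem_map_of_mem HoTT.Sym.truncVEntry_mem))).provable
    (fun i => [k, l, a, b, c].getD i 0) (HoTT.Sym.eval_truncVEntry n k l a b c)
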